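/- Let $P$ be a finite metacyclic $2$-group, i.e. $P$ has a cyclic normal subgroup with cyclic quotient. Saturated fusion systems are taken in the sense of Broto–Levi–Oliver, and two fusion systems $\mathcal F,\mathcal F'$ on $P$ are isomorphic if some $\alpha\in\mathrm{Aut}(P)$ satisfies $\mathrm{Hom}_{\mathcal F'}(\alpha(Q),\alpha(R))=\alpha\,\mathrm{Hom}_{\mathcal F}(Q,R)\,\alpha^{-1}$ for all subgroups $Q,R\le P$. Let $\mathcal F_P(P)$ be the fusion system on $P$ whose morphisms are the maps induced by conjugation by elements of $P$. 1. If $P$ is dihedral (of order at least $8$) or generalized quaternion of order at least $16$, then there are, up to isomorphism, exactly three saturated fusion systems on $P$. If $P\cong Q_8$, there are exactly two. 2. If $P$ is semidihedral (of order at least $16$), then there are, up to isomorphism, exactly four saturated fusion systems on $P$. 3. If $P\cong C_{2^n}\times C_{2^n}$ for some $n\ge 1$, then there are, up to isomorphism, exactly two saturated fusion systems on $P$. 4. If $P$ is none of the above groups (dihedral of order at least $8$, generalized quaternion of order at least $8$, semidihedral, $C_{2^n}\times C_{2^n}$ with $n\ge 1$), then there is a unique saturated fusion system on $P$, namely $\mathcal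 F_P(P)$. -/

import Mathlib

/-- A fusion system on a group `P`: a category whose objects are the subgroups of `P`, whose
morphisms are injective group homomorphisms, which contains every map induced by conjugation in
`P`, and in which every morphism is an isomorphism of the category followed by an inclusion. -/
@[ext]
structure FusionSystem (P : Type*) [Group P] where
  /-- The set of morphisms from `Q` to `R`. -/
  Hom : (Q R : Subgroup P) → Set (Q →* R)
  injective_of_mem : ∀ {Q R : Subgroup P} {φ : Q →* R}, φ ∈ Hom Q R → Function.Injective φ
  /-- Conjugation by `g ∈ P` is a morphism `Q → R` whenever it maps `Q` into `R`; with `g = 1`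
  this gives the identities and the inclusions. -/
  conj_mem : ∀ {Q R : Subgroup P} (g : P) (φ : Q →* R),
    (∀ x : Q, (φ x : P) = g * x * g⁻¹) → φ ∈ Hom Q R
  comp_mem : ∀ {Q R S : Subgroup P} {φ : Q →* R} {ψ : R →* S},
    φ ∈ Hom Q R → ψ ∈ Hom R S → ψ.comp φ ∈ Hom Q S
  /-- The target of a morphism may be replaced by any subgroup that contains its image (such as
  the image itself). -/
  codRestrict_mem : ∀ {Q R S : Subgroup P} {φ : Q →* R} (ψ : Q →* S),
    φ ∈ Hom Q R → (∀ x : Q, (ψ x : P) = φ x) → ψ ∈ Hom Q S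
  /-- The inverse of a bijective morphism is a morphism. -/
  symm_mem : ∀ {Q R : Subgroup P} (e : Q ≃* R),
    e.toMonoidHom ∈ Hom Q R → e.symm.toMonoidHom ∈ Hom R Q

namespace FusionSystem

variable {P : Type*} [Group P]

/-- The trivial fusion system `F_P(P)`: its morphisms are the maps induced by conjugation
in `P`. -/
def inner (P : Type*) [Group P] : FusionSystem P where
  Hom Q R := {φ | ∃ g : P, ∀ x : Q, (φ x : P) = g * x * g⁻¹}
  injective_of_mem := by
    rintro Q R φ ⟨g, hg⟩ x y hxy
    have h : g * (x : P) * g⁻¹ = g * y * g⁻¹ := by rw [← hg, ← hg, hxy]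
    exact Subtype.ext (by simpa using h)
  conj_mem g φ h := ⟨g, h⟩
  comp_mem := by
    rintro Q R S φ ψ ⟨g, hg⟩ ⟨k, hk⟩
    exact ⟨k * g, fun x => by simp [hk, hg, mul_assoc]⟩
  codRestrict_mem := by
    rintro Q R S φ ψ ⟨g, hg⟩ h
    exact ⟨g, fun x => by rw [h, hg]⟩
  symm_mem := by
    rintro Q R e ⟨g, hg⟩
    refine ⟨g⁻¹, fun x => ?_⟩
    have h : ((e (e.symm x) : R) : P) = g * (e.symm x : P) * g⁻¹ := hg (e.symm x)
    rw [e.apply_symm_apply] at h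
    rw [h]
    simp [mul_assoc]

variable (F : FusionSystem P)

/-- `Q` and `R` are isomorphic in the category `F`. -/
def IsConj (Q R : Subgroup P) : Prop :=
  ∃ e : Q ≃* R, e.toMonoidHom ∈ F.Hom Q R

/-- `Q` is fully `F`-normalized. -/
def IsFullyNormalized (Q : Subgroup P) : Prop :=
  ∀ R : Subgroup P, F.IsConj Q R →
    Nat.card (Subgroup.normalizer (R : Set P)) ≤ Nat.card (Subgroup.normalizer (Q : Set P))

/-- `Q` is fully `F`-centralized. -/
def IsFullyCentralized (Q : Subgroup P) : Prop :=
  ∀ R : Subgroup P, F.IsConj Q R →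
    Nat.card (Subgroup.centralizer (R : Set P)) ≤ Nat.card (Subgroup.centralizer (Q : Set P))

/-- `Aut_F(Q)`, the group of automorphisms of `Q` in the category `F`. -/
def aut (Q : Subgroup P) : Subgroup (MulAut Q) where
  carrier := {α | MulEquiv.toMonoidHom α ∈ F.Hom Q Q}
  one_mem' := F.conj_mem 1 _ (fun x => by simp)
  mul_mem' {a b} ha hb := F.comp_mem (φ := MulEquiv.toMonoidHom b)
    (ψ := MulEquiv.toMonoidHom a) hb ha
  inv_mem' {a} ha := F.symm_mem a ha

/-- `Aut_P(Q)`, the group of automorphisms of `Q` induced by conjugation by the elements of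
`N_P(Q)`. -/
def autP (Q : Subgroup P) : Subgroup (MulAut Q) :=
  Q.normalizerMonoidHom.range

/-- The subgroup `N_φ = {g ∈ N_P(Q) | φ c_g φ⁻¹ ∈ Aut_P(R)}` of `P`, for an isomorphism
`φ : Q → R`. -/
def extender {Q R : Subgroup P} (φ : Q ≃* R) : Subgroup P :=
  ((autP R).comap ((MulAut.congr φ).toMonoidHom.comp Q.normalizerMonoidHom)).map
    (Subgroup.normalizer (Q : Set P)).subtype

theorem le_extender {Q R : Subgroup P} (φ : Q ≃* R) : Q ≤ extender φ := by
  intro q hq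
  have hn : q ∈ Subgroup.normalizer (Q : Set P) := Subgroup.le_normalizer hq
  refine Subgroup.mem_map.2 ⟨⟨q, hn⟩, Subgroup.mem_comap.2 ?_, rfl⟩
  refine MonoidHom.mem_range.2
    ⟨⟨(φ ⟨q, hq⟩ : P), Subgroup.le_normalizer (φ ⟨q, hq⟩).2⟩, MulEquiv.ext fun y => ?_⟩
  have h : (Q.normalizerMonoidHom ⟨q, hn⟩) (φ.symm y) = ⟨q, hq⟩ * φ.symm y * ⟨q, hq⟩⁻¹ := rfl
  change _ = φ ((Q.normalizerMonoidHom ⟨q, hn⟩) (φ.symm y))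
  rw [h, map_mul, map_mul, map_inv, φ.apply_symm_apply]
  rfl

/-- `F` is saturated (with respect to the prime `p`):
every fully normalized subgroup `Q` is fully centralized and `Aut_P(Q)` is a Sylow `p`-subgroup
of `Aut_F(Q)`; and every isomorphism `φ : Q → R` in `F` onto a fully centralized subgroup `R`
extends to a morphism `N_φ → P` in `F`. -/
structure IsSaturated (p : ℕ) : Prop where
  fullyCentralized : ∀ Q : Subgroup P, F.IsFullyNormalized Q → F.IsFullyCentralized Q
  sylow : ∀ Q : Subgroup P, F.IsFullyNormalized Q →
    ∃ S : Sylow p (F.aut Q), (S : Subgroup (F.aut Q)) = (autP Q).subgroupOf (F.aut Q)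
  extension : ∀ (Q R : Subgroup P) (φ : Q ≃* R), φ.toMonoidHom ∈ F.Hom Q R →
    F.IsFullyCentralized R →
      ∃ ψ ∈ F.Hom (extender φ) ⊤,
        ∀ x : Q, (ψ (Subgroup.inclusion (le_extender φ) x) : P) = φ x

/-- The homomorphism `α φ α⁻¹ : α(Q) → α(R)`. -/
def transport (α : P ≃* P) {Q R : Subgroup P} (φ : Q →* R) :
    Q.map α.toMonoidHom →* R.map α.toMonoidHom :=
  (α.subgroupMap R).toMonoidHom.comp (φ.comp (α.subgroupMap Q).symm.toMonoidHom)

/-- `F` and `F'` are isomorphic fusion systems: some automorphism `α` of `P` satisfies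
`Hom_{F'}(α(Q), α(R)) = α Hom_F(Q, R) α⁻¹` for all `Q` and `R`. -/
def IsIsomorphic (F F' : FusionSystem P) : Prop :=
  ∃ α : P ≃* P, ∀ (Q R : Subgroup P) (φ : Q →* R),
    φ ∈ F.Hom Q R ↔ transport α φ ∈ F'.Hom (Q.map α.toMonoidHom) (R.map α.toMonoidHom)

theorem transport_apply (α : P ≃* P) {Q R : Subgroup P} (φ : Q →* R) (x : P) (hx : x ∈ Q)
    (hx' : α x ∈ Q.map α.toMonoidHom) : (transport α φ ⟨α x, hx'⟩ : P) = α (φ ⟨x, hx⟩) := by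
  have h : (α.subgroupMap Q).symm ⟨α x, hx'⟩ = ⟨x, hx⟩ :=
    (MulEquiv.symm_apply_eq _).2 (Subtype.ext rfl)
  change α (φ ((α.subgroupMap Q).symm ⟨α x, hx'⟩)) = _
  rw [h]

theorem mem_iff_of_coe_eq (F : FusionSystem P) {Q R Q' R' : Subgroup P} (hQ : Q = Q')
    (hR : R = R') (φ : Q →* R) (ψ : Q' →* R')
    (h : ∀ (x : P) (hx : x ∈ Q) (hx' : x ∈ Q'), (φ ⟨x, hx⟩ : P) = ψ ⟨x, hx'⟩) :
    φ ∈ F.Hom Q R ↔ ψ ∈ F.Hom Q' R' := by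
  subst hQ hR
  have : φ = ψ := MonoidHom.ext fun x => Subtype.ext (h x x.2 x.2)
  rw [this]

theorem IsIsomorphic.refl (F : FusionSystem P) : F.IsIsomorphic F := by
  refine ⟨MulEquiv.refl P, fun Q R φ => ?_⟩
  refine F.mem_iff_of_coe_eq (Subgroup.map_id Q).symm (Subgroup.map_id R).symm _ _
    fun x hx hx' => ?_
  exact (transport_apply (MulEquiv.refl P) φ x hx hx').symm

theorem IsIsomorphic.symm {F F' : FusionSystem P} (h : F.IsIsomorphic F') :
    F'.IsIsomorphic F := by
  obtain ⟨α, hα⟩ := h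
  have hm : ∀ Q : Subgroup P, Q = (Q.map α.symm.toMonoidHom).map α.toMonoidHom := fun Q => by
    ext x
    simp [Subgroup.mem_map]
  refine ⟨α.symm, fun Q R φ => ?_⟩
  rw [hα]
  refine F'.mem_iff_of_coe_eq (hm Q) (hm R) _ _ fun x hx hx' => ?_
  have hy : α.symm x ∈ Q.map α.symm.toMonoidHom := Subgroup.mem_map_of_mem _ hx
  have h1 := transport_apply α.symm φ x hx hy
  have h2 := transport_apply α (transport α.symm φ) (α.symm x) hy
    (Subgroup.mem_map_of_mem _ hy)
  have h3 : (⟨x, hx'⟩ : (Q.map α.symm.toMonoidHom).map α.toMonoidHom) =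
      ⟨α (α.symm x), Subgroup.mem_map_of_mem α.toMonoidHom hy⟩ :=
    Subtype.ext (α.apply_symm_apply x).symm
  rw [h3]
  exact (h2.trans ((congrArg α h1).trans (α.apply_symm_apply _))).symm

theorem IsIsomorphic.trans {F F' F'' : FusionSystem P} (h : F.IsIsomorphic F')
    (h' : F'.IsIsomorphic F'') : F.IsIsomorphic F'' := by
  obtain ⟨α, hα⟩ := h
  obtain ⟨β, hβ⟩ := h'
  have hm : ∀ Q : Subgroup P, (Q.map α.toMonoidHom).map β.toMonoidHom =
      Q.map (α.trans β).toMonoidHom := fun Q => Subgroup.map_map Q _ _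
  refine ⟨α.trans β, fun Q R φ => ?_⟩
  rw [hα, hβ]
  refine F''.mem_iff_of_coe_eq (hm Q) (hm R) _ _ ?_
  rintro _ ⟨_, ⟨x, hx, rfl⟩, rfl⟩ hx'
  have h1 := transport_apply α φ x hx (Subgroup.mem_map_of_mem _ hx)
  have h2 := transport_apply β (transport α φ) (α x) (Subgroup.mem_map_of_mem _ hx)
    (Subgroup.mem_map_of_mem _ (Subgroup.mem_map_of_mem _ hx))
  have h3 := transport_apply (α.trans β) φ x hx hx'
  exact h2.trans ((congrArg β h1).trans h3.symm)

/-- Isomorphism as an equivalence relation on the saturated fusion systems on `P`. -/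
def saturatedSetoid (p : ℕ) (P : Type*) [Group P] :
    Setoid {F : FusionSystem P // F.IsSaturated p} where
  r F F' := F.1.IsIsomorphic F'.1
  iseqv := ⟨fun F => .refl F.1, fun h => h.symm, fun h h' => h.trans h'⟩

/-- The number of saturated fusion systems on `P`, up to isomorphism. -/
noncomputable def numSaturated (p : ℕ) (P : Type*) [Group P] : ℕ :=
  Nat.card (Quotient (saturatedSetoid p P))

end FusionSystem

/-- `P` is metacyclic: it has a cyclic normal subgroup with cyclic quotient. -/
def IsMetacyclic (P : Type*) [Group P] : Prop :=
  ∃ (N : Subgroup P) (_ : N.Normal), IsCyclic N ∧ IsCyclic (P ⧸ N)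

/-- `P` is a dihedral `2`-group, of order `2 ^ (n + 1) ≥ 8`. -/
def IsDihedralTwoGroup (P : Type*) [Group P] : Prop :=
  ∃ n : ℕ, 2 ≤ n ∧ Nonempty (P ≃* DihedralGroup (2 ^ n))

/-- `P` is a generalized quaternion `2`-group, of order `2 ^ (n + 2) ≥ 8`. -/
def IsQuaternionTwoGroup (P : Type*) [Group P] : Prop :=
  ∃ n : ℕ, 1 ≤ n ∧ Nonempty (P ≃* QuaternionGroup (2 ^ n))

/-- `P` is a semidihedral `2`-group, of order `2 ^ n ≥ 16`: it has this order and generators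
satisfying the relations `r ^ (2 ^ (n - 1)) = s ^ 2 = 1` and
`s * r * s⁻¹ = r ^ (2 ^ (n - 2) - 1)`, which define a group of order `2 ^ n`. -/
def IsSemidihedralTwoGroup (P : Type*) [Group P] : Prop :=
  ∃ n : ℕ, 4 ≤ n ∧ Nat.card P = 2 ^ n ∧
    ∃ r s : P, Subgroup.closure {r, s} = ⊤ ∧ r ^ 2 ^ (n - 1) = 1 ∧ s ^ 2 = 1 ∧
      s * r * s⁻¹ = r ^ (2 ^ (n - 2) - 1)

/-- `P` is isomorphic to `C_{2^n} × C_{2^n}` for some `n ≥ 1`. -/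
def IsHomocyclicTwoGroup (P : Type*) [Group P] : Prop :=
  ∃ n : ℕ, 1 ≤ n ∧
    Nonempty (P ≃* Multiplicative (ZMod (2 ^ n)) × Multiplicative (ZMod (2 ^ n)))

/-!
A saturated fusion system `F` is generated by the automorphism groups `Aut_F(Q)` of its fully
normalized subgroups `Q` (Alperin's argument, `FusionSystem.IsSaturated.hom_subset_of_aut_le`),
and by Sylow's axiom only those `Q` matter for which `Aut_F(Q)` is not a `2`-group, hence contains
a nontrivial automorphism of odd order. Subgroups of metacyclic groups are metacyclic, and a
metacyclic `2`-group with such an automorphism is `C_{2^n} × C_{2^n}` or `Q_8`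
(`exists_generator_pair_of_odd_mulAut`): the automorphism permutes the three maximal subgroups, so
the given cyclic normal subgroup `⟨a⟩` and its image generate the group, and their intersection is
central and fixed by the automorphism, which leaves these two cases.

If `P` is not homocyclic, a homocyclic subgroup `Q` of exponent at least `4` has an element of its
normalizer, outside `Q`, which acts trivially modulo squares, and therefore all its automorphisms
in `F` extend to larger subgroups. The same holds for a four-group that does not contain its
centralizer. A self-centralizing four-group, or a subgroup `Q_8`, forces `P` to have a cyclic
subgroup of index `2` inverted, up to an involution, by the other elements
(`IsMaxClassGenerator`), that is, to be dihedral, generalized quaternion or semidihedral. In all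
other cases `F` is therefore `F_P(P)` (`FusionSystem.IsSaturated.eq_inner`).

Let now `P` be of maximal class with cyclic maximal subgroup `⟨a⟩`, and not `Q_8`. Every `y`
outside `⟨a⟩` has order `2` or `4` and lies in one `essentialSubgroup a y`, a four-group or a
`Q_8`; these are the only subgroups that can have an automorphism of odd order, and they form two
conjugacy classes. If `Aut_F(E)` has an element of odd order, it is all of `Aut(E)`, so `F` is
determined by the set of classes where this happens (`EssentialFamily.exists_eq_fusionSystem`).
Conversely, every conjugation invariant family of essential subgroups generates a fusion system
with an explicit description of its morphisms (`EssentialFamily.IsMor`), which is saturated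
(`EssentialFamily.isSaturated`). This gives four fusion systems. In the semidihedral case the two
classes have members of orders `4` and `8`, so no two of the four are isomorphic; in the dihedral
and quaternion cases an automorphism of `P` exchanges the two classes, and three remain up to
isomorphism.

If `P` is homocyclic or `Q_8`, every morphism of a saturated fusion system is the restriction of
an automorphism of `P`, and the group of these automorphisms is generated by the inner ones and
possibly one of order three. The automorphisms of order three are conjugate in `Aut(P)`, so there
are two fusion systems (`FusionSystem.numSaturated_eq_two`).
-/

/-! ### Morphisms of fusion systems and Alperin's induction -/

namespace FusionSystem

variable {P : Type*} [Group P]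

/-- Fusion systems are determined by their morphism sets, one inclusion at a time. -/
theorem ext_of_subset {F G : FusionSystem P} (h : ∀ Q R, F.Hom Q R ⊆ G.Hom Q R)
    (h' : ∀ Q R, G.Hom Q R ⊆ F.Hom Q R) : F = G :=
  FusionSystem.ext (funext fun Q => funext fun R => Set.Subset.antisymm (h Q R) (h' Q R))

variable (F : FusionSystem P)

theorem restrict_mem {Q R Q' S : Subgroup P} {φ : Q →* R} (hφ : φ ∈ F.Hom Q R) (hQ : Q' ≤ Q)
    (ψ : Q' →* S) (h : ∀ x : Q', (ψ x : P) = φ (Subgroup.inclusion hQ x)) : ψ ∈ F.Hom Q' S :=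
  F.codRestrict_mem ψ (F.comp_mem (F.conj_mem 1 (Subgroup.inclusion hQ) (by simp)) hφ) h

theorem exists_equiv_of_mem {Q R : Subgroup P} {φ : Q →* R} (hφ : φ ∈ F.Hom Q R) :
    ∃ (S : Subgroup P) (e : Q ≃* S), e.toMonoidHom ∈ F.Hom Q S ∧ ∀ x, (e x : P) = φ x := by
  have hinj : Function.Injective (R.subtype.comp φ) :=
    R.subtype_injective.comp (F.injective_of_mem hφ)
  exact ⟨_, MonoidHom.ofInjective hinj, F.codRestrict_mem _ hφ fun _ => rfl, fun _ => rfl⟩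

theorem IsConj.symm {F : FusionSystem P} {Q R : Subgroup P} (h : F.IsConj Q R) : F.IsConj R Q := by
  obtain ⟨e, he⟩ := h
  exact ⟨e.symm, F.symm_mem e he⟩

theorem IsConj.trans {F : FusionSystem P} {Q R S : Subgroup P} (h : F.IsConj Q R)
    (h' : F.IsConj R S) : F.IsConj Q S := by
  obtain ⟨e, he⟩ := h
  obtain ⟨e', he'⟩ := h'
  exact ⟨e.trans e', F.comp_mem he he'⟩

theorem IsConj.refl (Q : Subgroup P) : F.IsConj Q Q :=
  ⟨MulEquiv.refl Q, F.conj_mem 1 _ (by simp)⟩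

theorem IsConj.card_eq {F : FusionSystem P} {Q R : Subgroup P} (h : F.IsConj Q R) :
    Nat.card Q = Nat.card R :=
  Nat.card_congr h.choose.toEquiv

theorem mem_autP {Q : Subgroup P} {α : MulAut Q} :
    α ∈ autP Q ↔ ∃ g ∈ Subgroup.normalizer (Q : Set P), ∀ x : Q, (α x : P) = g * x * g⁻¹ := by
  constructor
  · rintro ⟨⟨g, hg⟩, rfl⟩
    exact ⟨g, hg, fun x => rfl⟩
  · rintro ⟨g, hg, h⟩
    exact ⟨⟨g, hg⟩, MulEquiv.ext fun x => Subtype.ext (h x).symm⟩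

theorem mem_normalizer_of_conj [Finite P] {Q : Subgroup P} {g : P}
    (h : ∀ x ∈ Q, g * x * g⁻¹ ∈ Q) : g ∈ Subgroup.normalizer (Q : Set P) := by
  have hmap : Q.map (MulAut.conj g).toMonoidHom = Q := by
    refine Subgroup.eq_of_le_of_card_ge ?_ (le_of_eq ?_)
    · rintro _ ⟨x, hx, rfl⟩
      exact h x hx
    · exact Nat.card_congr (Q.equivMapOfInjective _ (MulAut.conj g).injective).toEquiv
  refine Subgroup.mem_normalizer_iff.2 fun x => ⟨h x, fun hx => ?_⟩
  have hx' : g * x * g⁻¹ ∈ Q.map (MulAut.conj g).toMonoidHom := by rwa [hmap]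
  obtain ⟨y, hy, hxy⟩ := hx'
  have : y = x := (MulAut.conj g).injective hxy
  rwa [← this]

theorem mem_autP' [Finite P] {Q : Subgroup P} {α : MulAut Q} :
    α ∈ autP Q ↔ ∃ g : P, ∀ x : Q, (α x : P) = g * x * g⁻¹ := by
  refine mem_autP.trans ⟨fun ⟨g, _, h⟩ => ⟨g, h⟩, fun ⟨g, h⟩ => ⟨g, ?_, h⟩⟩
  exact mem_normalizer_of_conj fun x hx => (h ⟨x, hx⟩) ▸ (α ⟨x, hx⟩).2

theorem autP_le_aut (Q : Subgroup P) : autP Q ≤ F.aut Q := by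
  intro α hα
  obtain ⟨g, -, h⟩ := mem_autP.1 hα
  exact F.conj_mem g _ h

theorem isPGroup_autP {p : ℕ} (hP : IsPGroup p P) (Q : Subgroup P) : IsPGroup p (autP Q) :=
  (hP.to_subgroup _).of_surjective _ Q.normalizerMonoidHom.rangeRestrict_surjective

theorem mem_extender {Q R : Subgroup P} (φ : Q ≃* R) (g : P) :
    g ∈ extender φ ↔ ∃ hg : g ∈ Subgroup.normalizer (Q : Set P),
      MulAut.congr φ (Q.normalizerMonoidHom ⟨g, hg⟩) ∈ autP R := by
  constructor
  · rintro ⟨⟨g, hg⟩, h, rfl⟩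
    exact ⟨hg, h⟩
  · rintro ⟨hg, h⟩
    exact ⟨⟨g, hg⟩, h, rfl⟩

theorem extender_le_normalizer {Q R : Subgroup P} (φ : Q ≃* R) :
    extender φ ≤ Subgroup.normalizer (Q : Set P) := fun g hg => ((mem_extender φ g).1 hg).1

theorem exists_fullyNormalized [Finite P] (Q : Subgroup P) :
    ∃ R, F.IsConj Q R ∧ F.IsFullyNormalized R := by
  obtain ⟨R, hR, hmax⟩ := Set.exists_max_image {R | F.IsConj Q R}
    (fun R => Nat.card (Subgroup.normalizer (R : Set P))) (Set.toFinite _) ⟨Q, IsConj.refl F Q⟩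
  exact ⟨R, hR, fun S hS => hmax S (IsConj.trans hR hS)⟩

variable {F}

/-- In a saturated fusion system, an isomorphism onto a fully normalized subgroup can be chosen
so that it extends to the normalizer: by Sylow's theorem it may be corrected by an automorphism
of the target until it carries `Aut_P(Q)` into `Aut_P(R)`. -/
theorem IsSaturated.exists_extension_normalizer [Finite P] {p : ℕ} [Fact p.Prime]
    (hP : IsPGroup p P) (hF : F.IsSaturated p) {Q R : Subgroup P} (hQR : F.IsConj Q R)
    (hR : F.IsFullyNormalized R) :
    ∃ e : Q ≃* R, e.toMonoidHom ∈ F.Hom Q R ∧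
      ∃ ψ ∈ F.Hom (Subgroup.normalizer (Q : Set P)) ⊤,
        ∀ x : Q, (ψ (Subgroup.inclusion Subgroup.le_normalizer x) : P) = e x := by
  obtain ⟨e, he⟩ := hQR
  obtain ⟨S, hS⟩ := hF.sylow R hR
  have hT : IsPGroup p ((((autP Q).map (MulAut.congr e).toMonoidHom)).subgroupOf (F.aut R)) :=
    ((isPGroup_autP hP Q).map _).comap_subtype
  obtain ⟨S', hS'⟩ := hT.exists_le_sylow
  obtain ⟨β, hβ⟩ := MulAction.exists_smul_eq (F.aut R) S' S
  let e' : Q ≃* R := e.trans β.1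
  have he' : e'.toMonoidHom ∈ F.Hom Q R := F.comp_mem he β.2
  have hext : extender e' = Subgroup.normalizer (Q : Set P) := by
    refine le_antisymm (extender_le_normalizer e') fun g hg => (mem_extender e' g).2 ⟨hg, ?_⟩
    have hc : Q.normalizerMonoidHom ⟨g, hg⟩ ∈ autP Q := ⟨_, rfl⟩
    have hc' : MulAut.congr e (Q.normalizerMonoidHom ⟨g, hg⟩) ∈ F.aut R :=
      F.comp_mem (F.comp_mem (F.symm_mem e he) (autP_le_aut F Q hc)) he
    have h1 : (⟨_, hc'⟩ : F.aut R) ∈ S' := hS' (Subgroup.mem_subgroupOf.2 ⟨_, hc, rfl⟩)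
    have h2 : β * ⟨_, hc'⟩ * β⁻¹ ∈ (S : Subgroup (F.aut R)) := by
      rw [← hβ]
      exact Subgroup.smul_mem_pointwise_smul _ (MulAut.conj β) _ h1
    rw [hS, Subgroup.mem_subgroupOf] at h2
    exact h2
  obtain ⟨ψ, hψ, hx⟩ := hF.extension Q R e' he' (hF.fullyCentralized R hR)
  refine ⟨e', he', ψ.comp (Subgroup.inclusion hext.ge), F.restrict_mem hψ hext.ge _ fun _ => rfl,
    fun x => hx x⟩

theorem lt_normalizer [Finite P] {p : ℕ} [Fact p.Prime] (hP : IsPGroup p P) {Q : Subgroup P}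
    (hQ : Q ≠ ⊤) : Q < Subgroup.normalizer (Q : Set P) := by
  have := hP.isNilpotent
  exact Group.normalizerCondition_of_isNilpotent Q (lt_top_iff_ne_top.2 hQ)

/-- Alperin's fusion theorem in inductive form: to show that the saturated fusion system `F` is
contained in `G`, it is enough to treat the automorphisms of the fully normalized subgroups `Q`,
and one may assume that all morphisms of `F` on larger subgroups belong to `G`. -/
theorem IsSaturated.hom_subset_of_aut_le [Finite P] {p : ℕ} [Fact p.Prime] (hP : IsPGroup p P)
    (hF : F.IsSaturated p) (G : FusionSystem P)
    (h : ∀ Q, F.IsFullyNormalized Q →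
      (∀ R S : Subgroup P, Nat.card Q < Nat.card R → F.Hom R S ⊆ G.Hom R S) → F.aut Q ≤ G.aut Q) :
    ∀ Q R, F.Hom Q R ⊆ G.Hom Q R := by
  suffices H : ∀ n, ∀ Q R : Subgroup P, Nat.card P - Nat.card Q = n → F.Hom Q R ⊆ G.Hom Q R from
    fun Q R => H _ Q R rfl
  intro n
  induction n using Nat.strong_induction_on with
  | _ n ih =>
  intro Q R hn φ hφ
  have hbig : ∀ R S : Subgroup P, Nat.card Q < Nat.card R → F.Hom R S ⊆ G.Hom R S := by
    intro R S hR
    have h1 := Subgroup.card_le_card_group R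
    exact ih (Nat.card P - Nat.card R) (by omega) R S rfl
  obtain ⟨S, e, he, hex⟩ := F.exists_equiv_of_mem hφ
  refine G.codRestrict_mem (φ := e.toMonoidHom) φ ?_ fun x => (hex x).symm
  by_cases hQ : Q = ⊤
  · have hS : S = Q := by
      rw [hQ]
      refine Subgroup.eq_top_of_le_card S ?_
      rw [← Nat.card_congr e.toEquiv, hQ, Subgroup.card_top]
    subst hS
    refine h S (fun R hR => ?_) hbig he
    have hR : R = S := by
      rw [hQ]
      refine Subgroup.eq_top_of_le_card R ?_
      rw [← hR.card_eq, hQ, Subgroup.card_top]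
    rw [hR]
  · obtain ⟨T, hT, hTn⟩ := F.exists_fullyNormalized Q
    have key : ∀ Q' : Subgroup P, F.IsConj Q' T → ∃ e : Q' ≃* T, e.toMonoidHom ∈ F.Hom Q' T ∧
        e.toMonoidHom ∈ G.Hom Q' T := by
      intro Q' hQ'
      have hcard : Nat.card Q' = Nat.card Q := by rw [hQ'.card_eq, hT.card_eq]
      have hne : Q' ≠ ⊤ := by
        rintro rfl
        refine hQ (Subgroup.eq_top_of_le_card Q ?_)
        rw [← hcard, Subgroup.card_top]
      obtain ⟨e, he, ψ, hψ, hex⟩ := hF.exists_extension_normalizer hP hQ' hTn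
      refine ⟨e, he, G.restrict_mem (hbig _ _ ?_ hψ) Subgroup.le_normalizer _
        fun x => (hex x).symm⟩
      rw [← hcard]
      have hlt := lt_normalizer hP hne
      exact lt_of_not_ge fun hle => hlt.ne (Subgroup.eq_of_le_of_card_ge hlt.le hle)
    obtain ⟨e₁, h₁, h₁'⟩ := key Q hT
    obtain ⟨e₂, h₂, h₂'⟩ := key S (IsConj.trans (IsConj.symm ⟨e, he⟩) hT)
    have hα : ((e₁.symm.trans e).trans e₂ : MulAut T) ∈ F.aut T :=
      F.comp_mem (F.comp_mem (F.symm_mem e₁ h₁) he) h₂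
    have hα' := h T hTn (fun R S hR => hbig R S (by rwa [hT.card_eq])) hα
    have hcomp := G.comp_mem (G.comp_mem h₁' hα') (G.symm_mem e₂ h₂')
    refine G.codRestrict_mem _ hcomp fun x => ?_
    change (e x : P) = e₂.symm (e₂ (e (e₁.symm (e₁ x))))
    rw [e₂.symm_apply_apply, e₁.symm_apply_apply]

/-- If `Aut_F(Q)` is a `p`-group, then Sylow's axiom makes all its elements inner. -/
theorem IsSaturated.aut_le_autP {p : ℕ} (hF : F.IsSaturated p) {Q : Subgroup P}
    (hQ : F.IsFullyNormalized Q) (h : IsPGroup p (F.aut Q)) : F.aut Q ≤ autP Q := by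
  obtain ⟨S, hS⟩ := hF.sylow Q hQ
  have : (⊤ : Subgroup (F.aut Q)) = S := S.is_maximal' (h.to_subgroup ⊤) le_top
  rw [hS] at this
  intro α hα
  have h2 : (⟨α, hα⟩ : F.aut Q) ∈ (⊤ : Subgroup (F.aut Q)) := trivial
  rw [this] at h2
  exact h2

theorem autP_le_of_inner {G : FusionSystem P} {Q : Subgroup P} (h : F.aut Q ≤ autP Q) :
    F.aut Q ≤ G.aut Q := h.trans (autP_le_aut G Q)

theorem extender_eq_of_mem_autP [Finite P] {Q R : Subgroup P} (φ : Q ≃* R)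
    (h : ∃ g : P, ∀ x : Q, (φ x : P) = g * x * g⁻¹) :
    ∃ ψ ∈ F.Hom (extender φ) ⊤,
      ∀ x : Q, (ψ (Subgroup.inclusion (le_extender φ) x) : P) = φ x := by
  obtain ⟨g, hg⟩ := h
  refine ⟨(((MulAut.conj g).toMonoidHom.comp (extender φ).subtype).codRestrict ⊤
    fun _ => Subgroup.mem_top _), F.conj_mem g _ fun _ => rfl, fun x => (hg x).symm⟩

/-- If `Aut_F(Q)` consists of conjugation maps, `Aut_P(Q)` is a Sylow subgroup of it, because it is
the whole group. -/
theorem exists_sylow_of_aut_le {p : ℕ} (hP : IsPGroup p P) {Q : Subgroup P}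
    (h : F.aut Q ≤ autP Q) :
    ∃ S : Sylow p (F.aut Q), (S : Subgroup (F.aut Q)) = (autP Q).subgroupOf (F.aut Q) := by
  refine ⟨⟨(autP Q).subgroupOf (F.aut Q), (isPGroup_autP hP Q).comap_subtype, ?_⟩, rfl⟩
  intro T _ hT
  refine le_antisymm (fun x _ => h x.2) hT

end FusionSystem

/-! ### Fusion systems all of whose morphisms extend to the whole group -/

namespace FusionSystem

variable {P : Type*} [Group P]

/-- The fusion system whose morphisms are the restrictions of the elements of a group `A` of
automorphisms of `P` containing the inner ones. If `H` is a complement of the inner automorphisms in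
`A` of order prime to `p`, this is the fusion system of the semidirect product of `P` by `H`. -/
def ofAut (A : Subgroup (MulAut P)) (hA : (MulAut.conj : P →* MulAut P).range ≤ A) :
    FusionSystem P where
  Hom Q R := {φ | ∃ α ∈ A, ∀ x : Q, (φ x : P) = α x}
  injective_of_mem := by
    rintro Q R φ ⟨α, -, h⟩ x y hxy
    exact Subtype.ext (α.injective (by rw [← h, ← h, hxy]))
  conj_mem g φ h := ⟨MulAut.conj g, hA ⟨g, rfl⟩, h⟩
  comp_mem := by
    rintro Q R S φ ψ ⟨α, hα, h⟩ ⟨β, hβ, h'⟩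
    exact ⟨β * α, A.mul_mem hβ hα, fun x => by simp [h', h]⟩
  codRestrict_mem := by
    rintro Q R S φ ψ ⟨α, hα, h⟩ h'
    exact ⟨α, hα, fun x => (h' x).trans (h x)⟩
  symm_mem := by
    rintro Q R e ⟨α, hα, h⟩
    refine ⟨α⁻¹, A.inv_mem hα, fun x => ?_⟩
    have h1 : ((e (e.symm x) : R) : P) = α (e.symm x : P) := h (e.symm x)
    rw [e.apply_symm_apply] at h1
    rw [h1]
    exact (α.symm_apply_apply _).symm

theorem mem_ofAut {A : Subgroup (MulAut P)} {hA : (MulAut.conj : P →* MulAut P).range ≤ A}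
    {Q R : Subgroup P} {φ : Q →* R} :
    φ ∈ (ofAut A hA).Hom Q R ↔ ∃ α ∈ A, ∀ x : Q, (φ x : P) = α x := Iff.rfl

theorem inner_eq_ofAut : inner P = ofAut (MulAut.conj : P →* MulAut P).range le_rfl := by
  refine ext_of_subset ?_ ?_
  · rintro Q R φ ⟨g, hg⟩
    exact ⟨MulAut.conj g, ⟨g, rfl⟩, hg⟩
  · rintro Q R φ ⟨_, ⟨g, rfl⟩, hg⟩
    exact ⟨g, hg⟩

theorem isSaturated_ofAut [Finite P] {p : ℕ} [Fact p.Prime] (hP : IsPGroup p P)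
    (A : Subgroup (MulAut P)) (hA : (MulAut.conj : P →* MulAut P).range ≤ A)
    (hodd : ∀ α ∈ A, ∃ k, p.Coprime k ∧ α ^ k ∈ (MulAut.conj : P →* MulAut P).range) :
    (ofAut A hA).IsSaturated p := by
  refine ⟨fun Q _ R hQR => ?_, fun Q _ => ?_, fun Q R φ hφ _ => ?_⟩
  · obtain ⟨e, α, -, h⟩ := hQR
    refine Nat.card_le_card_of_injective
      (fun g : Subgroup.centralizer (R : Set P) =>
        (⟨α.symm g, ?_⟩ : Subgroup.centralizer (Q : Set P))) ?_
    · refine Subgroup.mem_centralizer_iff.2 fun x hx => α.injective ?_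
      have h1 : (α x : P) ∈ R := (h ⟨x, hx⟩) ▸ (e ⟨x, hx⟩).2
      rw [map_mul, map_mul, MulEquiv.apply_symm_apply]
      exact Subgroup.mem_centralizer_iff.1 g.2 _ h1
    · intro g g' hgg
      exact Subtype.ext (α.symm.injective (Subtype.ext_iff.1 hgg))
  · refine ⟨⟨(autP Q).subgroupOf ((ofAut A hA).aut Q), (isPGroup_autP hP Q).comap_subtype, ?_⟩, rfl⟩
    intro T hT hle
    refine le_antisymm (fun τ hτ => ?_) hle
    obtain ⟨α, hα, h⟩ := τ.2
    obtain ⟨k, hk, g, hg⟩ := hodd α hα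
    obtain ⟨n, hn⟩ := (IsPGroup.iff_orderOf.1 hT) ⟨τ, hτ⟩
    rw [Subgroup.orderOf_mk] at hn
    obtain ⟨m, hm⟩ := exists_pow_eq_self_of_coprime (x := τ) (n := k)
      (by rw [hn]; exact (hk.pow_left n).symm)
    have hpow : ∀ j : ℕ, ∀ x : Q, (((τ : MulAut Q) ^ j) x : P) = (α ^ j) x := by
      intro j
      induction j with
      | zero => intro x; rfl
      | succ j ih =>
        intro x
        rw [pow_succ', pow_succ', MulAut.mul_apply, MulAut.mul_apply, ← ih]
        exact h _
    rw [← hm]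
    refine pow_mem (Subgroup.mem_subgroupOf.2 (mem_autP'.2 ⟨g, fun x => ?_⟩)) m
    change ((((τ : MulAut Q) ^ k) x : Q) : P) = _
    rw [hpow, ← hg]
    rfl
  · obtain ⟨α, hα, h⟩ := hφ
    exact ⟨(α.toMonoidHom.comp (extender φ).subtype).codRestrict ⊤ fun _ => Subgroup.mem_top _,
      ⟨α, hα, fun _ => rfl⟩, fun x => (h x).symm⟩

theorem isSaturated_inner [Finite P] {p : ℕ} [Fact p.Prime] (hP : IsPGroup p P) :
    (inner P).IsSaturated p := by
  rw [inner_eq_ofAut]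
  exact isSaturated_ofAut hP _ _ fun α hα => ⟨1, by simp, by simpa using hα⟩

theorem ofAut_isIsomorphic {A A' : Subgroup (MulAut P)}
    (hA : (MulAut.conj : P →* MulAut P).range ≤ A)
    (hA' : (MulAut.conj : P →* MulAut P).range ≤ A') (e : P ≃* P)
    (h : ∀ β, β ∈ A ↔ MulAut.congr e β ∈ A') : (ofAut A hA).IsIsomorphic (ofAut A' hA') := by
  refine ⟨e, fun Q R φ => ⟨?_, ?_⟩⟩
  · rintro ⟨α, hα, hφ⟩
    refine ⟨_, (h α).1 hα, ?_⟩
    rintro ⟨_, x, hx, rfl⟩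
    refine (transport_apply e φ x hx _).trans ?_
    change e _ = e (α (e.symm (e x)))
    rw [e.symm_apply_apply, hφ]
  · rintro ⟨α', hα', hφ⟩
    obtain ⟨α, rfl⟩ := (MulAut.congr e).surjective α'
    refine ⟨α, (h α).2 hα', fun x => e.injective ?_⟩
    have hx : e x ∈ Q.map e.toMonoidHom := Subgroup.mem_map_of_mem e.toMonoidHom x.2
    refine ((transport_apply e φ x x.2 hx).symm.trans (hφ ⟨e x, hx⟩)).trans ?_
    change e (α (e.symm (e x))) = _
    rw [e.symm_apply_apply]

/-! ### Counting isomorphism classes -/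

theorem numSaturated_eq_card {p : ℕ} {ι : Type*} (f : ι → FusionSystem P)
    (hs : ∀ i, (f i).IsSaturated p) (hne : ∀ i j, (f i).IsIsomorphic (f j) → i = j)
    (hall : ∀ F : FusionSystem P, F.IsSaturated p → ∃ i, F.IsIsomorphic (f i)) :
    numSaturated p P = Nat.card ι := by
  refine (Nat.card_eq_of_bijective
    (fun i => (Quotient.mk (saturatedSetoid p P) ⟨f i, hs i⟩)) ⟨fun i j hij => ?_, ?_⟩).symm
  · exact hne i j (Quotient.exact hij)
  · intro q
    induction q using Quotient.inductionOn with
    | _ F =>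
      obtain ⟨i, hi⟩ := hall F.1 F.2
      exact ⟨i, Quotient.sound hi.symm⟩

/-- An isomorphism of fusion systems carries `Aut_F(Q)` to the group of automorphisms of the image
of `Q`; in particular it preserves whether this group is a `p`-group. -/
theorem isPGroup_aut_map_iff {F F' : FusionSystem P} {α : P ≃* P}
    (h : ∀ (Q R : Subgroup P) (φ : Q →* R),
      φ ∈ F.Hom Q R ↔ transport α φ ∈ F'.Hom (Q.map α.toMonoidHom) (R.map α.toMonoidHom))
    (p : ℕ) (Q : Subgroup P) :
    IsPGroup p (F.aut Q) ↔ IsPGroup p (F'.aut (Q.map α.toMonoidHom)) := by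
  let c : MulAut Q ≃* MulAut (Q.map α.toMonoidHom) := MulAut.congr (α.subgroupMap Q)
  have hmap : (F.aut Q).map c.toMonoidHom = F'.aut (Q.map α.toMonoidHom) := by
    ext β
    constructor
    · rintro ⟨β, hβ, rfl⟩
      exact (h Q Q _).1 hβ
    · intro hβ
      obtain ⟨γ, rfl⟩ := c.surjective β
      exact ⟨γ, (h Q Q γ.toMonoidHom).2 hβ, rfl⟩
  let e := (F.aut Q).equivMapOfInjective c.toMonoidHom c.injective
  rw [← hmap]
  exact ⟨fun h => h.of_equiv e, fun h => h.of_equiv e.symm⟩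

end FusionSystem

/-! ### The subgroup generated by the squares -/

section SquareSubgroup

variable {G : Type*} [Group G]

/-- The subgroup of `G` generated by all squares. For a finite `2`-group it is the Frattini
subgroup. -/
def squareSubgroup (G : Type*) [Group G] : Subgroup G :=
  Subgroup.closure (Set.range fun g : G => g ^ 2)

theorem sq_mem_squareSubgroup (g : G) : g ^ 2 ∈ squareSubgroup G :=
  Subgroup.subset_closure ⟨g, rfl⟩

theorem map_squareSubgroup_le (α : G ≃* G) :
    (squareSubgroup G).map α.toMonoidHom ≤ squareSubgroup G := by
  rw [squareSubgroup, MonoidHom.map_closure, Subgroup.closure_le]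
  rintro _ ⟨_, ⟨g, rfl⟩, rfl⟩
  exact Subgroup.subset_closure ⟨α g, (map_pow α g 2).symm⟩

instance : (squareSubgroup G).Characteristic :=
  Subgroup.characteristic_iff_map_le.2 map_squareSubgroup_le

theorem map_squareSubgroup (α : G ≃* G) :
    (squareSubgroup G).map α.toMonoidHom = squareSubgroup G :=
  Subgroup.characteristic_iff_map_eq.1 inferInstance α

/-- The elements of `squareSubgroup G` are non-generators of the finite `2`-group `G`. -/
theorem eq_top_of_sup_squareSubgroup [Finite G] (hG : IsPGroup 2 G) (H : Subgroup G)
    (h : H ⊔ squareSubgroup G = ⊤) : H = ⊤ := by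
  by_contra hH
  obtain ⟨N, hN⟩ := IsPGroup.iff_card.1 hG
  obtain ⟨k, hk⟩ := IsPGroup.iff_card.1 (hG.to_subgroup H)
  have hlt : 2 ^ k < 2 ^ N := by
    rw [← hk, ← hN]
    exact lt_of_not_ge fun hle => hH (Subgroup.eq_top_of_le_card H hle)
  have hkN : k < N := (Nat.pow_lt_pow_iff_right (by norm_num)).1 hlt
  obtain ⟨K, hK, hHK⟩ := Sylow.exists_subgroup_card_pow_prime_le 2 (m := N - 1)
    (by rw [hN]; exact pow_dvd_pow 2 (Nat.sub_le N 1)) H hk (by omega)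
  have hidx : K.index = 2 := by
    have h1 := K.card_mul_index
    rw [hK, hN] at h1
    have h2 : 2 ^ N = 2 ^ (N - 1) * 2 := by rw [← pow_succ]; congr 1; omega
    rw [h2] at h1
    exact Nat.eq_of_mul_eq_mul_left (by positivity) h1
  have hle : squareSubgroup G ≤ K := by
    rw [squareSubgroup, Subgroup.closure_le]
    rintro _ ⟨g, rfl⟩
    exact Subgroup.sq_mem_of_index_two hidx g
  have htop : K = ⊤ := top_le_iff.1 (h ▸ sup_le hHK hle)
  rw [htop, Subgroup.index_top] at hidx
  omega

/-- The automorphism of `G / squareSubgroup G` induced by an automorphism of `G`. -/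
def squareQuotientAut (α : MulAut G) : MulAut (G ⧸ squareSubgroup G) :=
  QuotientGroup.congr _ _ α (map_squareSubgroup α)

@[simp]
theorem squareQuotientAut_mk (α : MulAut G) (g : G) :
    squareQuotientAut α (g : G ⧸ squareSubgroup G) = (α g : G) := rfl

theorem squareQuotient_mul_self (v : G ⧸ squareSubgroup G) : v * v = 1 := by
  induction v using QuotientGroup.induction_on with
  | H g => exact (QuotientGroup.eq_one_iff _).2 (by simpa [sq] using sq_mem_squareSubgroup g)

theorem zpow_eq_of_mul_self {V : Type*} [Group V] {v : V} (hv : v * v = 1) (i : ℤ) :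
    v ^ i = if Even i then 1 else v := by
  rcases Int.even_or_odd' i with ⟨k, rfl | rfl⟩
  · simp [zpow_mul, zpow_ofNat, sq, hv]
  · simp [zpow_add, zpow_mul, zpow_ofNat, sq, hv]

/-- An automorphism of a finite `2`-group of odd prime order that is trivial modulo squares is
trivial: it fixes a point in each coset of `squareSubgroup G`. -/
theorem false_of_prime_orderOf [Finite G] (hG : IsPGroup 2 G) {q : ℕ} (hq : q.Prime) (hq2 : q ≠ 2)
    (α : MulAut G) (hα : orderOf α = q) (h : ∀ g, g⁻¹ * α g ∈ squareSubgroup G) : False := by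
  classical
  have := Fintype.ofFinite G
  have := Fact.mk hq
  have hα1 : α ≠ 1 := by
    rintro rfl
    rw [orderOf_one] at hα
    exact hq.one_lt.ne hα
  let H : Subgroup G :=
    { carrier := {g | α g = g}
      one_mem' := map_one α
      mul_mem' := fun {x y} hx hy => (map_mul α x y).trans (by rw [hx, hy])
      inv_mem' := fun {x} hx => (map_inv α x).trans (by rw [hx]) }
  have hH : H = ⊤ := by
    refine eq_top_of_sup_squareSubgroup hG H (top_le_iff.1 fun g _ => ?_)
    have hinv : ∀ x, g⁻¹ * α x ∈ squareSubgroup G ↔ g⁻¹ * x ∈ squareSubgroup G := by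
      intro x
      have : g⁻¹ * α x = g⁻¹ * x * (x⁻¹ * α x) := by group
      rw [this]
      exact Subgroup.mul_mem_cancel_right _ (h x)
    let σ : Equiv.Perm {x // g⁻¹ * x ∈ squareSubgroup G} :=
      Equiv.Perm.subtypePerm (MulAut.toPerm G α) hinv
    have hσ : σ ^ q ^ 1 = 1 := by
      rw [pow_one, ← hα]
      have : MulAut.toPerm G α ^ orderOf α = 1 := by
        rw [← map_pow, pow_orderOf_eq_one, map_one]
      refine Equiv.ext fun x => Subtype.ext ?_
      rw [show σ ^ orderOf α = _ from Equiv.Perm.subtypePerm_pow _ _ _,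
        Equiv.Perm.subtypePerm_apply]
      exact congrArg (fun f : Equiv.Perm G => f x) this
    have hcard : ¬ q ∣ Fintype.card {x // g⁻¹ * x ∈ squareSubgroup G} := by
      have h1 : Fintype.card {x // g⁻¹ * x ∈ squareSubgroup G} = Nat.card (squareSubgroup G) := by
        rw [← Nat.card_eq_fintype_card]
        exact Nat.card_congr ((Equiv.mulLeft g⁻¹).subtypeEquiv fun x => Iff.rfl)
      obtain ⟨k, hk⟩ := IsPGroup.iff_card.1 (hG.to_subgroup (squareSubgroup G))
      rw [h1, hk]
      exact fun hd => hq2 ((Nat.prime_dvd_prime_iff_eq hq Nat.prime_two).1 (hq.dvd_of_dvd_pow hd))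
    obtain ⟨⟨x, hx⟩, hfix⟩ := Equiv.Perm.exists_fixed_point_of_prime hcard hσ
    have hxH : x ∈ H := Subtype.ext_iff.1 hfix
    have hg : g = x * (g⁻¹ * x)⁻¹ := by group
    rw [hg]
    exact mul_mem (Subgroup.mem_sup_left hxH) (Subgroup.mem_sup_right (inv_mem hx))
  refine hα1 (MulEquiv.ext fun g => ?_)
  have : g ∈ H := by rw [hH]; trivial
  exact this

/-- An automorphism of odd order of a finite `2`-group that is trivial modulo squares is
trivial. -/
theorem eq_one_of_odd_of_squareQuotient [Finite G] (hG : IsPGroup 2 G) (α : MulAut G)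
    (hα : Odd (orderOf α)) (h : squareQuotientAut α = 1) : α = 1 := by
  by_contra hne
  have h1 : orderOf α ≠ 1 := fun h => hne (orderOf_eq_one_iff.1 h)
  obtain ⟨q, hq, hdvd⟩ := Nat.exists_prime_and_dvd h1
  have h0 : orderOf α ≠ 0 := hα.pos.ne'
  have hq2 : q ≠ 2 := by
    rintro rfl
    exact Nat.not_even_iff_odd.2 hα (even_iff_two_dvd.2 hdvd)
  have hmul : ∀ n : ℕ, ∀ g, ((α ^ n) g : G ⧸ squareSubgroup G) = g := by
    intro n
    induction n with
    | zero => intro g; rfl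
    | succ n ih =>
      intro g
      rw [pow_succ', MulAut.mul_apply, ← squareQuotientAut_mk, h, MulAut.one_apply, ih]
  refine false_of_prime_orderOf hG hq hq2 (α ^ (orderOf α / q)) ?_ fun g => ?_
  · rw [orderOf_pow_of_dvd (Nat.div_pos (Nat.le_of_dvd hα.pos hdvd) hq.pos).ne'
      (Nat.div_dvd_of_dvd hdvd), Nat.div_div_self hdvd h0]
  · exact QuotientGroup.eq.1 (hmul _ g).symm

theorem odd_orderOf_pow {M : Type*} [Group M] {α : M} (h : Odd (orderOf α)) (n : ℕ) :
    Odd (orderOf (α ^ n)) :=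
  h.of_dvd_nat (orderOf_pow_dvd n)

theorem squareQuotientAut_mul (α β : MulAut G) :
    squareQuotientAut (α * β) = squareQuotientAut α * squareQuotientAut β := by
  ext v
  induction v using QuotientGroup.induction_on with
  | H g => rfl

theorem squareQuotientAut_pow (α : MulAut G) (n : ℕ) :
    squareQuotientAut (α ^ n) = squareQuotientAut α ^ n := by
  induction n with
  | zero =>
    ext v
    induction v using QuotientGroup.induction_on with
    | H g => rfl
  | succ n ih => rw [pow_succ, pow_succ, squareQuotientAut_mul, ih]

theorem mul_comm_of_mul_self {V : Type*} [Group V] (hsq : ∀ v : V, v * v = 1) (v w : V) :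
    v * w = w * v := by
  have h : ∀ v : V, v⁻¹ = v := fun v => inv_eq_of_mul_eq_one_right (hsq v)
  rw [← h (v * w), mul_inv_rev, h, h]

theorem eq_or_of_card_le_four {V : Type*} [Group V] [Finite V] (hV : Nat.card V ≤ 4)
    (hsq : ∀ v : V, v * v = 1) {v w : V} (hv : v ≠ 1) (hw : w ≠ 1) (hvw : w ≠ v) (u : V) :
    u = 1 ∨ u = v ∨ u = w ∨ u = v * w := by
  classical
  have := Fintype.ofFinite V
  have h1 : v * w ≠ 1 := fun h => hvw (mul_left_cancel (h.trans (hsq v).symm))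
  have hcard : ({1, v, w, v * w} : Finset V).card = 4 := by
    rw [Finset.card_insert_of_notMem, Finset.card_insert_of_notMem, Finset.card_pair]
    · simpa using hv
    · simp [hw, hvw.symm]
    · simp [hv.symm, hw.symm, h1.symm]
  have huniv : ({1, v, w, v * w} : Finset V) = Finset.univ := by
    refine Finset.eq_univ_of_card _ (le_antisymm (Finset.card_le_univ _) ?_)
    rw [hcard, ← Nat.card_eq_fintype_card]
    exact hV
  have := Finset.mem_univ u
  rw [← huniv] at this
  simpa using this

/-- If `G` is generated by two elements, a nontrivial automorphism of odd order permutes the three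
nontrivial cosets of `squareSubgroup G` without fixed point. -/
theorem squareQuotientAut_ne [Finite G] (hG : IsPGroup 2 G)
    (hV : Nat.card (G ⧸ squareSubgroup G) ≤ 4) {α : MulAut G} (hα : Odd (orderOf α)) (h1 : α ≠ 1)
    {v : G ⧸ squareSubgroup G} (hv : v ≠ 1) : squareQuotientAut α v ≠ v := by
  intro hfix
  have hsq := squareQuotient_mul_self (G := G)
  have htwo : squareQuotientAut (α ^ 2) = 1 := by
    rw [squareQuotientAut_pow]
    refine MulEquiv.ext fun w => ?_
    rw [sq, MulAut.mul_apply, MulAut.one_apply]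
    by_cases hw : w = 1
    · simp [hw]
    by_cases hwv : w = v
    · simp [hwv, hfix]
    rcases eq_or_of_card_le_four hV hsq hv hw hwv (squareQuotientAut α w) with h | h | h | h
    · exact absurd (by simpa using h) hw
    · exact absurd ((squareQuotientAut α).injective (h.trans hfix.symm)) hwv
    · rw [h, h]
    · rw [h, map_mul, hfix, h, ← mul_assoc, hsq, one_mul]
  have hα2 := eq_one_of_odd_of_squareQuotient hG _ (odd_orderOf_pow hα 2) htwo
  have h2 : orderOf α ∣ 2 := orderOf_dvd_of_pow_eq_one hα2
  rcases (Nat.dvd_prime Nat.prime_two).1 h2 with h | h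
  · exact h1 (orderOf_eq_one_iff.1 h)
  · rw [h] at hα
    exact absurd hα (by decide)

theorem squareQuotientAut_apply_apply [Finite G] (hG : IsPGroup 2 G)
    (hV : Nat.card (G ⧸ squareSubgroup G) ≤ 4) {α : MulAut G} (hα : Odd (orderOf α)) (h1 : α ≠ 1)
    (v : G ⧸ squareSubgroup G) :
    squareQuotientAut α (squareQuotientAut α v) = v * squareQuotientAut α v := by
  by_cases hv : v = 1
  · simp [hv]
  have hsq := squareQuotient_mul_self (G := G)
  have hne {v} := squareQuotientAut_ne hG hV hα h1 (v := v)
  have hw : squareQuotientAut α v ≠ 1 := by simpa using hv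
  rcases eq_or_of_card_le_four hV hsq hv hw (hne hv)
    (squareQuotientAut α (squareQuotientAut α v)) with h | h | h | h
  · exact absurd h (by simpa using hv)
  · refine absurd ?_ (hne (v := v * squareQuotientAut α v) fun h' => ?_)
    · rw [map_mul, h]
      have h3 := hsq (v * squareQuotientAut α v)
      rw [← mul_left_inj (v * squareQuotientAut α v), h3, mul_assoc, ← mul_assoc v v, hsq,
        one_mul, hsq]
    · exact hne hv (mul_left_cancel (h'.trans (hsq v).symm))
  · exact absurd h (hne hw)
  · exact h

theorem pow_three_eq_one_of_odd [Finite G] (hG : IsPGroup 2 G)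
    (hV : Nat.card (G ⧸ squareSubgroup G) ≤ 4) {α : MulAut G} (hα : Odd (orderOf α)) :
    α ^ 3 = 1 := by
  by_cases h1 : α = 1
  · simp [h1]
  refine eq_one_of_odd_of_squareQuotient hG _ (odd_orderOf_pow hα 3) ?_
  have hsq := squareQuotient_mul_self (G := G)
  have happ := squareQuotientAut_apply_apply hG hV hα h1
  rw [squareQuotientAut_pow]
  refine MulEquiv.ext fun v => ?_
  rw [pow_succ, sq, MulAut.mul_apply, MulAut.mul_apply, MulAut.one_apply, happ, happ,
    mul_comm_of_mul_self hsq v, ← mul_assoc, hsq, one_mul]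

end SquareSubgroup

/-! ### Cyclic `2`-groups -/

theorem mem_zpowers_of_orderOf_dvd {C : Type*} [Group C] [Finite C] [IsCyclic C] {u v : C}
    (h : orderOf u ∣ orderOf v) : u ∈ Subgroup.zpowers v := by
  classical
  have := Fintype.ofFinite C
  have h1 := IsCyclic.card_pow_eq_one_le (α := C) (orderOf_pos v)
  have hsub : (Finset.univ.filter fun x => x ∈ Subgroup.zpowers v) ⊆
      Finset.univ.filter fun x : C => x ^ orderOf v = 1 := by
    intro x hx
    have hx' := (Finset.mem_filter.1 hx).2
    exact Finset.mem_filter.2 ⟨Finset.mem_univ x,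
      orderOf_dvd_iff_pow_eq_one.1 (orderOf_dvd_of_mem_zpowers hx')⟩
  have hcard : (Finset.univ.filter fun x => x ∈ Subgroup.zpowers v).card = orderOf v := by
    rw [← Nat.card_zpowers, ← Fintype.card_subtype, Nat.card_eq_fintype_card]
  have heq := Finset.eq_of_subset_of_card_le hsub (by rw [hcard]; exact h1)
  have hu : u ∈ Finset.univ.filter fun x : C => x ^ orderOf v = 1 :=
    Finset.mem_filter.2 ⟨Finset.mem_univ u, orderOf_dvd_iff_pow_eq_one.1 h⟩
  rw [← heq] at hu
  exact (Finset.mem_filter.1 hu).2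

theorem mem_zpowers_or_mem_zpowers {C : Type*} [Group C] [Finite C] [IsCyclic C]
    (hC : IsPGroup 2 C) (u v : C) : u ∈ Subgroup.zpowers v ∨ v ∈ Subgroup.zpowers u := by
  obtain ⟨i, hi⟩ := IsPGroup.iff_orderOf.1 hC u
  obtain ⟨j, hj⟩ := IsPGroup.iff_orderOf.1 hC v
  rcases le_total i j with h | h
  · exact Or.inl (mem_zpowers_of_orderOf_dvd (by rw [hi, hj]; exact pow_dvd_pow 2 h))
  · exact Or.inr (mem_zpowers_of_orderOf_dvd (by rw [hi, hj]; exact pow_dvd_pow 2 h))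

theorem le_of_card_dvd_of_le_isCyclic {G : Type*} [Group G] [Finite G] {H K C : Subgroup G}
    [IsCyclic C] (hH : H ≤ C) (hK : K ≤ C) (h : Nat.card H ∣ Nat.card K) : H ≤ K := by
  intro x hx
  have hKc : IsCyclic K := isCyclic_of_injective _ (Subgroup.inclusion_injective hK)
  obtain ⟨k, hk⟩ := hKc.exists_generator
  have hx' : (⟨x, hH hx⟩ : C) ∈ Subgroup.zpowers (⟨k, hK k.2⟩ : C) := by
    refine mem_zpowers_of_orderOf_dvd ?_
    rw [Subgroup.orderOf_mk, Subgroup.orderOf_mk, Subgroup.orderOf_coe,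
      orderOf_eq_card_of_forall_mem_zpowers hk]
    exact (Subgroup.orderOf_dvd_natCard H hx).trans h
  obtain ⟨i, hi⟩ := hx'
  have : (k : G) ^ i = x := congrArg Subtype.val hi
  rw [← this]
  exact zpow_mem k.2 i

theorem isPGroup_mulAut_of_isCyclic {C : Type*} [Group C] [Finite C] [IsCyclic C]
    (hC : IsPGroup 2 C) : IsPGroup 2 (MulAut C) := by
  obtain ⟨k, hk⟩ := IsPGroup.iff_card.1 hC
  have hcard := IsCyclic.card_mulAut C
  rw [hk] at hcard
  cases k with
  | zero => exact IsPGroup.of_card (n := 0) (by simpa using hcard)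
  | succ k =>
    rw [Nat.totient_prime_pow_succ Nat.prime_two] at hcard
    exact IsPGroup.of_card (n := k) (by simpa using hcard)

theorem eq_one_of_odd_orderOf {M : Type*} [Group M] (hM : IsPGroup 2 M) {x : M}
    (hx : Odd (orderOf x)) : x = 1 := by
  obtain ⟨k, hk⟩ := IsPGroup.iff_orderOf.1 hM x
  cases k with
  | zero => exact orderOf_eq_one_iff.1 (by simpa using hk)
  | succ k =>
    rw [hk, pow_succ] at hx
    exact absurd hx (Nat.not_odd_iff_even.2 (even_two.mul_left _))

/-- An automorphism of odd order fixes every invariant cyclic subgroup of a finite `2`-group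
elementwise. -/
theorem apply_eq_self_of_isCyclic {G : Type*} [Group G] [Finite G] (hG : IsPGroup 2 G)
    {α : MulAut G} (hα : Odd (orderOf α)) (K : Subgroup G) [IsCyclic K]
    (hK : K.map α.toMonoidHom = K) {x : G} (hx : x ∈ K) : α x = x := by
  let β : MulAut K := (α.subgroupMap K).trans (MulEquiv.subgroupCongr hK)
  have hβ : ∀ n : ℕ, ∀ y : K, ((β ^ n) y : G) = (α ^ n) y := by
    intro n
    induction n with
    | zero => intro y; rfl
    | succ n ih =>
      intro y
      rw [pow_succ', pow_succ', MulAut.mul_apply, MulAut.mul_apply, ← ih]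
      rfl
  have hβ1 : β = 1 := by
    refine eq_one_of_odd_orderOf (isPGroup_mulAut_of_isCyclic (hG.to_subgroup K)) ?_
    refine hα.of_dvd_nat (orderOf_dvd_of_pow_eq_one (MulEquiv.ext fun y => Subtype.ext ?_))
    rw [hβ, pow_orderOf_eq_one]
    rfl
  have h := hβ 1 ⟨x, hx⟩
  rw [pow_one, pow_one, hβ1] at h
  exact h.symm

/-! ### Metacyclic `2`-groups with an automorphism of odd order -/

section OddAutomorphisms

variable {G : Type*} [Group G]

theorem IsMetacyclic.exists_generators (hm : IsMetacyclic G) :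
    ∃ a b : G, (Subgroup.zpowers a).Normal ∧ ∀ g : G, ∃ i j : ℤ, g = b ^ i * a ^ j := by
  obtain ⟨N, hN, ⟨a, ha⟩, ⟨b, hb⟩⟩ := hm
  obtain ⟨b, rfl⟩ := QuotientGroup.mk_surjective b
  have hNa : N = Subgroup.zpowers (a : G) := by
    refine le_antisymm (fun x hx => ?_) ((Subgroup.zpowers_le).2 a.2)
    obtain ⟨i, hi⟩ := ha ⟨x, hx⟩
    exact ⟨i, congrArg Subtype.val hi⟩
  refine ⟨a, b, hNa ▸ hN, fun g => ?_⟩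
  obtain ⟨i, hi⟩ := hb g
  have h1 : (b ^ i)⁻¹ * g ∈ N := QuotientGroup.eq.1 (by simpa using hi)
  rw [hNa] at h1
  obtain ⟨j, hj⟩ := h1
  refine ⟨i, j, ?_⟩
  have hj' : (a : G) ^ j = (b ^ i)⁻¹ * g := hj
  rw [hj']
  group

theorem IsMetacyclic.subgroup (hm : IsMetacyclic G) (H : Subgroup G) : IsMetacyclic H := by
  obtain ⟨N, hN, hc, hq⟩ := hm
  refine ⟨N.subgroupOf H, inferInstance, ?_, ?_⟩
  · exact isCyclic_of_injective (H.subtype.subgroupComap N) fun x y h =>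
      Subtype.ext (Subtype.ext (congrArg (fun t : N => (t : G)) h))
  · refine isCyclic_of_injective (QuotientGroup.map (N.subgroupOf H) N H.subtype le_rfl) ?_
    rw [← MonoidHom.ker_eq_bot_iff, eq_bot_iff]
    intro x hx
    induction x using QuotientGroup.induction_on with
    | H x =>
      have : (x : G) ∈ N := (QuotientGroup.eq_one_iff _).1 hx
      exact (QuotientGroup.eq_one_iff _).2 this

theorem IsMetacyclic.card_squareQuotient_le [Finite G] (hm : IsMetacyclic G) :
    Nat.card (G ⧸ squareSubgroup G) ≤ 4 := by
  obtain ⟨a, b, -, hab⟩ := hm.exists_generators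
  let f : Bool × Bool → G ⧸ squareSubgroup G := fun p =>
    (if p.1 then 1 else (b : G ⧸ squareSubgroup G)) * if p.2 then 1 else (a : G ⧸ squareSubgroup G)
  have hf : Function.Surjective f := by
    intro v
    induction v using QuotientGroup.induction_on with
    | H g =>
      obtain ⟨i, j, rfl⟩ := hab g
      refine ⟨(decide (Even i), decide (Even j)), ?_⟩
      rw [QuotientGroup.mk_mul, QuotientGroup.mk_zpow, QuotientGroup.mk_zpow,
        zpow_eq_of_mul_self (squareQuotient_mul_self _),
        zpow_eq_of_mul_self (squareQuotient_mul_self _)]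
      simp [f]
  have := Nat.card_le_card_of_surjective f hf
  simpa using this

/-- `a` and `c` are independent generators of order `2 ^ n` of an abelian group. -/
structure IsHomocyclicPair (n : ℕ) (a c : G) : Prop where
  orderOf_left : orderOf a = 2 ^ n
  orderOf_right : orderOf c = 2 ^ n
  comm : a * c = c * a
  indep : ∀ i j : ℤ, a ^ i = c ^ j → a ^ i = 1
  gen : ∀ g, ∃ i j : ℤ, g = a ^ i * c ^ j

/-- `a` and `c` generate the group and satisfy the relations of the standard generators of the
quaternion group of order `8`. -/
structure IsQuaternionPair (a c : G) : Prop where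
  sq_ne : a ^ 2 ≠ 1
  pow_four : a ^ 4 = 1
  sq_eq : c ^ 2 = a ^ 2
  conj : c * a * c⁻¹ = a⁻¹
  gen : ∀ g, ∃ i j : ℤ, g = a ^ i * c ^ j

/-- The power of a product of two elements whose commutator `u` is central. -/
theorem mul_pow_of_commutator {x y u : G} (hxy : y * x = u * x * y) (hux : u * x = x * u)
    (huy : u * y = y * u) (k : ℕ) : (x * y) ^ k = x ^ k * y ^ k * u ^ (k * (k - 1) / 2) := by
  have hy : ∀ k : ℕ, y ^ k * x = x * y ^ k * u ^ k := by
    intro k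
    induction k with
    | zero => simp
    | succ k ih =>
      have hc : u * y ^ k = y ^ k * u := (Commute.pow_right (show Commute u y from huy) k).eq
      calc y ^ (k + 1) * x = y ^ k * (y * x) := by rw [pow_succ, mul_assoc]
        _ = y ^ k * (x * y * u) := by rw [hxy, hux, mul_assoc x u y, huy, ← mul_assoc x]
        _ = (y ^ k * x) * y * u := by group
        _ = x * (y ^ k * (u ^ k * y)) * u := by rw [ih]; group
        _ = x * (y ^ k * (y * u ^ k)) * u := by
          rw [(Commute.pow_left (show Commute u y from huy) k).eq]
        _ = x * y ^ (k + 1) * u ^ (k + 1) := by rw [pow_succ y, pow_succ u]; group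
  induction k with
  | zero => simp
  | succ k ih =>
    have ht : (k + 1) * (k + 1 - 1) / 2 = k + k * (k - 1) / 2 := by
      rw [← Nat.choose_two_right, ← Nat.choose_two_right, Nat.choose_succ_succ']
      simp
    have hcx : Commute (u ^ (k * (k - 1) / 2)) x := Commute.pow_left hux _
    have hcy : Commute (u ^ (k * (k - 1) / 2)) y := Commute.pow_left huy _
    have hcyk : Commute (u ^ k) y := Commute.pow_left huy _
    calc (x * y) ^ (k + 1) = x ^ k * y ^ k * (u ^ (k * (k - 1) / 2) * x) * y := by
          rw [pow_succ, ih]; group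
      _ = x ^ k * (y ^ k * x) * (u ^ (k * (k - 1) / 2) * y) := by rw [hcx.eq]; group
      _ = x ^ k * x * y ^ k * (u ^ k * y) * u ^ (k * (k - 1) / 2) := by
          rw [hcy.eq, hy]; group
      _ = x ^ (k + 1) * y ^ (k + 1) * u ^ ((k + 1) * (k + 1 - 1) / 2) := by
          rw [hcyk.eq, ht, pow_add u, pow_succ x, pow_succ y]; group

theorem pow_eq_one_of_commutator {x y u : G} (hxy : y * x = u * x * y) (hux : u * x = x * u)
    {k : ℕ} (hk : y * x ^ k = x ^ k * y) : u ^ k = 1 := by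
  have h : y * x ^ k * y⁻¹ = u ^ k * x ^ k := by
    have h1 : y * x * y⁻¹ = u * x := by rw [hxy]; group
    rw [← conj_pow, h1, (show Commute u x from hux).mul_pow]
  rw [hk, mul_inv_cancel_right] at h
  exact (right_eq_mul.1 h)

theorem exists_generator_pair_of_odd_mulAut [Finite G] (hG : IsPGroup 2 G) (hm : IsMetacyclic G)
    {α : MulAut G} (hα : Odd (orderOf α)) (h1 : α ≠ 1) :
    ∃ a : G, (∃ n, 1 ≤ n ∧ IsHomocyclicPair n a (α a)) ∨ IsQuaternionPair a (α a) := by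
  have hV := hm.card_squareQuotient_le
  have hne {v} := squareQuotientAut_ne hG hV hα h1 (v := v)
  have happ := squareQuotientAut_apply_apply hG hV hα h1
  have hsq := squareQuotient_mul_self (G := G)
  obtain ⟨a, b, hNa, hab⟩ := hm.exists_generators
  -- If `a` were a square modulo squares, the quotient would be cyclic.
  have ha : (a : G ⧸ squareSubgroup G) ≠ 1 := by
    intro ha
    have hcyc : ∀ v : G ⧸ squareSubgroup G, v = 1 ∨ v = (b : G ⧸ squareSubgroup G) := by
      intro v
      induction v using QuotientGroup.induction_on with
      | H g =>
        obtain ⟨i, j, rfl⟩ := hab g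
        rw [QuotientGroup.mk_mul, QuotientGroup.mk_zpow, QuotientGroup.mk_zpow, ha, one_zpow,
          mul_one, zpow_eq_of_mul_self (hsq _)]
        split <;> simp
    refine h1 (eq_one_of_odd_of_squareQuotient hG α hα (MulEquiv.ext fun v => ?_))
    by_contra hv
    have hv1 : v ≠ 1 := by
      rintro rfl
      simp at hv
    rcases hcyc (squareQuotientAut α v) with h | h
    · exact hv1 (by simpa using h)
    · rcases hcyc v with h' | h'
      · exact hv1 h'
      · exact hv (h.trans h'.symm)
  set c := α a with hc
  set d := α c with hd
  have hca : (c : G ⧸ squareSubgroup G) ≠ a := hne ha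
  have hc1 : (c : G ⧸ squareSubgroup G) ≠ 1 := by
    have := (squareQuotientAut α).map_ne_one_iff.2 ha
    exact this
  have hdq : (d : G ⧸ squareSubgroup G) = a * c := happ a
  have hgen' : Subgroup.zpowers a ⊔ Subgroup.zpowers c = ⊤ := by
    refine eq_top_of_sup_squareSubgroup hG _ (top_le_iff.1 fun g _ => ?_)
    have key : ∀ h ∈ Subgroup.zpowers a ⊔ Subgroup.zpowers c,
        (g : G ⧸ squareSubgroup G) = h →
          g ∈ Subgroup.zpowers a ⊔ Subgroup.zpowers c ⊔ squareSubgroup G := by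
      intro h hh hgh
      have : g = h * (h⁻¹ * g) := by group
      rw [this]
      exact mul_mem (Subgroup.mem_sup_left hh)
        (Subgroup.mem_sup_right (QuotientGroup.eq.1 hgh.symm))
    have ha' : a ∈ Subgroup.zpowers a ⊔ Subgroup.zpowers c :=
      Subgroup.mem_sup_left (Subgroup.mem_zpowers a)
    have hc' : c ∈ Subgroup.zpowers a ⊔ Subgroup.zpowers c :=
      Subgroup.mem_sup_right (Subgroup.mem_zpowers c)
    rcases eq_or_of_card_le_four hV hsq ha hc1 hca (g : G ⧸ squareSubgroup G) with h | h | h | h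
    · exact key 1 (one_mem _) h
    · exact key a ha' h
    · exact key c hc' h
    · exact key (a * c) (mul_mem ha' hc') h
  have hgen : ∀ g, ∃ i j : ℤ, g = a ^ i * c ^ j := by
    intro g
    have hg : g ∈ Subgroup.zpowers a ⊔ Subgroup.zpowers c := by rw [hgen']; trivial
    obtain ⟨_, ⟨i, rfl⟩, _, ⟨j, rfl⟩, h⟩ := Subgroup.mem_sup_of_normal_left.1 hg
    exact ⟨i, j, h.symm⟩
  have hmapa : (Subgroup.zpowers a).map α.toMonoidHom = Subgroup.zpowers c :=
    MonoidHom.map_zpowers _ _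
  have hmapc : (Subgroup.zpowers c).map α.toMonoidHom = Subgroup.zpowers d :=
    MonoidHom.map_zpowers _ _
  have hNc : (Subgroup.zpowers c).Normal := by
    rw [← hmapa]
    exact hNa.map _ α.surjective
  have hoc : orderOf c = orderOf a := MulEquiv.orderOf_eq α a
  have hod : orderOf d = orderOf a := (MulEquiv.orderOf_eq α c).trans hoc
  obtain ⟨m, hm⟩ := IsPGroup.iff_orderOf.1 hG a
  set Z := Subgroup.zpowers a ⊓ Subgroup.zpowers c with hZ
  have hZcomm : ∀ w ∈ Z, ∀ g, w * g = g * w := by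
    rintro w ⟨⟨k, hk⟩, ⟨l, hl⟩⟩ g
    obtain ⟨i, j, rfl⟩ := hgen g
    have h2 : Commute w a := by rw [← hk]; exact (Commute.refl a).zpow_left k
    have h3 : Commute w c := by rw [← hl]; exact (Commute.refl c).zpow_left l
    exact ((h2.zpow_right i).mul_right (h3.zpow_right j)).eq
  -- The commutators of powers of `a` and `c` lie in `Z`.
  have hcommZ : ∀ i j : ℤ, c ^ j * a ^ i * (c ^ j)⁻¹ * (a ^ i)⁻¹ ∈ Z := by
    intro i j
    have hai : a ^ i ∈ Subgroup.zpowers a := ⟨i, rfl⟩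
    have hcj : c ^ j ∈ Subgroup.zpowers c := ⟨j, rfl⟩
    refine Subgroup.mem_inf.2 ⟨mul_mem (hNa.conj_mem _ hai _) (inv_mem hai), ?_⟩
    have : c ^ j * a ^ i * (c ^ j)⁻¹ * (a ^ i)⁻¹ = c ^ j * (a ^ i * (c ^ j)⁻¹ * (a ^ i)⁻¹) := by
      group
    rw [this]
    exact mul_mem hcj (hNc.conj_mem _ (inv_mem hcj) _)
  refine ⟨a, ?_⟩
  by_cases hZbot : Z = ⊥
  · left
    refine ⟨m, ?_, hm, hoc.trans hm, ?_, ?_, hgen⟩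
    · by_contra h0
      have : m = 0 := by omega
      rw [this, pow_zero, orderOf_eq_one_iff] at hm
      exact ha (by rw [hm]; rfl)
    · have := hcommZ 1 1
      rw [hZbot, Subgroup.mem_bot, zpow_one, zpow_one, mul_inv_eq_one,
        mul_inv_eq_iff_eq_mul] at this
      exact this.symm
    · intro i j hij
      have : a ^ i ∈ Z := ⟨⟨i, rfl⟩, ⟨j, hij.symm⟩⟩
      rwa [hZbot] at this
  right
  -- `α` fixes `Z` elementwise.
  have hZmap : Z.map α.toMonoidHom = Z := by
    have hinf : Z.map α.toMonoidHom = Subgroup.zpowers c ⊓ Subgroup.zpowers d := by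
      rw [hZ, Subgroup.map_inf _ _ _ α.injective, hmapa, hmapc]
    have hcard : Nat.card (Z.map α.toMonoidHom) = Nat.card Z :=
      (Nat.card_congr (Z.equivMapOfInjective _ α.injective).toEquiv).symm
    have h2 : Z.map α.toMonoidHom ≤ Subgroup.zpowers c := hinf ▸ inf_le_left
    exact le_antisymm (le_of_card_dvd_of_le_isCyclic h2 inf_le_right hcard.dvd)
      (le_of_card_dvd_of_le_isCyclic inf_le_right h2 hcard.symm.dvd)
  have hZcyc : IsCyclic Z := isCyclic_of_injective _ (Subgroup.inclusion_injective
    (inf_le_left : Z ≤ Subgroup.zpowers a))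
  have hfix : ∀ w ∈ Z, α w = w := fun w hw => apply_eq_self_of_isCyclic hG hα Z hZmap hw
  -- `w = a ^ (2 ^ n)` is a generator of `Z`.
  have hex : ∃ n : ℕ, a ^ 2 ^ n ∈ Z := ⟨m, by rw [← hm, pow_orderOf_eq_one]; exact one_mem Z⟩
  classical
  obtain ⟨n, hn, hmin⟩ : ∃ n : ℕ, a ^ 2 ^ n ∈ Z ∧ ∀ k < n, a ^ 2 ^ k ∉ Z :=
    ⟨Nat.find hex, Nat.find_spec hex, fun k hk => Nat.find_min hex hk⟩
  set w := a ^ 2 ^ n with hw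
  have hZw : ∀ x ∈ Z, ∃ k : ℤ, x = w ^ k := by
    rintro x hx
    obtain ⟨k, rfl⟩ := hx.1
    have hg : a ^ (Int.gcd k (2 ^ n : ℕ)) ∈ Z := by
      rw [← zpow_natCast, Int.gcd_eq_gcd_ab, zpow_add, zpow_mul, zpow_mul, zpow_natCast]
      exact mul_mem (zpow_mem hx _) (zpow_mem hn _)
    have hdvd : Int.gcd k (2 ^ n : ℕ) ∣ 2 ^ n := by
      have := Int.gcd_dvd_right k (2 ^ n : ℕ)
      exact_mod_cast this
    obtain ⟨l, hl, hgl⟩ := (Nat.dvd_prime_pow Nat.prime_two).1 hdvd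
    rw [hgl] at hg
    have hln : l = n := by
      by_contra h
      exact hmin l (by omega) hg
    have hk : ((2 ^ n : ℕ) : ℤ) ∣ k := by
      have := Int.gcd_dvd_left k (2 ^ n : ℕ)
      rwa [hgl, hln] at this
    obtain ⟨r, rfl⟩ := hk
    exact ⟨r, by rw [hw, ← zpow_natCast a, ← zpow_mul]⟩
  have hw1 : w ≠ 1 := by
    intro h
    refine hZbot (eq_bot_iff.2 fun x hx => ?_)
    obtain ⟨k, rfl⟩ := hZw x hx
    simp [h]
  have hcw : c ^ 2 ^ n = w := by
    have := hfix w hn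
    rwa [hw, map_pow] at this
  have hdw : d ^ 2 ^ n = w := by
    have := hfix w hn
    rw [← hcw, map_pow] at this
    rw [this, hcw]
  have hn1 : n ≠ 0 := by
    rintro rfl
    rw [pow_zero, pow_one] at hcw hw
    exact hca (by rw [hcw, hw])
  obtain ⟨i, j, hdij⟩ := hgen d
  have hdq' := hdq
  rw [hdij, QuotientGroup.mk_mul, QuotientGroup.mk_zpow, QuotientGroup.mk_zpow,
    zpow_eq_of_mul_self (hsq _), zpow_eq_of_mul_self (hsq _)] at hdq'
  have hi : ¬ Even i := by
    intro hi
    rw [if_pos hi, one_mul] at hdq'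
    split at hdq'
    · have h3 : (a : G ⧸ squareSubgroup G) * c = a * a := hdq'.symm.trans (hsq _).symm
      exact hca (mul_left_cancel h3)
    · exact ha (right_eq_mul.1 hdq')
  have hj : ¬ Even j := by
    intro hj
    rw [if_neg hi, if_pos hj] at hdq'
    exact hc1 (mul_left_cancel hdq').symm
  set x := a ^ i with hx
  set y := c ^ j with hy
  set u := y * x * y⁻¹ * x⁻¹ with hu
  have huZ : u ∈ Z := hcommZ i j
  have hyx : y * x = u * x * y := by rw [hu]; group
  have hxn : x ^ 2 ^ n = w ^ i := by
    rw [hx, hw, ← zpow_natCast, ← zpow_mul, mul_comm, zpow_mul, zpow_natCast]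
  have hyn : y ^ 2 ^ n = w ^ j := by
    rw [hy, ← hcw, ← zpow_natCast, ← zpow_mul, mul_comm, zpow_mul, zpow_natCast]
  have hun : u ^ 2 ^ n = 1 := by
    refine pow_eq_one_of_commutator hyx (hZcomm u huZ x) ?_
    rw [hxn]
    exact (hZcomm _ (zpow_mem hn i) y).symm
  have hpow := mul_pow_of_commutator hyx (hZcomm u huZ x) (hZcomm u huZ y) (2 ^ n)
  rw [← hdij, hdw, hxn, hyn, ← zpow_add] at hpow
  set t := u ^ (2 ^ n * (2 ^ n - 1) / 2) with ht
  have ht2 : t ^ 2 = 1 := by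
    have h2 : 2 ∣ 2 ^ n * (2 ^ n - 1) := (dvd_pow_self 2 hn1).mul_right _
    rw [ht, ← pow_mul, Nat.div_mul_cancel h2, pow_mul, hun, one_pow]
  obtain ⟨r, hr⟩ : ∃ r : ℤ, i + j = 2 * r := by
    obtain ⟨r, hr⟩ := (Int.not_even_iff_odd.1 hi).add_odd (Int.not_even_iff_odd.1 hj)
    exact ⟨r, by rw [hr]; ring⟩
  have htw : t = w ^ (1 - 2 * r) := by
    rw [zpow_sub, zpow_one, ← hr]
    nth_rewrite 1 [hpow]
    have hcomm := hZcomm _ (zpow_mem hn (i + j)) t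
    rw [hcomm, mul_inv_cancel_right]
  have hw2 : w ^ 2 = 1 := by
    have hodd : w ^ (2 * (1 - 2 * r)) = 1 := by
      rw [mul_comm, zpow_mul, ← htw]
      exact_mod_cast ht2
    obtain ⟨s, hs⟩ := IsPGroup.iff_orderOf.1 hG w
    have h3 := orderOf_dvd_iff_zpow_eq_one.2 hodd
    rw [hs] at h3
    have hcop : IsCoprime ((2 ^ s : ℕ) : ℤ) (1 - 2 * r) := by
      push_cast
      refine IsCoprime.pow_left ⟨r, 1, by ring⟩
    have h4 := hcop.dvd_of_dvd_mul_right h3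
    have h5 : orderOf w ∣ 2 := by
      rw [hs]
      exact_mod_cast h4
    exact orderOf_dvd_iff_pow_eq_one.1 h5
  have hwmul : w * w = 1 := by rw [← sq, hw2]
  have htw' : t = w := by
    rw [htw, zpow_eq_of_mul_self hwmul, if_neg]
    rw [Int.even_sub]
    simp
  have huw : u = 1 ∨ u = w := by
    obtain ⟨k, hk⟩ := hZw u huZ
    rw [hk, zpow_eq_of_mul_self hwmul]
    split <;> simp
  have hn_one : n = 1 := by
    by_contra hne1
    have h4 : 2 * 2 ∣ 2 ^ n := by
      have : 2 ^ 2 ∣ 2 ^ n := pow_dvd_pow 2 (by omega)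
      simpa using this
    obtain ⟨k, hk⟩ := h4
    have h5 : 2 ^ n * (2 ^ n - 1) / 2 = 2 * (k * (2 ^ n - 1)) := by
      nth_rewrite 1 [hk]
      rw [mul_assoc, mul_assoc, Nat.mul_div_cancel_left _ (by norm_num)]
    refine hw1 ?_
    rw [← htw', ht, h5, pow_mul]
    rcases huw with h | h
    · simp [h]
    · rw [h, hw2, one_pow]
  rw [hn_one, pow_one] at hcw hw
  refine ⟨hw ▸ hw1, ?_, hcw.trans hw, ?_, hgen⟩
  · rw [show 4 = 2 * 2 by norm_num, pow_mul, ← hw, hw2]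
  · -- the commutator of `a` and `c` is `w = a ^ 2`, for otherwise `G` would be commutative
    obtain ⟨k, hk⟩ := hZw _ (hcommZ 1 1)
    rw [zpow_eq_of_mul_self hwmul, zpow_one, zpow_one] at hk
    split at hk
    · exfalso
      have hcomm : Commute c a := mul_inv_eq_iff_eq_mul.1 (mul_inv_eq_one.1 hk)
      have : u = 1 := by
        rw [hu, mul_inv_eq_one, mul_inv_eq_iff_eq_mul]
        exact (hcomm.zpow_zpow j i).eq
      refine hw1 ?_
      rw [← htw', ht, this, one_pow]
    · rw [mul_inv_eq_iff_eq_mul] at hk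
      rw [hk, eq_inv_iff_mul_eq_one, mul_assoc, ← sq, ← hw, hwmul]

end OddAutomorphisms

/-! ### Isomorphisms defined on generators -/

section Presentations

variable {G : Type*} [Group G]

/-- The homomorphism `i ↦ u ^ i` from `ℤ / n`, when `u ^ n = 1`. -/
def zmodPowHom {n : ℕ} (u : G) (hu : u ^ n = 1) : Multiplicative (ZMod n) →* G :=
  AddMonoidHom.toMultiplicativeLeft
    (ZMod.lift n ⟨zmultiplesHom (Additive G) (Additive.ofMul u), by
      rw [zmultiplesHom_apply, natCast_zsmul, ← ofMul_pow, hu, ofMul_one]⟩)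

theorem zmodPowHom_intCast {n : ℕ} (u : G) (hu : u ^ n = 1) (i : ℤ) :
    zmodPowHom u hu (Multiplicative.ofAdd (i : ZMod n)) = u ^ i := by
  change Additive.toMul (ZMod.lift n _ (i : ZMod n)) = _
  rw [ZMod.lift_coe]
  rfl

theorem zmodPowHom_one {n : ℕ} (u : G) (hu : u ^ n = 1) :
    zmodPowHom u hu (Multiplicative.ofAdd 1) = u := by
  have := zmodPowHom_intCast u hu 1
  rwa [Int.cast_one, zpow_one] at this

theorem zmodPowHom_mem {n : ℕ} (u : G) (hu : u ^ n = 1) (i : Multiplicative (ZMod n)) :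
    zmodPowHom u hu i ∈ Subgroup.zpowers u := by
  obtain ⟨k, hk⟩ := ZMod.intCast_surjective (Multiplicative.toAdd i)
  refine ⟨k, ?_⟩
  have := zmodPowHom_intCast u hu k
  rw [hk] at this
  exact this.symm

theorem zmodPowHom_injective {n : ℕ} (u : G) (hu : u ^ n = 1) (ho : orderOf u = n) :
    Function.Injective (zmodPowHom u hu) := by
  rw [injective_iff_map_eq_one]
  intro i hi
  obtain ⟨k, hk⟩ := ZMod.intCast_surjective (Multiplicative.toAdd i)
  have h1 := zmodPowHom_intCast u hu k
  rw [hk, ofAdd_toAdd, hi] at h1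
  have h2 := orderOf_dvd_iff_zpow_eq_one.2 h1.symm
  rw [ho] at h2
  have h3 : (k : ZMod n) = 0 := (ZMod.intCast_zmod_eq_zero_iff_dvd k n).2 h2
  rw [hk] at h3
  exact h3

theorem zmodPowHom_conj {n : ℕ} {u w : G} (hu : u ^ n = 1) (h : w * u * w⁻¹ = u⁻¹)
    (i : Multiplicative (ZMod n)) : zmodPowHom u hu i * w = w * (zmodPowHom u hu i)⁻¹ := by
  obtain ⟨k, hk⟩ := zmodPowHom_mem u hu i
  have h1 : w * (u ^ k)⁻¹ * w⁻¹ = u ^ k := by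
    rw [← zpow_neg, ← conj_zpow, h, inv_zpow, zpow_neg, inv_inv]
  have hk' : u ^ k = zmodPowHom u hu i := hk
  rw [← hk']
  nth_rewrite 1 [← h1]
  group

/-- The homomorphism from the quaternion group given by elements satisfying its relations. -/
def quaternionLift {n : ℕ} {u w : G} (hu : u ^ (2 * n) = 1) (hw : w ^ 2 = u ^ n)
    (h : w * u * w⁻¹ = u⁻¹) : QuaternionGroup n →* G :=
  MonoidHom.mk' (fun
    | .a i => zmodPowHom u hu (Multiplicative.ofAdd i)
    | .xa i => w * zmodPowHom u hu (Multiplicative.ofAdd i)) (by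
      have hc := zmodPowHom_conj hu h
      have hn : zmodPowHom u hu (Multiplicative.ofAdd (n : ZMod (2 * n))) = w ^ 2 := by
        have := zmodPowHom_intCast u hu n
        rw [zpow_natCast, Int.cast_natCast] at this
        rw [this, hw]
      rintro (i | i) (j | j)
      · simp only [QuaternionGroup.a_mul_a, ofAdd_add, map_mul]
      · simp only [QuaternionGroup.a_mul_xa]
        rw [← mul_assoc, hc, sub_eq_neg_add, ofAdd_add, map_mul, ofAdd_neg, map_inv, mul_assoc]
      · simp only [QuaternionGroup.xa_mul_a, ofAdd_add, map_mul, mul_assoc]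
      · simp only [QuaternionGroup.xa_mul_xa]
        rw [mul_assoc, ← mul_assoc _ w, hc, add_sub_assoc, sub_eq_neg_add, ofAdd_add, ofAdd_add,
          map_mul, map_mul, hn, ofAdd_neg, map_inv, sq]
        simp only [mul_assoc])

theorem exists_quaternionGroup_equiv {n : ℕ} {u w : G} (ho : orderOf u = 2 * n)
    (hw : w ^ 2 = u ^ n) (h : w * u * w⁻¹ = u⁻¹) (hnot : w ∉ Subgroup.zpowers u)
    (hgen : ∀ g, g ∈ Subgroup.zpowers u ∨ w⁻¹ * g ∈ Subgroup.zpowers u) :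
    ∃ e : QuaternionGroup n ≃* G, e (.a 1) = u ∧ e (.xa 0) = w := by
  have hu : u ^ (2 * n) = 1 := by rw [← ho, pow_orderOf_eq_one]
  have key : ∀ g ∈ Subgroup.zpowers u, ∃ i : ZMod (2 * n),
      zmodPowHom u hu (Multiplicative.ofAdd i) = g := by
    rintro _ ⟨k, rfl⟩
    exact ⟨k, zmodPowHom_intCast u hu k⟩
  refine ⟨MulEquiv.ofBijective (quaternionLift hu hw h) ⟨?_, fun g => ?_⟩, zmodPowHom_one u hu, ?_⟩
  · rw [injective_iff_map_eq_one]
    rintro (i | i) hi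
    · have := (injective_iff_map_eq_one _).1 (zmodPowHom_injective u hu ho)
        (Multiplicative.ofAdd i) hi
      have hi0 : i = 0 := this
      rw [hi0]
      rfl
    · refine absurd ?_ hnot
      have hi' : w * zmodPowHom u hu (Multiplicative.ofAdd i) = 1 := hi
      rw [mul_eq_one_iff_eq_inv] at hi'
      rw [hi']
      exact inv_mem (zmodPowHom_mem u hu _)
  · rcases hgen g with hg | hg
    · obtain ⟨i, hi⟩ := key _ hg
      exact ⟨.a i, hi⟩
    · obtain ⟨i, hi⟩ := key _ hg
      refine ⟨.xa i, ?_⟩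
      change w * _ = g
      rw [hi, mul_inv_cancel_left]
  · change w * zmodPowHom u hu (Multiplicative.ofAdd 0) = w
    rw [ofAdd_zero, map_one, mul_one]

/-- The homomorphism from the dihedral group given by elements satisfying its relations. -/
def dihedralLift {n : ℕ} {u w : G} (hu : u ^ n = 1) (hw : w ^ 2 = 1)
    (h : w * u * w⁻¹ = u⁻¹) : DihedralGroup n →* G :=
  MonoidHom.mk' (fun
    | .r i => zmodPowHom u hu (Multiplicative.ofAdd i)
    | .sr i => w * zmodPowHom u hu (Multiplicative.ofAdd i)) (by
      have hc := zmodPowHom_conj hu h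
      rintro (i | i) (j | j)
      · simp only [DihedralGroup.r_mul_r, ofAdd_add, map_mul]
      · simp only [DihedralGroup.r_mul_sr]
        rw [← mul_assoc, hc, sub_eq_neg_add, ofAdd_add, map_mul, ofAdd_neg, map_inv, mul_assoc]
      · simp only [DihedralGroup.sr_mul_r, ofAdd_add, map_mul, mul_assoc]
      · simp only [DihedralGroup.sr_mul_sr]
        rw [mul_assoc, ← mul_assoc _ w, hc, sub_eq_neg_add, ofAdd_add, map_mul, ofAdd_neg, map_inv]
        simp only [← mul_assoc]
        rw [← sq, hw, one_mul])

theorem exists_dihedralGroup_equiv {n : ℕ} {u w : G} (ho : orderOf u = n)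
    (hw : w ^ 2 = 1) (h : w * u * w⁻¹ = u⁻¹) (hnot : w ∉ Subgroup.zpowers u)
    (hgen : ∀ g, g ∈ Subgroup.zpowers u ∨ w⁻¹ * g ∈ Subgroup.zpowers u) :
    ∃ e : DihedralGroup n ≃* G, e (.r 1) = u ∧ e (.sr 0) = w := by
  have hu : u ^ n = 1 := by rw [← ho, pow_orderOf_eq_one]
  have key : ∀ g ∈ Subgroup.zpowers u, ∃ i : ZMod n,
      zmodPowHom u hu (Multiplicative.ofAdd i) = g := by
    rintro _ ⟨k, rfl⟩
    exact ⟨k, zmodPowHom_intCast u hu k⟩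
  refine ⟨MulEquiv.ofBijective (dihedralLift hu hw h) ⟨?_, fun g => ?_⟩, zmodPowHom_one u hu, ?_⟩
  · rw [injective_iff_map_eq_one]
    rintro (i | i) hi
    · have := (injective_iff_map_eq_one _).1 (zmodPowHom_injective u hu ho)
        (Multiplicative.ofAdd i) hi
      have hi0 : i = 0 := this
      rw [hi0]
      rfl
    · refine absurd ?_ hnot
      have hi' : w * zmodPowHom u hu (Multiplicative.ofAdd i) = 1 := hi
      rw [mul_eq_one_iff_eq_inv] at hi'
      rw [hi']
      exact inv_mem (zmodPowHom_mem u hu _)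
  · rcases hgen g with hg | hg
    · obtain ⟨i, hi⟩ := key _ hg
      exact ⟨.r i, hi⟩
    · obtain ⟨i, hi⟩ := key _ hg
      refine ⟨.sr i, ?_⟩
      change w * _ = g
      rw [hi, mul_inv_cancel_left]
  · change w * zmodPowHom u hu (Multiplicative.ofAdd 0) = w
    rw [ofAdd_zero, map_one, mul_one]

theorem IsHomocyclicPair.exists_equiv {n : ℕ} {a c : G} (h : IsHomocyclicPair n a c) :
    ∃ e : Multiplicative (ZMod (2 ^ n)) × Multiplicative (ZMod (2 ^ n)) ≃* G,
      e (Multiplicative.ofAdd 1, 1) = a ∧ e (1, Multiplicative.ofAdd 1) = c := by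
  have ha : a ^ 2 ^ n = 1 := by rw [← h.orderOf_left, pow_orderOf_eq_one]
  have hc : c ^ 2 ^ n = 1 := by rw [← h.orderOf_right, pow_orderOf_eq_one]
  let f := MonoidHom.noncommCoprod (zmodPowHom a ha) (zmodPowHom c hc) (fun i j => by
    obtain ⟨k, hk⟩ := zmodPowHom_mem a ha i
    obtain ⟨l, hl⟩ := zmodPowHom_mem c hc j
    rw [← hk, ← hl]
    exact (show Commute a c from h.comm).zpow_zpow k l)
  have hf : ∀ i j, f (i, j) = zmodPowHom a ha i * zmodPowHom c hc j := fun i j => rfl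
  refine ⟨MulEquiv.ofBijective f ⟨?_, fun g => ?_⟩, ?_, ?_⟩
  · rw [injective_iff_map_eq_one]
    rintro ⟨i, j⟩ hij
    rw [hf] at hij
    obtain ⟨k, hk⟩ := zmodPowHom_mem a ha i
    obtain ⟨l, hl⟩ := zmodPowHom_mem c hc j
    have hk' : a ^ k = zmodPowHom a ha i := hk
    have hl' : c ^ l = zmodPowHom c hc j := hl
    have h1 : zmodPowHom a ha i = 1 := by
      rw [← hk']
      refine h.indep k (-l) ?_
      rw [hk', zpow_neg, hl']
      exact eq_inv_of_mul_eq_one_left hij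
    rw [h1, one_mul] at hij
    exact Prod.ext ((injective_iff_map_eq_one _).1 (zmodPowHom_injective a ha h.orderOf_left) i h1)
      ((injective_iff_map_eq_one _).1 (zmodPowHom_injective c hc h.orderOf_right) j hij)
  · obtain ⟨i, j, rfl⟩ := h.gen g
    exact ⟨(Multiplicative.ofAdd (i : ZMod (2 ^ n)), Multiplicative.ofAdd (j : ZMod (2 ^ n))), by
      rw [hf, zmodPowHom_intCast, zmodPowHom_intCast]⟩
  · change f _ = a
    rw [hf, map_one (zmodPowHom c hc), mul_one, zmodPowHom_one]
  · change f _ = c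
    rw [hf, map_one (zmodPowHom a ha), one_mul, zmodPowHom_one]

theorem IsQuaternionPair.orderOf_eq {a c : G} (h : IsQuaternionPair a c) : orderOf a = 4 :=
  orderOf_eq_prime_pow (p := 2) (n := 1) (by simpa using h.sq_ne) (by simpa using h.pow_four)

theorem IsQuaternionPair.notMem {a c : G} (h : IsQuaternionPair a c) :
    c ∉ Subgroup.zpowers a := by
  rintro ⟨k, hk⟩
  have hk' : a ^ k = c := hk
  have h1 := h.conj
  have h2 : c * a * c⁻¹ = a := by
    rw [← hk', ((Commute.refl a).zpow_left k).eq, mul_inv_cancel_right]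
  rw [h2] at h1
  refine h.sq_ne ?_
  rw [sq]
  nth_rewrite 1 [h1]
  exact inv_mul_cancel a

theorem IsQuaternionPair.mem_or_inv_mul_mem {a c : G} (h : IsQuaternionPair a c) (g : G) :
    g ∈ Subgroup.zpowers a ∨ c⁻¹ * g ∈ Subgroup.zpowers a := by
  obtain ⟨i, j, rfl⟩ := h.gen g
  have hai : a ^ i ∈ Subgroup.zpowers a := ⟨i, rfl⟩
  have hc2 : ∀ k : ℤ, c ^ (2 * k) ∈ Subgroup.zpowers a := fun k => by
    rw [zpow_mul, zpow_ofNat, h.sq_eq]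
    exact zpow_mem (pow_mem (Subgroup.mem_zpowers a) 2) k
  rcases Int.even_or_odd' j with ⟨k, rfl | rfl⟩
  · exact Or.inl (mul_mem hai (hc2 k))
  · right
    have h1 : c⁻¹ * a ^ i * c = a ^ (-i) := by
      have h2 : c * a ^ (-i) * c⁻¹ = a ^ i := by
        rw [← conj_zpow, h.conj, inv_zpow, zpow_neg, inv_inv]
      rw [← h2]
      group
    have h3 : c⁻¹ * (a ^ i * c ^ (2 * k + 1)) = (c⁻¹ * a ^ i * c) * c ^ (2 * k) := by
      rw [add_comm, zpow_add, zpow_one]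
      group
    rw [h3, h1]
    exact mul_mem ⟨-i, rfl⟩ (hc2 k)

theorem IsQuaternionPair.exists_equiv {a c : G} (h : IsQuaternionPair a c) :
    ∃ e : QuaternionGroup 2 ≃* G, e (.a 1) = a ∧ e (.xa 0) = c :=
  exists_quaternionGroup_equiv h.orderOf_eq h.sq_eq h.conj h.notMem h.mem_or_inv_mul_mem

theorem IsHomocyclicPair.exists_equiv_of_pair {G' : Type*} [Group G'] {n : ℕ} {a c : G} {a' c' : G'}
    (h : IsHomocyclicPair n a c) (h' : IsHomocyclicPair n a' c') :
    ∃ e : G ≃* G', e a = a' ∧ e c = c' := by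
  obtain ⟨e, rfl, rfl⟩ := h.exists_equiv
  obtain ⟨e', rfl, rfl⟩ := h'.exists_equiv
  exact ⟨e.symm.trans e', by simp, by simp⟩

theorem IsQuaternionPair.exists_equiv_of_pair {G' : Type*} [Group G'] {a c : G} {a' c' : G'}
    (h : IsQuaternionPair a c) (h' : IsQuaternionPair a' c') :
    ∃ e : G ≃* G', e a = a' ∧ e c = c' := by
  obtain ⟨e, rfl, rfl⟩ := h.exists_equiv
  obtain ⟨e', rfl, rfl⟩ := h'.exists_equiv
  exact ⟨e.symm.trans e', by simp, by simp⟩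

end Presentations

/-! ### Metacyclic `2`-groups containing small self-centralizing subgroups -/

section MetacyclicTwoGroups

variable {P : Type*} [Group P]

/-- `a` has order `2 ^ m ≥ 4`, generates a subgroup of index `2`, and every element outside this
subgroup conjugates `a` to `a⁻¹` or to `a ^ (-1 + 2 ^ (m - 1))`, the latter only for `m ≥ 3`, since
for `m = 2` it would make the group abelian. The groups with such an element
are the `2`-groups of maximal class: dihedral, generalized quaternion and semidihedral. -/
structure IsMaxClassGenerator (a : P) (m : ℕ) : Prop where
  two_le : 2 ≤ m
  orderOf_eq : orderOf a = 2 ^ m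
  index_eq : (Subgroup.zpowers a).index = 2
  conj : ∀ y ∉ Subgroup.zpowers a,
    y * a * y⁻¹ = a⁻¹ ∨ 3 ≤ m ∧ y * a * y⁻¹ = a⁻¹ * a ^ 2 ^ (m - 1)

theorem isMaxClassGenerator_of_forall {a y : P} {m : ℕ} (hm : 2 ≤ m) (ho : orderOf a = 2 ^ m)
    (hy : y ∉ Subgroup.zpowers a)
    (hgen : ∀ g, g ∈ Subgroup.zpowers a ∨ y⁻¹ * g ∈ Subgroup.zpowers a)
    (hc : y * a * y⁻¹ = a⁻¹ ∨ 3 ≤ m ∧ y * a * y⁻¹ = a⁻¹ * a ^ 2 ^ (m - 1)) :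
    IsMaxClassGenerator a m := by
  have hgen' : ∀ g, g ∉ Subgroup.zpowers a → y⁻¹ * g ∈ Subgroup.zpowers a := fun g hg =>
    (hgen g).resolve_left hg
  refine ⟨hm, ho, ?_, fun g hg => ?_⟩
  · exact Subgroup.index_eq_two_iff_exists_notMem_and'.2
      ⟨y⁻¹, fun h => hy (by simpa using h), fun g => (hgen g).symm⟩
  · obtain ⟨k, hk⟩ := hgen' g hg
    have hk' : a ^ k = y⁻¹ * g := hk
    have : g * a * g⁻¹ = y * a * y⁻¹ := by
      have hg' : g = y * a ^ k := by rw [hk']; group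
      rw [hg']
      group
    rwa [this]

theorem int_odd_coprime_two_pow {e : ℤ} (he : Odd e) (m : ℕ) : IsCoprime ((2 ^ m : ℕ) : ℤ) e := by
  obtain ⟨r, rfl⟩ := he
  push_cast
  exact IsCoprime.pow_left ⟨-r, 1, by ring⟩

theorem zpow_eq_zpow_iff_dvd {a : P} {m : ℕ} (ho : orderOf a = 2 ^ m) (i : ℤ) :
    a ^ i = 1 ↔ ((2 ^ m : ℕ) : ℤ) ∣ i := by
  rw [← orderOf_dvd_iff_zpow_eq_one, ho]

/-- If an element `y` acts on a normal cyclic subgroup with cyclic quotient by an exponent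
congruent to `3` modulo `4`, it is not a square modulo this subgroup; so if `y ^ 2` lies in the
subgroup, the index is `2`. -/
theorem isMaxClassGenerator_of_conj [Finite P] (hP : IsPGroup 2 P) {a b y : P} {m : ℕ}
    (hN : (Subgroup.zpowers a).Normal) (hab : ∀ g : P, ∃ i j : ℤ, g = b ^ i * a ^ j) (hm : 2 ≤ m)
    (ho : orderOf a = 2 ^ m) {s : ℤ} (hs : y * a * y⁻¹ = a ^ s) (hs4 : s % 4 = 3)
    (hy2 : y ^ 2 ∈ Subgroup.zpowers a) : IsMaxClassGenerator a m := by
  have h4 : (4 : ℤ) ∣ ((2 ^ m : ℕ) : ℤ) := by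
    push_cast
    exact pow_dvd_pow 2 hm
  have hconj : ∀ g : P, ∀ r : ℤ, g * a * g⁻¹ = a ^ r →
      ∀ r' : ℤ, g * a ^ r' * g⁻¹ = a ^ (r * r') := by
    intro g r hr r'
    rw [← conj_zpow, hr, zpow_mul]
  have hcongr : ∀ i j : ℤ, a ^ i = a ^ j → ((2 ^ m : ℕ) : ℤ) ∣ i - j := by
    intro i j h
    rw [← zpow_eq_zpow_iff_dvd ho, zpow_sub, h, mul_inv_cancel]
  have hself : ∀ k : ℤ, a ^ k * a * (a ^ k)⁻¹ = a := fun k => by group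
  -- `s ^ 2 = 1` modulo the order of `a`
  have hss : ((2 ^ m : ℕ) : ℤ) ∣ s * s - 1 := by
    refine hcongr _ _ ?_
    obtain ⟨k, hk⟩ := hy2
    have hk' : a ^ k = y ^ 2 := hk
    have h1 : y ^ 2 * a * (y ^ 2)⁻¹ = a := by rw [← hk', hself]
    calc a ^ (s * s) = y * (y * a * y⁻¹) * y⁻¹ := by rw [hs, hconj y s hs s]
      _ = y ^ 2 * a * (y ^ 2)⁻¹ := by rw [sq]; group
      _ = a ^ (1 : ℤ) := by rw [h1, zpow_one]
  have hyn : y ∉ Subgroup.zpowers a := by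
    rintro ⟨k, hk⟩
    have hk' : a ^ k = y := hk
    rw [← hk', hself] at hs
    have h1 := hcongr s 1 (by rw [zpow_one]; exact hs.symm)
    have := h4.trans h1
    omega
  obtain ⟨i, j, hy⟩ := hab y
  have hiodd : Odd i := by
    by_contra hi
    obtain ⟨k, hk⟩ := Int.not_odd_iff_even.1 hi
    obtain ⟨r, hr⟩ := hN.conj_mem a (Subgroup.mem_zpowers a) (b ^ k)
    have hr' : b ^ k * a * (b ^ k)⁻¹ = a ^ r := hr.symm
    have h1 : y * a * y⁻¹ = a ^ (r * r) := by
      rw [← hconj _ r hr' r, ← hr', hy, hk, zpow_add]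
      group
    have h2 := h4.trans (hcongr _ _ (hs.symm.trans h1))
    have h3 : (r * r) % 4 = 0 ∨ (r * r) % 4 = 1 := by
      rcases Int.even_or_odd' r with ⟨q, rfl | rfl⟩
      · left
        ring_nf
        omega
      · right
        ring_nf
        omega
    omega
  refine isMaxClassGenerator_of_forall hm ho hyn (fun g => ?_) ?_
  · obtain ⟨n, hn⟩ := IsPGroup.iff_orderOf.1 hP b
    have hbN : (b : P ⧸ Subgroup.zpowers a) ^ i = (y : P ⧸ Subgroup.zpowers a) := by
      have ha1 : ((a ^ j : P) : P ⧸ Subgroup.zpowers a) = 1 :=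
        (QuotientGroup.eq_one_iff _).2 ⟨j, rfl⟩
      rw [hy, QuotientGroup.mk_mul, ha1, mul_one, QuotientGroup.mk_zpow]
    have hyy : (y : P ⧸ Subgroup.zpowers a) * y = 1 := by
      rw [← sq, ← QuotientGroup.mk_pow]
      exact (QuotientGroup.eq_one_iff _).2 hy2
    obtain ⟨k, l, hkl⟩ := int_odd_coprime_two_pow hiodd n
    have hbo : (b : P ⧸ Subgroup.zpowers a) ^ ((2 ^ n : ℕ) : ℤ) = 1 := by
      rw [zpow_natCast, ← QuotientGroup.mk_pow, ← hn, pow_orderOf_eq_one, QuotientGroup.mk_one]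
    have hbl : (b : P ⧸ Subgroup.zpowers a) = (y : P ⧸ Subgroup.zpowers a) ^ l := by
      rw [← hbN, ← zpow_mul]
      nth_rewrite 1 [← zpow_one (b : P ⧸ Subgroup.zpowers a), ← hkl]
      rw [zpow_add, mul_comm k, zpow_mul, hbo, one_zpow, one_mul, mul_comm]
    obtain ⟨i', j', rfl⟩ := hab g
    have hg : ((b ^ i' * a ^ j' : P) : P ⧸ Subgroup.zpowers a) =
        (y : P ⧸ Subgroup.zpowers a) ^ (l * i') := by
      have ha1 : ((a ^ j' : P) : P ⧸ Subgroup.zpowers a) = 1 :=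
        (QuotientGroup.eq_one_iff _).2 ⟨j', rfl⟩
      rw [QuotientGroup.mk_mul, ha1, mul_one, QuotientGroup.mk_zpow, hbl, zpow_mul]
    rw [zpow_eq_of_mul_self hyy] at hg
    split at hg
    · exact Or.inl ((QuotientGroup.eq_one_iff _).1 hg)
    · exact Or.inr (QuotientGroup.eq.1 hg.symm)
  · have hfac : ((2 ^ (m - 1) : ℕ) : ℤ) ∣ s + 1 := by
      obtain ⟨q, hq⟩ : ∃ q, s - 1 = 2 * q := ⟨(s - 1) / 2, by omega⟩
      have hqo : Odd q := by
        rw [Int.odd_iff]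
        omega
      have h2 : ((2 ^ m : ℕ) : ℤ) = 2 * ((2 ^ (m - 1) : ℕ) : ℤ) := by
        have : m = m - 1 + 1 := by omega
        nth_rewrite 1 [this]
        push_cast
        ring
      have h3 : s * s - 1 = 2 * (q * (s + 1)) := by
        have : s * s - 1 = (s - 1) * (s + 1) := by ring
        rw [this, hq]
        ring
      rw [h2, h3] at hss
      have h4 := Int.dvd_of_mul_dvd_mul_left (by norm_num) hss
      exact (int_odd_coprime_two_pow hqo _).dvd_of_dvd_mul_left h4
    obtain ⟨k, hk⟩ := hfac
    have hs' : y * a * y⁻¹ = a⁻¹ * (a ^ 2 ^ (m - 1)) ^ k := by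
      rw [hs, ← zpow_natCast a, ← zpow_mul, ← hk, zpow_add_one]
      group
    have hz : a ^ 2 ^ (m - 1) * a ^ 2 ^ (m - 1) = 1 := by
      rw [← pow_add, ← two_mul, ← pow_succ', show m - 1 + 1 = m by omega, ← ho, pow_orderOf_eq_one]
    rw [zpow_eq_of_mul_self hz] at hs'
    split at hs'
    · left
      simpa using hs'
    · rename_i hkodd
      right
      refine ⟨?_, hs'⟩
      by_contra hm3
      have : m = 2 := by omega
      subst this
      norm_num at hk
      have := Int.not_even_iff.1 hkodd
      omega

theorem isMaxClassGenerator_of_inverted [Finite P] (hP : IsPGroup 2 P) {a b x y : P}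
    (hN : (Subgroup.zpowers a).Normal) (hab : ∀ g : P, ∃ i j : ℤ, g = b ^ i * a ^ j)
    (hx : x ∈ Subgroup.zpowers a) (hx2 : x ^ 2 ≠ 1) (hxy : y * x * y⁻¹ = x⁻¹) (hy : y ^ 2 = x ^ 2) :
    ∃ m, IsMaxClassGenerator a m := by
  obtain ⟨m, ho⟩ := IsPGroup.iff_orderOf.1 hP a
  obtain ⟨l, hl⟩ := hx
  have hl' : a ^ l = x := hl
  obtain ⟨s, hs⟩ := hN.conj_mem a (Subgroup.mem_zpowers a) y
  have hs' : y * a * y⁻¹ = a ^ s := hs.symm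
  have h2l : ¬ ((2 ^ m : ℕ) : ℤ) ∣ 2 * l := by
    rw [← zpow_eq_zpow_iff_dvd ho, mul_comm, zpow_mul, hl']
    exact_mod_cast hx2
  have hls : ((2 ^ m : ℕ) : ℤ) ∣ l * (s + 1) := by
    rw [← zpow_eq_zpow_iff_dvd ho, mul_add, mul_one, zpow_add, mul_comm l s, zpow_mul, ← hs',
      conj_zpow, hl', hxy, inv_mul_cancel]
  have hs4 : s % 4 = 3 := by
    by_contra h
    have : ∃ e c : ℤ, Odd e ∧ (s + 1) * c = 2 * e := by
      rcases Int.even_or_odd' s with ⟨q, rfl | rfl⟩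
      · exact ⟨2 * q + 1, 2, ⟨q, rfl⟩, by ring⟩
      · refine ⟨q + 1, 1, ?_, by ring⟩
        rw [Int.odd_iff]
        omega
    obtain ⟨e, c, he, hec⟩ := this
    refine h2l ((int_odd_coprime_two_pow he m).dvd_of_dvd_mul_right ?_)
    have : 2 * l * e = l * (s + 1) * c := by rw [mul_assoc l, hec]; ring
    rw [this]
    exact hls.mul_right c
  refine ⟨m, isMaxClassGenerator_of_conj hP hN hab ?_ ho hs' hs4 ?_⟩
  · by_contra hm
    refine h2l ?_
    have : 2 ^ m ∣ 2 ^ 1 := pow_dvd_pow 2 (by omega)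
    have h2 : ((2 ^ m : ℕ) : ℤ) ∣ 2 := by exact_mod_cast this
    exact h2.mul_right l
  · rw [hy, ← hl']
    exact pow_mem (Subgroup.mem_zpowers_iff.2 ⟨l, rfl⟩) 2

theorem eq_or_eq_of_isCyclic_of_mul_self {C : Type*} [Group C] [Finite C] [IsCyclic C] {u v : C}
    (hu : u * u = 1) (hv : v * v = 1) : u = 1 ∨ v = 1 ∨ u = v := by
  by_cases hu1 : u = 1
  · exact Or.inl hu1
  by_cases hv1 : v = 1
  · exact Or.inr (Or.inl hv1)
  have hou : orderOf u = 2 := orderOf_eq_prime (by rw [sq, hu]) hu1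
  have hov : orderOf v = 2 := orderOf_eq_prime (by rw [sq, hv]) hv1
  obtain ⟨k, hk⟩ := mem_zpowers_of_orderOf_dvd (u := u) (v := v) (by rw [hou, hov])
  have hk' : v ^ k = u := hk
  rw [zpow_eq_of_mul_self hv] at hk'
  split at hk'
  · exact absurd hk'.symm hu1
  · exact Or.inr (Or.inr hk'.symm)

theorem isCyclic_quotient_of_generators {a b : P} (hN : (Subgroup.zpowers a).Normal)
    (hab : ∀ g : P, ∃ i j : ℤ, g = b ^ i * a ^ j) : IsCyclic (P ⧸ Subgroup.zpowers a) := by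
  refine ⟨(b : P ⧸ Subgroup.zpowers a), fun v => ?_⟩
  induction v using QuotientGroup.induction_on with
  | H g =>
    obtain ⟨i, j, rfl⟩ := hab g
    have ha1 : ((a ^ j : P) : P ⧸ Subgroup.zpowers a) = 1 :=
      (QuotientGroup.eq_one_iff _).2 ⟨j, rfl⟩
    exact ⟨i, by rw [QuotientGroup.mk_mul, ha1, mul_one, QuotientGroup.mk_zpow]⟩

/-- A metacyclic `2`-group containing a quaternion group of order `8` has maximal class: one of the
cyclic subgroups of order `4` lies in the given normal cyclic subgroup, and is inverted. -/
theorem exists_isMaxClassGenerator_of_quaternion [Finite P] (hP : IsPGroup 2 P)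
    (hm : IsMetacyclic P) {i j : P} (hi2 : i ^ 2 ≠ 1) (hi4 : i ^ 4 = 1) (hj : j ^ 2 = i ^ 2)
    (hij : j * i * j⁻¹ = i⁻¹) : ∃ (a : P) (m : ℕ), IsMaxClassGenerator a m := by
  obtain ⟨a, b, hN, hab⟩ := hm.exists_generators
  have hcyc := isCyclic_quotient_of_generators hN hab
  have hi4' : i ^ 2 * i ^ 2 = 1 := by rw [← pow_add, hi4]
  have hinv2 : (i ^ 2)⁻¹ = i ^ 2 := inv_eq_of_mul_eq_one_right hi4'
  have hjc : j * i ^ 2 = i ^ 2 * j := by rw [← hj, ← pow_succ', ← pow_succ]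
  have hji : j * i = i⁻¹ * j := by rw [← hij]; group
  have hi2N : i ^ 2 ∈ Subgroup.zpowers a := by
    rw [← hinv2, ← QuotientGroup.eq_one_iff]
    have h1 : (i ^ 2)⁻¹ = j * i * j⁻¹ * i⁻¹ := by rw [hij]; group
    have hcomm : ((j : P) : P ⧸ Subgroup.zpowers a) * i = i * j :=
      (IsCyclic.isMulCommutative (α := P ⧸ Subgroup.zpowers a)).is_comm.comm _ _
    rw [h1, QuotientGroup.mk_mul, QuotientGroup.mk_mul, QuotientGroup.mk_mul, hcomm]
    simp
  have hiq : (i : P ⧸ Subgroup.zpowers a) * i = 1 := by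
    rw [← sq, ← QuotientGroup.mk_pow]
    exact (QuotientGroup.eq_one_iff _).2 hi2N
  have hjq : (j : P ⧸ Subgroup.zpowers a) * j = 1 := by
    rw [← sq, ← QuotientGroup.mk_pow, hj]
    exact (QuotientGroup.eq_one_iff _).2 hi2N
  rcases eq_or_eq_of_isCyclic_of_mul_self hiq hjq with h | h | h
  · exact ⟨a, isMaxClassGenerator_of_inverted hP hN hab ((QuotientGroup.eq_one_iff _).1 h) hi2
      hij hj⟩
  · refine ⟨a, isMaxClassGenerator_of_inverted hP hN hab ((QuotientGroup.eq_one_iff _).1 h)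
      (by rwa [hj]) (y := i) ?_ hj.symm⟩
    calc i * j * i⁻¹ = i * (j * i) * (i ^ 2)⁻¹ := by group
      _ = j * (i ^ 2)⁻¹ := by rw [hji]; group
      _ = j⁻¹ := by rw [← hj]; group
  · have hx : i * j ∈ Subgroup.zpowers a := by
      rw [← QuotientGroup.eq_one_iff, QuotientGroup.mk_mul, h, hjq]
    have hsq : (i * j) ^ 2 = i ^ 2 := by
      calc (i * j) ^ 2 = i * (j * i) * j := by rw [sq]; group
        _ = j ^ 2 := by rw [hji, sq]; group
        _ = i ^ 2 := hj
    refine ⟨a, isMaxClassGenerator_of_inverted hP hN hab hx (by rwa [hsq]) (y := j) ?_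
      (hj.trans hsq.symm)⟩
    calc j * (i * j) * j⁻¹ = j * i := by group
      _ = i⁻¹ * j⁻¹ * j ^ 2 := by rw [hji, sq]; group
      _ = i⁻¹ * (j⁻¹ * i ^ 2) := by rw [hj]; group
      _ = i⁻¹ * (i ^ 2 * j⁻¹) := by rw [← hj]; group
      _ = (i * j⁻¹) := by group
      _ = (i * j)⁻¹ := by
        rw [mul_inv_rev]
        have h5 : j⁻¹ * i⁻¹ * j = i := by
          calc j⁻¹ * i⁻¹ * j = j⁻¹ * (j * i * j⁻¹) * j := by rw [hij]
            _ = i := by group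
        nth_rewrite 1 [← h5]
        group

/-- A metacyclic `2`-group containing a self-centralizing four-group `Q` is equal to `Q` or has
maximal class. -/
theorem eq_top_or_exists_isMaxClassGenerator [Finite P] (hP : IsPGroup 2 P) (hm : IsMetacyclic P)
    {Q : Subgroup P} {u v : Q} (huv : IsHomocyclicPair 1 u v)
    (hQ : Subgroup.centralizer (Q : Set P) ≤ Q) :
    Q = ⊤ ∨ ∃ (a : P) (m : ℕ), IsMaxClassGenerator a m := by
  obtain ⟨a, b, hN, hab⟩ := hm.exists_generators
  have hcyc := isCyclic_quotient_of_generators hN hab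
  obtain ⟨m, ho⟩ := IsPGroup.iff_orderOf.1 hP a
  have hexp : ∀ g : Q, g * g = 1 := by
    intro g
    obtain ⟨i, j, rfl⟩ := huv.gen g
    have hu : u ^ (2 : ℕ) = 1 := by
      rw [← orderOf_dvd_iff_pow_eq_one, huv.orderOf_left, pow_one]
    have hv : v ^ (2 : ℕ) = 1 := by
      rw [← orderOf_dvd_iff_pow_eq_one, huv.orderOf_right, pow_one]
    have hc : Commute (u ^ i) (v ^ j) := (show Commute u v from huv.comm).zpow_zpow i j
    rw [← sq, hc.mul_pow, ← zpow_natCast, ← zpow_natCast (v ^ j), ← zpow_mul, ← zpow_mul,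
      mul_comm i, mul_comm j, zpow_mul, zpow_mul, zpow_natCast, zpow_natCast, hu, hv, one_zpow,
      one_zpow, one_mul]
  have hcomm := mul_comm_of_mul_self hexp
  have hu1 : u ≠ 1 := by
    rintro rfl
    simpa using huv.orderOf_left
  have hv1 : v ≠ 1 := by
    rintro rfl
    simpa using huv.orderOf_right
  have hne : u ≠ v := by
    rintro rfl
    exact hu1 (by simpa using huv.indep 1 1 rfl)
  have hexpP : ∀ g : Q, (g : P) * g = 1 := fun g => congrArg Subtype.val (hexp g)
  have hexpq : ∀ g : Q, ((g : P) : P ⧸ Subgroup.zpowers a) * (g : P) = 1 := fun g => by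
    rw [← QuotientGroup.mk_mul, hexpP, QuotientGroup.mk_one]
  -- a nontrivial element `z` of `Q` in the cyclic normal subgroup, and another one, `x`
  obtain ⟨z, x, hz1, hx1, hzx, hzN⟩ : ∃ z x : Q, z ≠ 1 ∧ x ≠ 1 ∧ z ≠ x ∧
      (z : P) ∈ Subgroup.zpowers a := by
    rcases eq_or_eq_of_isCyclic_of_mul_self (hexpq u) (hexpq v) with h | h | h
    · exact ⟨u, v, hu1, hv1, hne, (QuotientGroup.eq_one_iff _).1 h⟩
    · exact ⟨v, u, hv1, hu1, hne.symm, (QuotientGroup.eq_one_iff _).1 h⟩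
    · refine ⟨u * v, v, fun h1 => hne (mul_right_cancel (h1.trans (hexp v).symm)), hv1, ?_, ?_⟩
      · exact fun h1 => hu1 (mul_eq_right.1 h1)
      · rw [← QuotientGroup.eq_one_iff, Subgroup.coe_mul, QuotientGroup.mk_mul, h]
        exact hexpq v
  have hzpow : ∀ w : P, w ∈ Subgroup.zpowers a → w * w = 1 → w = 1 ∨ w = z := by
    intro w hw hww
    rcases eq_or_eq_of_isCyclic_of_mul_self (C := Subgroup.zpowers a) (u := ⟨w, hw⟩)
      (v := ⟨z, hzN⟩) (Subtype.ext hww) (Subtype.ext (hexpP z)) with h | h | h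
    · exact Or.inl (congrArg Subtype.val h)
    · exact absurd (Subtype.ext (congrArg (fun t : Subgroup.zpowers a => (t : P)) h) : z = 1) hz1
    · exact Or.inr (congrArg Subtype.val h)
  have hzc : ∀ g : P, g * z * g⁻¹ = z := by
    intro g
    rcases hzpow _ (hN.conj_mem _ hzN g) (by
      have h1 : g * z * g⁻¹ * (g * z * g⁻¹) = g * (z * z) * g⁻¹ := by group
      rw [h1, hexpP]
      simp) with h | h
    · refine absurd (Subtype.ext ?_) hz1
      have h2 := conj_eq_one_iff.1 h
      exact h2
    · exact h
  have hxN : (x : P) ∉ Subgroup.zpowers a := by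
    intro h
    rcases hzpow _ h (hexpP x) with h | h
    · exact hx1 (Subtype.ext h)
    · exact hzx (Subtype.ext h.symm)
  have hgen : ∀ g : Q, g = 1 ∨ g = z ∨ g = x ∨ g = z * x := by
    refine eq_or_of_card_le_four ?_ hexp hz1 hx1 hzx.symm
    obtain ⟨e, -, -⟩ := huv.exists_equiv
    rw [← Nat.card_congr e.toEquiv, Nat.card_prod]
    change Nat.card (ZMod (2 ^ 1)) * Nat.card (ZMod (2 ^ 1)) ≤ 4
    simp
  have hcent : ∀ g : P, g * x = x * g → g ∈ Q := by
    intro g hg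
    refine hQ (Subgroup.mem_centralizer_iff.2 fun h hh => ?_)
    have hgz : (z : P) * g = g * z := by
      rw [eq_comm, ← mul_inv_eq_iff_eq_mul]
      exact hzc g
    rcases hgen ⟨h, hh⟩ with h' | h' | h' | h'
    · rw [show h = 1 from congrArg Subtype.val h']; simp
    · rw [show h = z from congrArg Subtype.val h']; exact hgz
    · rw [show h = x from congrArg Subtype.val h']; exact hg.symm
    · rw [show h = z * x from congrArg Subtype.val h', mul_assoc, ← hg, ← mul_assoc, hgz, mul_assoc]
  obtain ⟨s, hs⟩ := hN.conj_mem a (Subgroup.mem_zpowers a) x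
  have hs' : (x : P) * a * (x : P)⁻¹ = a ^ s := hs.symm
  by_cases hm2 : 2 ≤ m
  · right
    refine ⟨a, m, isMaxClassGenerator_of_conj hP hN hab hm2 ho hs' ?_ ?_⟩
    · have hsodd : Odd s := by
        have h1 : a ^ (s * s) = a := by
          rw [zpow_mul, ← hs', conj_zpow, ← hs', ← mul_assoc, ← mul_assoc, hexpP, one_mul,
            mul_assoc,
            ← mul_inv_rev, hexpP, inv_one, mul_one]
        have h2 : a ^ (s * s - 1) = 1 := by rw [zpow_sub_one, h1, mul_inv_cancel]
        have h3 := (zpow_eq_zpow_iff_dvd ho _).1 h2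
        have h4 : (2 : ℤ) ∣ ((2 ^ m : ℕ) : ℤ) := by
          push_cast
          exact dvd_pow_self 2 (by omega)
        have h5 := h4.trans h3
        rw [← Int.not_even_iff_odd]
        rintro ⟨k, rfl⟩
        have h6 : (k + k) * (k + k) - 1 = 2 * (2 * (k * k)) - 1 := by ring
        rw [h6] at h5
        omega
      by_contra hs4
      obtain ⟨q, hq⟩ : ∃ q, s - 1 = 4 * q := ⟨(s - 1) / 4, by rw [Int.odd_iff] at hsodd; omega⟩
      -- the elements of order `4` of the cyclic subgroup would be centralized by `x`
      have hfo : a ^ 2 ^ (m - 2) ∈ Q := by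
        refine hcent _ ?_
        have h1 : (x : P) * a ^ 2 ^ (m - 2) * (x : P)⁻¹ = a ^ 2 ^ (m - 2) := by
          rw [← conj_pow, hs', ← zpow_natCast, ← zpow_natCast, ← zpow_mul, ← mul_inv_eq_one,
            ← zpow_neg, ← zpow_add, zpow_eq_zpow_iff_dvd ho]
          have h2 : s * ((2 ^ (m - 2) : ℕ) : ℤ) + -((2 ^ (m - 2) : ℕ) : ℤ) =
              ((2 ^ m : ℕ) : ℤ) * q := by
            have h3 : s * ((2 ^ (m - 2) : ℕ) : ℤ) + -((2 ^ (m - 2) : ℕ) : ℤ) =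
              (s - 1) * ((2 ^ (m - 2) : ℕ) : ℤ) := by ring
            have h4 : 2 ^ m = 2 ^ (m - 2) * 2 ^ 2 := by rw [← pow_add]; congr 1; omega
            rw [h3, hq, h4]
            push_cast
            ring
          rw [h2]
          exact dvd_mul_right _ _
        exact (mul_inv_eq_iff_eq_mul.1 h1).symm
      have h1 := hexpP ⟨_, hfo⟩
      have h2 : a ^ (2 ^ (m - 2) + 2 ^ (m - 2)) = 1 := by rw [pow_add]; exact h1
      rw [← orderOf_dvd_iff_pow_eq_one, ho, ← two_mul, ← pow_succ'] at h2
      have := (Nat.pow_dvd_pow_iff_le_right (by norm_num)).1 h2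
      omega
    · rw [sq, hexpP]
      exact one_mem _
  · -- the cyclic subgroup is `{1, z}`, so `P` is abelian
    left
    have ha : a ^ 2 = 1 := by
      rw [← orderOf_dvd_iff_pow_eq_one, ho]
      have : 2 ^ m ∣ 2 ^ 1 := pow_dvd_pow 2 (by omega)
      simpa using this
    have haz : a = 1 ∨ a = z := hzpow a (Subgroup.mem_zpowers a) (by rw [← sq, ha])
    have hac : ∀ g : P, a * g = g * a := by
      intro g
      rcases haz with h | h
      · rw [h]; simp
      · rw [h, eq_comm, ← mul_inv_eq_iff_eq_mul]
        exact hzc g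
    rw [eq_top_iff]
    intro g _
    refine hcent g ?_
    obtain ⟨i, j, rfl⟩ := hab g
    obtain ⟨i', j', hx⟩ := hab x
    rw [hx]
    have h1 : Commute a b := hac b
    have h2 : Commute (b ^ i * a ^ j) (b ^ i') :=
      ((Commute.refl b).zpow_zpow i i').mul_left (h1.zpow_zpow j i')
    have h3 : Commute (b ^ i * a ^ j) (a ^ j') :=
      (h1.symm.zpow_zpow i j').mul_left ((Commute.refl a).zpow_zpow j j')
    exact (h2.mul_right h3).eq

end MetacyclicTwoGroups

/-! ### Saturated fusion systems on the remaining metacyclic `2`-groups -/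

section Inner

variable {P : Type*} [Group P]

theorem IsHomocyclicPair.mul_comm {G : Type*} [Group G] {n : ℕ} {a c : G}
    (h : IsHomocyclicPair n a c) (x y : G) : x * y = y * x := by
  obtain ⟨i, j, rfl⟩ := h.gen x
  obtain ⟨i', j', rfl⟩ := h.gen y
  have hc : Commute a c := h.comm
  have h1 : Commute (a ^ i * c ^ j) (a ^ i') :=
    ((Commute.refl a).zpow_zpow i i').mul_left (hc.symm.zpow_zpow j i')
  have h2 : Commute (a ^ i * c ^ j) (c ^ j') :=
    (hc.zpow_zpow i j').mul_left ((Commute.refl c).zpow_zpow j j')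
  exact (h1.mul_right h2).eq

/-- Let `Q` be a homocyclic subgroup of rank `2` and exponent at least `4` of a metacyclic
`2`-group. Elements `t` normalizing `Q` with `t ^ 2 ∈ Q` act trivially on `Q` modulo squares. This
is where the wreath products, in which such an element swaps two generators, are excluded. -/
theorem exists_sq_of_mem_normalizer [Finite P] (hP : IsPGroup 2 P) (hm : IsMetacyclic P)
    {Q : Subgroup P} {r : ℕ} (hr : 2 ≤ r) {a c : Q} (h : IsHomocyclicPair r a c) {t : P}
    (ht : t ∈ Subgroup.normalizer (Q : Set P)) (ht2 : t ^ 2 ∈ Q) {y : P} (hy : y ∈ Q) :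
    ∃ w ∈ Q, t * y * t⁻¹ * y⁻¹ = w ^ 2 := by
  obtain ⟨N, hN, hNc, hNq⟩ := hm
  have hcomm : ∀ x ∈ Q, ∀ y ∈ Q, x * y = y * x := fun x hx y hy =>
    congrArg Subtype.val (h.mul_comm ⟨x, hx⟩ ⟨y, hy⟩)
  have hnorm : ∀ x ∈ Q, t * x * t⁻¹ ∈ Q := fun x hx => (Subgroup.mem_normalizer_iff.1 ht x).1 hx
  have hnorm' : ∀ x ∈ Q, t⁻¹ * x * t ∈ Q := fun x hx => by
    have := (Subgroup.mem_normalizer_iff.1 (inv_mem ht) x).1 hx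
    rwa [inv_inv] at this
  have hNcomm : ∀ x ∈ N, ∀ y ∈ N, x * y = y * x := fun x hx y hy =>
    congrArg Subtype.val ((IsCyclic.isMulCommutative (α := N)).is_comm.comm ⟨x, hx⟩ ⟨y, hy⟩)
  have hcmp : ∀ g h : P, (∃ k : ℤ, h ^ (-k) * g ∈ N) ∨ ∃ k : ℤ, g ^ (-k) * h ∈ N := by
    intro g h
    rcases mem_zpowers_or_mem_zpowers (hP.to_quotient N) (g : P ⧸ N) (h : P ⧸ N) with
      ⟨k, hk⟩ | ⟨k, hk⟩
    · left
      refine ⟨k, ?_⟩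
      rw [zpow_neg]
      exact QuotientGroup.eq.1 (by rw [QuotientGroup.mk_zpow]; exact hk)
    · right
      refine ⟨k, ?_⟩
      rw [zpow_neg]
      exact QuotientGroup.eq.1 (by rw [QuotientGroup.mk_zpow]; exact hk)
  -- `Q ⊓ N` has an element of order at least `4`
  have hpow : ∀ g : Q, orderOf g = 2 ^ r → g ^ (2 : ℤ) ≠ 1 := by
    intro g hg h1
    have h2 : orderOf g ∣ 2 ^ 1 := by
      rw [orderOf_dvd_iff_pow_eq_one]
      exact_mod_cast h1
    rw [hg] at h2
    have := (Nat.pow_dvd_pow_iff_le_right (by norm_num)).1 h2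
    omega
  obtain ⟨l, hlQ, hlN, hl⟩ : ∃ l ∈ Q, l ∈ N ∧ l ^ 2 ≠ 1 := by
    have hac : Commute a c := h.comm
    rcases hcmp a c with ⟨k, hk⟩ | ⟨k, hk⟩
    · refine ⟨_, (c ^ (-k) * a).2, hk, fun h1 => hpow a h.orderOf_left ?_⟩
      have h2 : (c ^ (-k) * a) ^ 2 = 1 := Subtype.ext h1
      rw [(hac.symm.zpow_left (-k)).mul_pow] at h2
      refine h.indep 2 (2 * k) ?_
      rw [zpow_ofNat, eq_inv_of_mul_eq_one_right h2, ← zpow_natCast, ← zpow_mul, ← zpow_neg]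
      congr 1
      push_cast
      ring
    · refine ⟨_, (a ^ (-k) * c).2, hk, fun h1 => hpow c h.orderOf_right ?_⟩
      have h2 : (a ^ (-k) * c) ^ 2 = 1 := Subtype.ext h1
      rw [(hac.zpow_left (-k)).mul_pow] at h2
      have h3 : a ^ (2 * k) = c ^ (2 : ℤ) := by
        rw [zpow_ofNat, eq_inv_of_mul_eq_one_right h2, ← zpow_natCast, ← zpow_mul, ← zpow_neg]
        congr 1
        push_cast
        ring
      rw [← h3]
      exact h.indep _ _ h3
  have hLcyc : IsCyclic (Q ⊓ N : Subgroup P) :=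
    isCyclic_of_injective _ (Subgroup.inclusion_injective (inf_le_right : Q ⊓ N ≤ N))
  obtain ⟨⟨x, hxL⟩, hx⟩ := hLcyc.exists_generator
  obtain ⟨hxQ, hxN⟩ := Subgroup.mem_inf.1 hxL
  have hL : ∀ k ∈ Q, k ∈ N → ∃ i : ℤ, k = x ^ i := by
    intro k hkQ hkN
    obtain ⟨i, hi⟩ := hx ⟨k, hkQ, hkN⟩
    exact ⟨i, (congrArg Subtype.val hi).symm⟩
  have heven : ∀ i : ℤ, Even i → ∃ w ∈ Q, x ^ i = w ^ 2 := by
    rintro _ ⟨i, rfl⟩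
    exact ⟨x ^ i, zpow_mem hxQ i, by rw [zpow_add, sq]⟩
  have hinvol : ∀ k ∈ Q, k ∈ N → k ^ 2 = 1 → ∃ w ∈ Q, k = w ^ 2 := by
    intro k hkQ hkN hk
    obtain ⟨i, rfl⟩ := hL k hkQ hkN
    rcases Int.even_or_odd i with hi | hi
    · exact heven i hi
    · exfalso
      obtain ⟨n, hn⟩ := IsPGroup.iff_orderOf.1 hP x
      have h1 : ((2 ^ n : ℕ) : ℤ) ∣ 2 * i := by
        rw [← zpow_eq_zpow_iff_dvd hn, _root_.mul_comm, zpow_mul]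
        exact_mod_cast hk
      have h2 : x ^ (2 : ℤ) = 1 :=
        (zpow_eq_zpow_iff_dvd hn 2).2 ((int_odd_coprime_two_pow hi n).dvd_of_dvd_mul_right h1)
      obtain ⟨j, rfl⟩ := hL l hlQ hlN
      refine hl ?_
      rw [← zpow_natCast, ← zpow_mul, _root_.mul_comm, zpow_mul]
      exact_mod_cast (by rw [h2, one_zpow] : (x ^ (2 : ℤ)) ^ j = 1)
  have hkQ : t * y * t⁻¹ * y⁻¹ ∈ Q := mul_mem (hnorm y hy) (inv_mem hy)
  have hkN : t * y * t⁻¹ * y⁻¹ ∈ N := by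
    rw [← QuotientGroup.eq_one_iff]
    have : (t : P ⧸ N) * y = y * t := (IsCyclic.isMulCommutative (α := P ⧸ N)).is_comm.comm _ _
    rw [QuotientGroup.mk_mul, QuotientGroup.mk_mul, QuotientGroup.mk_mul, this]
    simp
  -- if the coset of `t` meets `N`, the commutator has order at most `2`
  have caseA : ∀ q ∈ Q, q * t ∈ N → ∃ w ∈ Q, t * y * t⁻¹ * y⁻¹ = w ^ 2 := by
    intro q hq hqt
    refine hinvol _ hkQ hkN ?_
    have h1 : t * y * t⁻¹ * y⁻¹ = q * t * (y * (q * t)⁻¹ * y⁻¹) := by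
      have h2 := hcomm q hq _ (hnorm y hy)
      calc t * y * t⁻¹ * y⁻¹ = (t * y * t⁻¹) * q * q⁻¹ * y⁻¹ := by group
        _ = q * t * (y * (q * t)⁻¹ * y⁻¹) := by rw [← h2]; group
    have hs : (q * t) ^ 2 ∈ Q := by
      have : (q * t) ^ 2 = q * (t * q * t⁻¹) * t ^ 2 := by rw [sq, sq]; group
      rw [this]
      exact mul_mem (mul_mem hq (hnorm q hq)) ht2
    have h2 : y * ((q * t) ^ 2)⁻¹ * y⁻¹ = ((q * t) ^ 2)⁻¹ := by
      rw [hcomm y hy _ (inv_mem hs), mul_inv_cancel_right]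
    have h3 : Commute (q * t) (y * (q * t)⁻¹ * y⁻¹) :=
      hNcomm _ hqt _ (hN.conj_mem _ (inv_mem hqt) y)
    rw [h1, h3.mul_pow, conj_pow, inv_pow, h2, mul_inv_cancel]
  rcases hcmp y t with ⟨k, hk⟩ | ⟨k, hk⟩
  · rcases Int.even_or_odd' k with ⟨q, hq | hq⟩
    · -- `y = t ^ k * n` with `n ∈ Q ⊓ N`
      have htk : t ^ k ∈ Q := by
        rw [hq, zpow_mul, zpow_ofNat]
        exact zpow_mem ht2 q
      set n := t ^ (-k) * y with hn
      have hnQ : n ∈ Q := mul_mem (by rw [zpow_neg]; exact inv_mem htk) hy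
      obtain ⟨e, he⟩ := hL n hnQ hk
      obtain ⟨j, hj⟩ := hL _ (hnorm x hxQ) (hN.conj_mem x hxN t)
      have hyn : y = t ^ k * n := by rw [hn, zpow_neg, mul_inv_cancel_left]
      have hcalc : t * y * t⁻¹ * y⁻¹ = t ^ k * (x ^ ((j - 1) * e)) * (t ^ k)⁻¹ := by
        have h1 : x ^ ((j - 1) * e) = t * n * t⁻¹ * n⁻¹ := by
          rw [he, ← conj_zpow, hj, ← zpow_mul, ← zpow_neg, ← zpow_add]
          congr 1
          ring
        rw [h1]
        nth_rewrite 1 [hyn]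
        rw [hyn]
        group
      have hsq : ∃ w ∈ Q, x ^ ((j - 1) * e) = w ^ 2 := by
        rcases Int.even_or_odd j with hj' | hj'
        · obtain ⟨f, hf⟩ := hL _ (hnorm' x hxQ) (by
            have := hN.conj_mem x hxN t⁻¹
            rwa [inv_inv] at this)
          have h1 : x = x ^ (j * f) := by
            rw [zpow_mul, ← hj, conj_zpow, ← hf]
            group
          have h2 : x ^ ((j - 1) * e) = x ^ ((j * f) * ((j - 1) * e)) := by
            rw [zpow_mul x (j * f), ← h1]
          rw [h2]
          exact heven _ ((hj'.mul_right f).mul_right _)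
        · refine heven _ (Even.mul_right ?_ e)
          exact hj'.sub_odd odd_one
      obtain ⟨w, hw, hxw⟩ := hsq
      refine ⟨t ^ k * w * (t ^ k)⁻¹, mul_mem (mul_mem htk hw) (inv_mem htk), ?_⟩
      rw [hcalc, hxw, conj_pow]
    · have htk : t ^ (-k - 1) ∈ Q := by
        have : -k - 1 = 2 * (-q - 1) := by rw [hq]; ring
        rw [this, zpow_mul, zpow_ofNat]
        exact zpow_mem ht2 _
      refine caseA (t ^ (-k - 1) * (t * y * t⁻¹)) (mul_mem htk (hnorm y hy)) ?_
      have : t ^ (-k - 1) * (t * y * t⁻¹) * t = t ^ (-k) * y := by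
        rw [zpow_sub_one]
        group
      rwa [this]
  · exact caseA _ (zpow_mem hy _) hk

theorem exists_odd_of_not_isPGroup {M : Type*} [Group M] [Finite M] (h : ¬ IsPGroup 2 M) :
    ∃ x : M, Odd (orderOf x) ∧ x ≠ 1 := by
  have : ∃ q, q.Prime ∧ q ∣ Nat.card M ∧ q ≠ 2 := by
    by_contra! hq
    refine h (IsPGroup.of_card (n := (Nat.card M).primeFactorsList.length) ?_)
    exact Nat.eq_prime_pow_of_unique_prime_dvd Nat.card_pos.ne' fun {d} hd hdvd => hq d hd hdvd
  obtain ⟨q, hq, hdvd, hq2⟩ := this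
  have := Fact.mk hq
  obtain ⟨x, hx⟩ := exists_prime_orderOf_dvd_card' q hdvd
  refine ⟨x, hx ▸ hq.odd_of_ne_two hq2, ?_⟩
  rintro rfl
  rw [orderOf_one] at hx
  exact hq.one_lt.ne hx

namespace FusionSystem

/-- An automorphism of a fully normalized subgroup `Q` that extends to a larger subgroup is
accounted for by the morphisms on larger subgroups. -/
theorem IsSaturated.mem_aut_of_extender_ne [Finite P] {p : ℕ} {F G : FusionSystem P}
    (hF : F.IsSaturated p) {Q : Subgroup P} (hQ : F.IsFullyNormalized Q)
    (hbig : ∀ R S : Subgroup P, Nat.card Q < Nat.card R → F.Hom R S ⊆ G.Hom R S)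
    {β : MulAut Q} (hβ : β ∈ F.aut Q) {g : P} (hg : g ∈ extender β) (hgQ : g ∉ Q) :
    β ∈ G.aut Q := by
  obtain ⟨ψ, hψ, hx⟩ := hF.extension Q Q β hβ (hF.fullyCentralized Q hQ)
  refine G.restrict_mem (hbig _ _ ?_ hψ) (le_extender β) _ fun x => (hx x).symm
  refine lt_of_not_ge fun hle => hgQ ?_
  rw [Subgroup.eq_of_le_of_card_ge (le_extender β) hle]
  exact hg

theorem IsSaturated.mem_aut_of_centralizer [Finite P] {p : ℕ} {F G : FusionSystem P}
    (hF : F.IsSaturated p) {Q : Subgroup P} (hQ : F.IsFullyNormalized Q)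
    (hbig : ∀ R S : Subgroup P, Nat.card Q < Nat.card R → F.Hom R S ⊆ G.Hom R S)
    (hC : ¬ Subgroup.centralizer (Q : Set P) ≤ Q) : F.aut Q ≤ G.aut Q := by
  intro β hβ
  obtain ⟨g, hg, hgQ⟩ := SetLike.not_le_iff_exists.1 hC
  refine hF.mem_aut_of_extender_ne hQ hbig hβ ((mem_extender β g).2
    ⟨Subgroup.centralizer_le_normalizer _ hg, ?_⟩) hgQ
  have h1 : Q.normalizerMonoidHom ⟨g, Subgroup.centralizer_le_normalizer _ hg⟩ = 1 := by
    refine MulEquiv.ext fun x => Subtype.ext ?_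
    change g * x * g⁻¹ = x
    rw [← Subgroup.mem_centralizer_iff.1 hg x x.2, mul_inv_cancel_right]
  rw [h1, map_one]
  exact one_mem _

/-- On a homocyclic subgroup of exponent at least `4`, the automorphisms that are trivial modulo
squares form a normal `2`-subgroup of `Aut_F(Q)`, hence are induced by `P`. Some element of
`N_P(Q)` outside `Q` acts in this way, so every automorphism of `Q` in `F` extends. -/
theorem IsSaturated.aut_le_of_homocyclic [Finite P] {F G : FusionSystem P} (hP : IsPGroup 2 P)
    (hm : IsMetacyclic P) (hF : F.IsSaturated 2) {Q : Subgroup P} (hQ : F.IsFullyNormalized Q)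
    (hbig : ∀ R S : Subgroup P, Nat.card Q < Nat.card R → F.Hom R S ⊆ G.Hom R S)
    (htop : Q ≠ ⊤) {r : ℕ} (hr : 2 ≤ r) {a c : Q} (hac : IsHomocyclicPair r a c) :
    F.aut Q ≤ G.aut Q := by
  intro β hβ
  obtain ⟨g, hgN, hgQ⟩ := SetLike.exists_of_lt (lt_normalizer hP htop)
  obtain ⟨t, htN, htQ, ht2⟩ : ∃ t ∈ Subgroup.normalizer (Q : Set P), t ∉ Q ∧ t ^ 2 ∈ Q := by
    classical
    have hex : ∃ k, g ^ 2 ^ k ∈ Q := by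
      obtain ⟨k, hk⟩ := IsPGroup.iff_orderOf.1 hP g
      exact ⟨k, by rw [← hk, pow_orderOf_eq_one]; exact one_mem Q⟩
    have h0 : Nat.find hex ≠ 0 := by
      intro h0
      have := Nat.find_spec hex
      rw [h0, pow_zero, pow_one] at this
      exact hgQ this
    refine ⟨g ^ 2 ^ (Nat.find hex - 1), pow_mem hgN _, Nat.find_min hex (by omega), ?_⟩
    rw [← pow_mul, ← pow_succ, Nat.sub_add_cancel (by omega)]
    exact Nat.find_spec hex
  have hQ2 : IsPGroup 2 Q := hP.to_subgroup Q
  let f : F.aut Q →* MulAut (Q ⧸ squareSubgroup Q) :=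
    MonoidHom.mk' (fun α => squareQuotientAut α.1) fun α β => squareQuotientAut_mul α.1 β.1
  have hker : IsPGroup 2 f.ker := by
    by_contra hcon
    obtain ⟨x, hx, hx1⟩ := exists_odd_of_not_isPGroup hcon
    refine hx1 (Subtype.ext (Subtype.ext ?_))
    refine eq_one_of_odd_of_squareQuotient hQ2 _ ?_ x.2
    rwa [Subgroup.orderOf_coe, Subgroup.orderOf_coe]
  obtain ⟨S, hS⟩ := hF.sylow Q hQ
  have hkerS := hker.le_sylow_of_normal S
  have hct : Q.normalizerMonoidHom ⟨t, htN⟩ ∈ F.aut Q := autP_le_aut F Q ⟨_, rfl⟩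
  have hctk : (⟨_, hct⟩ : F.aut Q) ∈ f.ker := by
    refine MulEquiv.ext fun v => ?_
    induction v using QuotientGroup.induction_on with
    | H y =>
      refine (QuotientGroup.eq (s := squareSubgroup Q)).2 ?_
      obtain ⟨w, hw, hyw⟩ := exists_sq_of_mem_normalizer hP hm hr hac htN ht2 y.2
      have h1 : ((Q.normalizerMonoidHom ⟨t, htN⟩) y)⁻¹ * y = ((⟨w, hw⟩ : Q) ^ 2)⁻¹ := by
        rw [hac.mul_comm, eq_comm, inv_eq_iff_eq_inv, mul_inv_rev, inv_inv]
        exact Subtype.ext hyw.symm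
      change ((Q.normalizerMonoidHom ⟨t, htN⟩) y)⁻¹ * y ∈ squareSubgroup Q
      rw [h1]
      exact inv_mem (sq_mem_squareSubgroup _)
  refine hF.mem_aut_of_extender_ne hQ hbig hβ ((mem_extender β t).2 ⟨htN, ?_⟩) htQ
  have h2 := hkerS ((inferInstance : f.ker.Normal).conj_mem _ hctk ⟨β, hβ⟩)
  have h3 : (⟨β, hβ⟩ * ⟨_, hct⟩ * ⟨β, hβ⟩⁻¹ : F.aut Q) ∈ (S : Subgroup (F.aut Q)) := h2
  rw [hS, Subgroup.mem_subgroupOf] at h3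
  exact h3

theorem inner_hom_subset (F : FusionSystem P) (Q R : Subgroup P) :
    (inner P).Hom Q R ⊆ F.Hom Q R := by
  rintro φ ⟨g, hg⟩
  exact F.conj_mem g φ hg

/-- The metacyclic `2`-groups that are neither homocyclic nor of maximal class carry only the
trivial saturated fusion system. -/
theorem IsSaturated.eq_inner [Finite P] {F : FusionSystem P} (hP : IsPGroup 2 P)
    (hm : IsMetacyclic P) (hF : F.IsSaturated 2) (hhom : ¬ IsHomocyclicTwoGroup P)
    (hmax : ¬ ∃ (a : P) (m : ℕ), IsMaxClassGenerator a m) : F = inner P := by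
  refine ext_of_subset (hF.hom_subset_of_aut_le hP _ fun Q hQ hbig => ?_) (inner_hom_subset F)
  by_cases h2 : IsPGroup 2 (F.aut Q)
  · exact autP_le_of_inner (hF.aut_le_autP hQ h2)
  obtain ⟨α, hα, hα1⟩ := exists_odd_of_not_isPGroup h2
  obtain ⟨a, ⟨n, hn, hac⟩ | hac⟩ := exists_generator_pair_of_odd_mulAut (hP.to_subgroup Q)
    (hm.subgroup Q) (α := α.1) (by rwa [Subgroup.orderOf_coe]) fun h => hα1 (Subtype.ext h)
  · have htop : Q ≠ ⊤ := by
      rintro rfl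
      obtain ⟨e, -, -⟩ := hac.exists_equiv
      exact hhom ⟨n, hn, ⟨(e.trans Subgroup.topEquiv).symm⟩⟩
    by_cases hC : Subgroup.centralizer (Q : Set P) ≤ Q
    · by_cases hn1 : n = 1
      · subst hn1
        rcases eq_top_or_exists_isMaxClassGenerator hP hm hac hC with h | h
        · exact absurd h htop
        · exact absurd h hmax
      · exact hF.aut_le_of_homocyclic hP hm hQ hbig htop (by omega) hac
    · exact hF.mem_aut_of_centralizer hQ hbig hC
  · refine absurd (exists_isMaxClassGenerator_of_quaternion hP hm (i := (a : P))
      (j := (α.1 a : Q)) ?_ ?_ ?_ ?_) hmax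
    · exact fun h => hac.sq_ne (Subtype.ext h)
    · exact congrArg Subtype.val hac.pow_four
    · exact congrArg Subtype.val hac.sq_eq
    · exact congrArg Subtype.val hac.conj

end FusionSystem

end Inner

/-! ### The structure of `2`-groups of maximal class -/

section MaxClass

variable {P : Type*} [Group P] {a : P} {m : ℕ}

namespace IsMaxClassGenerator

theorem normal (h : IsMaxClassGenerator a m) : (Subgroup.zpowers a).Normal :=
  Subgroup.normal_of_index_eq_two h.index_eq

theorem mul_mem_iff (h : IsMaxClassGenerator a m) {x y : P} :
    x * y ∈ Subgroup.zpowers a ↔ (x ∈ Subgroup.zpowers a ↔ y ∈ Subgroup.zpowers a) :=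
  Subgroup.mul_mem_iff_of_index_two h.index_eq

theorem card_eq (h : IsMaxClassGenerator a m) : Nat.card P = 2 ^ (m + 1) := by
  rw [← (Subgroup.zpowers a).card_mul_index, h.index_eq, Nat.card_zpowers, h.orderOf_eq, pow_succ]

theorem finite (h : IsMaxClassGenerator a m) : Finite P :=
  Nat.finite_of_card_ne_zero (by rw [h.card_eq]; positivity)

theorem isPGroup (h : IsMaxClassGenerator a m) : IsPGroup 2 P := IsPGroup.of_card h.card_eq

theorem exists_notMem (h : IsMaxClassGenerator a m) : ∃ x, x ∉ Subgroup.zpowers a := by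
  by_contra! hx
  have := h.index_eq
  rw [(Subgroup.eq_top_iff' _).2 hx, Subgroup.index_top] at this
  omega

theorem zpow_eq_one_iff (h : IsMaxClassGenerator a m) (i : ℤ) :
    a ^ i = 1 ↔ ((2 ^ m : ℕ) : ℤ) ∣ i := zpow_eq_zpow_iff_dvd h.orderOf_eq i

theorem involution_sq (h : IsMaxClassGenerator a m) :
    a ^ 2 ^ (m - 1) * a ^ 2 ^ (m - 1) = 1 := by
  have := h.two_le
  rw [← pow_add, ← two_mul, ← pow_succ', show m - 1 + 1 = m by omega, ← h.orderOf_eq,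
    pow_orderOf_eq_one]

theorem involution_ne (h : IsMaxClassGenerator a m) : a ^ 2 ^ (m - 1) ≠ 1 := by
  have := h.two_le
  rw [Ne, ← orderOf_dvd_iff_pow_eq_one, h.orderOf_eq, Nat.pow_dvd_pow_iff_le_right (by norm_num)]
  omega

theorem comm (_h : IsMaxClassGenerator a m) {x y : P} (hx : x ∈ Subgroup.zpowers a)
    (hy : y ∈ Subgroup.zpowers a) : x * y = y * x := by
  obtain ⟨i, rfl⟩ := hx
  obtain ⟨j, rfl⟩ := hy
  exact ((Commute.refl a).zpow_zpow i j).eq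

theorem conj_zpow (h : IsMaxClassGenerator a m) {y : P} (hy : y ∉ Subgroup.zpowers a) (k : ℤ) :
    y * a ^ k * y⁻¹ = a ^ (-k) ∨
      3 ≤ m ∧ y * a ^ k * y⁻¹ = a ^ (-k) * (a ^ 2 ^ (m - 1)) ^ k := by
  rw [← _root_.conj_zpow]
  rcases h.conj y hy with h1 | ⟨h3, h1⟩
  · left
    rw [h1, inv_zpow, zpow_neg]
  · right
    refine ⟨h3, ?_⟩
    have hc : Commute a⁻¹ (a ^ 2 ^ (m - 1)) := ((Commute.refl a).pow_right _).inv_left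
    rw [h1, hc.mul_zpow, inv_zpow, zpow_neg]

theorem conj_eq_inv (h : IsMaxClassGenerator a m) {y w : P} (hy : y ∉ Subgroup.zpowers a)
    (hw : w ∈ Subgroup.zpowers a) (hw4 : w ^ 4 = 1) : y * w * y⁻¹ = w⁻¹ := by
  obtain ⟨k, rfl⟩ := hw
  change y * a ^ k * y⁻¹ = (a ^ k)⁻¹
  have hw4' : (a ^ k) ^ 4 = 1 := hw4
  rcases h.conj_zpow hy k with h1 | ⟨h3, h1⟩
  · rw [h1, zpow_neg]
  · have hk : Even k := by
      rw [← zpow_natCast, ← zpow_mul, h.zpow_eq_one_iff] at hw4'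
      have h8 : ((8 : ℕ) : ℤ) ∣ ((2 ^ m : ℕ) : ℤ) := by
        have : 2 ^ 3 ∣ 2 ^ m := pow_dvd_pow 2 h3
        exact_mod_cast this
      have := h8.trans hw4'
      rw [Int.even_iff]
      omega
    rw [h1, zpow_eq_of_mul_self h.involution_sq, if_pos hk, mul_one, zpow_neg]

theorem sq_eq_one_of_conj_eq (h : IsMaxClassGenerator a m) {y w : P}
    (hy : y ∉ Subgroup.zpowers a) (hw : w ∈ Subgroup.zpowers a) (hyw : y * w * y⁻¹ = w) :
    w ^ 2 = 1 := by
  obtain ⟨k, rfl⟩ := hw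
  have hyw' : y * a ^ k * y⁻¹ = a ^ k := hyw
  have key : a ^ (2 * k) = (a ^ 2 ^ (m - 1)) ^ k ∧ 3 ≤ m ∨ a ^ (2 * k) = 1 := by
    rw [two_mul, zpow_add]
    rcases h.conj_zpow hy k with h1 | ⟨h3, h1⟩
    · right
      nth_rewrite 1 [← hyw']
      rw [h1, zpow_neg, inv_mul_cancel]
    · left
      refine ⟨?_, h3⟩
      nth_rewrite 1 [← hyw']
      have hc : Commute ((a ^ 2 ^ (m - 1)) ^ k) (a ^ k) :=
        ((Commute.refl a).pow_left _).zpow_zpow k k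
      rw [h1, mul_assoc, hc.eq, zpow_neg, inv_mul_cancel_left]
  have h2 : a ^ (2 * k) = 1 := by
    rcases key with ⟨h1, h3⟩ | h1
    · rw [h1, zpow_eq_of_mul_self h.involution_sq, if_pos]
      have h4 : (a ^ (2 * k)) ^ 2 = 1 := by
        rw [h1, ← zpow_natCast, ← zpow_mul, mul_comm, zpow_mul, zpow_natCast, sq, h.involution_sq,
          one_zpow]
      rw [← zpow_natCast, ← zpow_mul, h.zpow_eq_one_iff] at h4
      have h8 : ((8 : ℕ) : ℤ) ∣ ((2 ^ m : ℕ) : ℤ) := by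
        have : 2 ^ 3 ∣ 2 ^ m := pow_dvd_pow 2 h3
        exact_mod_cast this
      have := h8.trans h4
      rw [Int.even_iff]
      omega
    · exact h1
  change (a ^ k) ^ 2 = 1
  rw [← zpow_natCast, ← zpow_mul, mul_comm]
  exact_mod_cast h2

theorem eq_one_or_eq_of_sq (h : IsMaxClassGenerator a m) {w : P} (hw : w ∈ Subgroup.zpowers a)
    (hw2 : w ^ 2 = 1) : w = 1 ∨ w = a ^ 2 ^ (m - 1) := by
  have := h.finite
  rcases eq_or_eq_of_isCyclic_of_mul_self (C := Subgroup.zpowers a) (u := ⟨w, hw⟩)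
    (v := ⟨a ^ 2 ^ (m - 1), pow_mem (Subgroup.mem_zpowers a) _⟩)
    (Subtype.ext (by rw [sq] at hw2; exact hw2)) (Subtype.ext h.involution_sq) with h1 | h1 | h1
  · exact Or.inl (congrArg Subtype.val h1)
  · exact absurd (congrArg Subtype.val h1) h.involution_ne
  · exact Or.inr (congrArg Subtype.val h1)

theorem sq_mem (h : IsMaxClassGenerator a m) (y : P) : y ^ 2 ∈ Subgroup.zpowers a :=
  Subgroup.sq_mem_of_index_two h.index_eq y

theorem pow_four (h : IsMaxClassGenerator a m) {y : P} (hy : y ∉ Subgroup.zpowers a) :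
    y ^ 4 = 1 := by
  have := h.sq_eq_one_of_conj_eq hy (h.sq_mem y) (by group)
  rwa [← pow_mul] at this

theorem sq_eq (h : IsMaxClassGenerator a m) {y : P} (hy : y ∉ Subgroup.zpowers a) :
    y ^ 2 = 1 ∨ y ^ 2 = a ^ 2 ^ (m - 1) :=
  h.eq_one_or_eq_of_sq (h.sq_mem y) (by rw [← pow_mul]; exact h.pow_four hy)

theorem orderOf_eq_two_or_four (h : IsMaxClassGenerator a m) {y : P}
    (hy : y ∉ Subgroup.zpowers a) :
    orderOf y = 2 ∧ y ^ 2 = 1 ∨ orderOf y = 4 ∧ y ^ 2 = a ^ 2 ^ (m - 1) := by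
  rcases h.sq_eq hy with h2 | h2
  · left
    refine ⟨orderOf_eq_prime h2 ?_, h2⟩
    rintro rfl
    exact hy (one_mem _)
  · right
    refine ⟨orderOf_eq_prime_pow (p := 2) (n := 1) ?_ ?_, h2⟩
    · rw [pow_one, h2]
      exact h.involution_ne
    · exact h.pow_four hy

theorem involution_central (h : IsMaxClassGenerator a m) (g : P) :
    g * a ^ 2 ^ (m - 1) * g⁻¹ = a ^ 2 ^ (m - 1) := by
  have hz : a ^ 2 ^ (m - 1) ∈ Subgroup.zpowers a := pow_mem (Subgroup.mem_zpowers a) _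
  by_cases hg : g ∈ Subgroup.zpowers a
  · rw [h.comm hg hz, mul_inv_cancel_right]
  · rw [h.conj_eq_inv hg hz]
    · exact inv_eq_of_mul_eq_one_right h.involution_sq
    · rw [show 4 = 2 * 2 by norm_num, pow_mul, sq (a ^ 2 ^ (m - 1)), h.involution_sq, one_pow]

end IsMaxClassGenerator

/-- The subgroup of the elements of `⟨a⟩` of exponent `q`. -/
def torsionZpowers (a : P) (q : ℕ) : Subgroup P where
  carrier := {w | w ∈ Subgroup.zpowers a ∧ w ^ q = 1}
  one_mem' := ⟨one_mem _, one_pow q⟩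
  mul_mem' := by
    rintro _ _ ⟨⟨i, rfl⟩, hi⟩ ⟨⟨j, rfl⟩, hj⟩
    refine ⟨⟨i + j, zpow_add a i j⟩, ?_⟩
    have hc : Commute (a ^ i) (a ^ j) := (Commute.refl a).zpow_zpow i j
    exact (hc.mul_pow q).trans (by rw [hi, hj, one_mul])
  inv_mem' := by
    rintro w ⟨hw, hq⟩
    exact ⟨inv_mem hw, by rw [inv_pow, hq, inv_one]⟩

/-- For `y` outside `⟨a⟩` in a `2`-group of maximal class, the subgroup generated by `y` and the
elements of `⟨a⟩` whose order divides that of `y`. It is a four-group if `y` is an involution and a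
quaternion group of order `8` if `y` has order `4`. -/
noncomputable def essentialSubgroup (a y : P) : Subgroup P :=
  torsionZpowers a (orderOf y) ⊔ Subgroup.zpowers y

theorem self_mem_essentialSubgroup (y : P) : y ∈ essentialSubgroup a y :=
  Subgroup.mem_sup_right (Subgroup.mem_zpowers y)

theorem torsion_le_essentialSubgroup (y : P) :
    torsionZpowers a (orderOf y) ≤ essentialSubgroup a y := le_sup_left

/-- `u` and `w` generate a four-group (`q = 2`) or a quaternion group of order `8` (`q = 4`). -/
structure IsEssentialPair {G : Type*} [Group G] (q : ℕ) (u w : G) : Prop where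
  eq_or : q = 2 ∨ q = 4
  orderOf_eq : orderOf u = q
  sq_eq : w ^ 2 = u ^ 2
  conj : w * u * w⁻¹ = u⁻¹
  notMem : w ∉ Subgroup.zpowers u
  gen : ∀ g, g ∈ Subgroup.zpowers u ∨ w⁻¹ * g ∈ Subgroup.zpowers u

theorem IsEssentialPair.exists_mulAut {G : Type*} [Group G] {q : ℕ} {u w u' w' : G}
    (h : IsEssentialPair q u w) (h' : IsEssentialPair q u' w') : ∃ θ : MulAut G, θ u = u' := by
  rcases h.eq_or with rfl | rfl
  · have h1 : w ^ 2 = 1 := by rw [h.sq_eq, ← h.orderOf_eq, pow_orderOf_eq_one]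
    have h1' : w' ^ 2 = 1 := by rw [h'.sq_eq, ← h'.orderOf_eq, pow_orderOf_eq_one]
    obtain ⟨e, he, -⟩ := exists_dihedralGroup_equiv h.orderOf_eq h1 h.conj h.notMem h.gen
    obtain ⟨e', he', -⟩ := exists_dihedralGroup_equiv h'.orderOf_eq h1' h'.conj h'.notMem h'.gen
    refine ⟨e.symm.trans e', ?_⟩
    change e' (e.symm u) = u'
    rw [← he, e.symm_apply_apply, he']
  · obtain ⟨e, he, -⟩ := exists_quaternionGroup_equiv (n := 2) h.orderOf_eq h.sq_eq h.conj h.notMem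
      h.gen
    obtain ⟨e', he', -⟩ := exists_quaternionGroup_equiv (n := 2) h'.orderOf_eq h'.sq_eq h'.conj
      h'.notMem h'.gen
    refine ⟨e.symm.trans e', ?_⟩
    change e' (e.symm u) = u'
    rw [← he, e.symm_apply_apply, he']

theorem IsEssentialPair.card_eq {G : Type*} [Group G] {q : ℕ} {u w : G}
    (h : IsEssentialPair q u w) : Nat.card G = 2 * q := by
  have hidx : (Subgroup.zpowers u).index = 2 :=
    Subgroup.index_eq_two_iff_exists_notMem_and'.2
      ⟨w⁻¹, fun hw => h.notMem (by simpa using hw), fun g => (h.gen g).symm⟩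
  rw [← (Subgroup.zpowers u).card_mul_index, hidx, Nat.card_zpowers, h.orderOf_eq, mul_comm]

/-- A `2`-group of maximal class other than the quaternion group of order `8`. -/
structure IsLargeMaxClassGenerator (a : P) (m : ℕ) : Prop extends IsMaxClassGenerator a m where
  three_le : ∀ y ∉ Subgroup.zpowers a, orderOf y = 4 → 3 ≤ m

namespace IsMaxClassGenerator

theorem exists_torsion_generator (h : IsMaxClassGenerator a m) {y : P}
    (hy : y ∉ Subgroup.zpowers a) :
    ∃ c ∈ Subgroup.zpowers a, orderOf c = orderOf y ∧ c ^ 2 = y ^ 2 ∧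
      torsionZpowers a (orderOf y) = Subgroup.zpowers c := by
  have := h.finite
  have h2 := h.two_le
  have hdvd : orderOf y ∣ 2 ^ m := by
    have h4 : 2 ^ 2 ∣ 2 ^ m := pow_dvd_pow 2 h2
    rcases h.orderOf_eq_two_or_four hy with ⟨h1, -⟩ | ⟨h1, -⟩
    · rw [h1]
      exact dvd_pow_self 2 (by omega)
    · rw [h1]
      exact h4
  set c := a ^ (2 ^ m / orderOf y) with hc
  have hoc : orderOf c = orderOf y := by
    rw [hc, orderOf_pow_of_dvd (Nat.div_pos (Nat.le_of_dvd (by positivity) hdvd)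
      (orderOf_pos y)).ne', h.orderOf_eq, Nat.div_div_self hdvd (by positivity)]
    rw [h.orderOf_eq]
    exact Nat.div_dvd_of_dvd hdvd
  have hcX : c ∈ Subgroup.zpowers a := pow_mem (Subgroup.mem_zpowers a) _
  refine ⟨c, hcX, hoc, ?_, le_antisymm ?_ ?_⟩
  · rcases h.orderOf_eq_two_or_four hy with ⟨h1, h3⟩ | ⟨h1, h3⟩
    · rw [h3, ← orderOf_dvd_iff_pow_eq_one, hoc, h1]
    · rw [h3]
      refine (h.eq_one_or_eq_of_sq (pow_mem hcX 2) ?_).resolve_left ?_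
      · rw [← pow_mul, ← orderOf_dvd_iff_pow_eq_one, hoc, h1]
      · rw [← orderOf_dvd_iff_pow_eq_one, hoc, h1]
        norm_num
  · rintro w ⟨hw, hw2⟩
    obtain ⟨k, hk⟩ := mem_zpowers_of_orderOf_dvd (C := Subgroup.zpowers a) (u := ⟨w, hw⟩)
      (v := ⟨c, hcX⟩) (by
        rw [Subgroup.orderOf_mk, Subgroup.orderOf_mk, hoc]
        exact orderOf_dvd_of_pow_eq_one hw2)
    exact ⟨k, congrArg Subtype.val hk⟩
  · rw [Subgroup.zpowers_le]
    exact ⟨hcX, by rw [← hoc, pow_orderOf_eq_one]⟩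

theorem torsion_pow_four (h : IsMaxClassGenerator a m) {y w : P} (hy : y ∉ Subgroup.zpowers a)
    (hw : w ∈ torsionZpowers a (orderOf y)) : w ^ 4 = 1 := by
  have h1 : orderOf y ∣ 4 := orderOf_dvd_of_pow_eq_one (h.pow_four hy)
  exact orderOf_dvd_iff_pow_eq_one.1 ((orderOf_dvd_of_pow_eq_one hw.2).trans h1)

theorem sq_mem_torsion (h : IsMaxClassGenerator a m) (y : P) :
    y ^ 2 ∈ torsionZpowers a (orderOf y) :=
  ⟨h.sq_mem y, by rw [← pow_mul, mul_comm, pow_mul, pow_orderOf_eq_one, one_pow]⟩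

theorem torsion_normal (h : IsMaxClassGenerator a m) (q : ℕ) : (torsionZpowers a q).Normal :=
  ⟨fun w hw g => ⟨h.normal.conj_mem w hw.1 g, by rw [conj_pow, hw.2, mul_one, mul_inv_cancel]⟩⟩

theorem mem_essentialSubgroup (h : IsMaxClassGenerator a m) {y g : P} :
    g ∈ essentialSubgroup a y ↔
      g ∈ torsionZpowers a (orderOf y) ∨ ∃ w ∈ torsionZpowers a (orderOf y), g = w * y := by
  have := h.torsion_normal (orderOf y)
  have hy2 : ∀ k : ℤ, y ^ (2 * k) ∈ torsionZpowers a (orderOf y) := fun k => by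
    rw [zpow_mul, zpow_ofNat]
    exact zpow_mem (h.sq_mem_torsion y) k
  rw [essentialSubgroup, Subgroup.mem_sup_of_normal_left]
  constructor
  · rintro ⟨w, hw, _, ⟨k, rfl⟩, rfl⟩
    rcases Int.even_or_odd' k with ⟨k, rfl | rfl⟩
    · exact Or.inl (mul_mem hw (hy2 k))
    · exact Or.inr ⟨w * y ^ (2 * k), mul_mem hw (hy2 k), by
        rw [mul_assoc, ← zpow_add_one]⟩
  · rintro (hg | ⟨w, hw, rfl⟩)
    · exact ⟨g, hg, 1, one_mem _, mul_one g⟩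
    · exact ⟨w, hw, y, Subgroup.mem_zpowers y, rfl⟩

theorem mem_torsion_of_mem (h : IsMaxClassGenerator a m) {y g : P} (hy : y ∉ Subgroup.zpowers a)
    (hg : g ∈ essentialSubgroup a y) (hgX : g ∈ Subgroup.zpowers a) :
    g ∈ torsionZpowers a (orderOf y) := by
  rcases (h.mem_essentialSubgroup).1 hg with h1 | ⟨w, hw, rfl⟩
  · exact h1
  · exact absurd ((Subgroup.mul_mem_cancel_left _ hw.1).1 hgX) hy

theorem eq_mul_of_mem (h : IsMaxClassGenerator a m) {y g : P}
    (hg : g ∈ essentialSubgroup a y) (hgX : g ∉ Subgroup.zpowers a) :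
    ∃ w ∈ torsionZpowers a (orderOf y), g = w * y :=
  ((h.mem_essentialSubgroup).1 hg).resolve_left fun h1 => hgX h1.1

theorem mul_sq (h : IsMaxClassGenerator a m) {y w : P} (hy : y ∉ Subgroup.zpowers a)
    (hw : w ∈ torsionZpowers a (orderOf y)) : (w * y) ^ 2 = y ^ 2 := by
  have h1 := h.conj_eq_inv hy hw.1 (h.torsion_pow_four hy hw)
  calc (w * y) ^ 2 = w * (y * w * y⁻¹) * y ^ 2 := by rw [sq, sq]; group
    _ = y ^ 2 := by rw [h1, mul_inv_cancel, one_mul]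

theorem orderOf_eq_of_sq_eq (h : IsMaxClassGenerator a m) {y y' : P}
    (hy : y ∉ Subgroup.zpowers a) (hy' : y' ∉ Subgroup.zpowers a) (hs : y' ^ 2 = y ^ 2) :
    orderOf y' = orderOf y := by
  rcases h.orderOf_eq_two_or_four hy with ⟨h1, h2⟩ | ⟨h1, h2⟩ <;>
    rcases h.orderOf_eq_two_or_four hy' with ⟨h3, h4⟩ | ⟨h3, h4⟩
  · rw [h1, h3]
  · exact absurd (h4.symm.trans (hs.trans h2)) h.involution_ne
  · exact absurd (h2.symm.trans (hs.symm.trans h4)) h.involution_ne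
  · rw [h1, h3]

theorem orderOf_eq_of_mem (h : IsMaxClassGenerator a m) {y g : P} (hy : y ∉ Subgroup.zpowers a)
    (hg : g ∈ essentialSubgroup a y) (hgX : g ∉ Subgroup.zpowers a) : orderOf g = orderOf y := by
  obtain ⟨w, hw, rfl⟩ := h.eq_mul_of_mem hg hgX
  exact h.orderOf_eq_of_sq_eq hy hgX (h.mul_sq hy hw)

theorem essentialSubgroup_eq_of_mem (h : IsMaxClassGenerator a m) {y g : P}
    (hy : y ∉ Subgroup.zpowers a) (hg : g ∈ essentialSubgroup a y)
    (hgX : g ∉ Subgroup.zpowers a) : essentialSubgroup a g = essentialSubgroup a y := by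
  have ho := h.orderOf_eq_of_mem hy hg hgX
  obtain ⟨w, hw, hgw⟩ := h.eq_mul_of_mem hg hgX
  have hyg : y = w⁻¹ * g := by rw [hgw, inv_mul_cancel_left]
  refine le_antisymm ?_ ?_
  · rw [essentialSubgroup, ho]
    exact sup_le (torsion_le_essentialSubgroup y) ((Subgroup.zpowers_le).2 hg)
  · rw [essentialSubgroup]
    nth_rewrite 1 [← ho]
    refine sup_le (torsion_le_essentialSubgroup g) ((Subgroup.zpowers_le).2 ?_)
    rw [hyg]
    refine mul_mem (torsion_le_essentialSubgroup g ?_) (self_mem_essentialSubgroup g)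
    rw [ho]
    exact inv_mem hw

theorem orderOf_conj (g y : P) : orderOf (g * y * g⁻¹) = orderOf y :=
  MulEquiv.orderOf_eq (MulAut.conj g) y

theorem conj_notMem (h : IsMaxClassGenerator a m) {y : P} (hy : y ∉ Subgroup.zpowers a) (g : P) :
    g * y * g⁻¹ ∉ Subgroup.zpowers a := fun hc => by
  have := h.normal.conj_mem _ hc g⁻¹
  refine hy ?_
  have h1 : g⁻¹ * (g * y * g⁻¹) * g⁻¹⁻¹ = y := by group
  rwa [h1] at this

theorem conj_mem_essentialSubgroup (h : IsMaxClassGenerator a m) {y x : P}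
    (hx : x ∈ essentialSubgroup a y) (g : P) :
    g * x * g⁻¹ ∈ essentialSubgroup a (g * y * g⁻¹) := by
  rw [h.mem_essentialSubgroup, orderOf_conj]
  have hn := h.torsion_normal (orderOf y)
  rcases (h.mem_essentialSubgroup).1 hx with h1 | ⟨w, hw, rfl⟩
  · exact Or.inl (hn.conj_mem x h1 g)
  · exact Or.inr ⟨_, hn.conj_mem w hw g, by group⟩

theorem isEssentialPair (h : IsMaxClassGenerator a m) {y c : P} (hy : y ∉ Subgroup.zpowers a)
    (hc : c ∈ essentialSubgroup a y) (hcX : c ∈ Subgroup.zpowers a)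
    (ho : orderOf c = orderOf y) :
    IsEssentialPair (G := essentialSubgroup a y) (orderOf y) ⟨c, hc⟩
      ⟨y, self_mem_essentialSubgroup y⟩ := by
  have := h.finite
  obtain ⟨d, hd, hod, hd2, hdt⟩ := h.exists_torsion_generator hy
  have hct := h.mem_torsion_of_mem hy hc hcX
  have hcd : Subgroup.zpowers c = torsionZpowers a (orderOf y) := by
    refine Subgroup.eq_of_le_of_card_ge ((Subgroup.zpowers_le).2 hct) ?_
    rw [hdt, Nat.card_zpowers, Nat.card_zpowers, hod, ho]
  have hmem : ∀ g (hg : g ∈ essentialSubgroup a y), g ∈ torsionZpowers a (orderOf y) →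
      (⟨g, hg⟩ : essentialSubgroup a y) ∈ Subgroup.zpowers ⟨c, hc⟩ := by
    intro g hg hgt
    rw [← hcd] at hgt
    obtain ⟨k, hk⟩ := hgt
    exact ⟨k, Subtype.ext hk⟩
  refine ⟨?_, ?_, Subtype.ext ?_, Subtype.ext ?_, ?_, ?_⟩
  · rcases h.orderOf_eq_two_or_four hy with ⟨h1, -⟩ | ⟨h1, -⟩
    · exact Or.inl h1
    · exact Or.inr h1
  · rw [Subgroup.orderOf_mk, ho]
  · change y ^ 2 = c ^ 2
    rcases h.orderOf_eq_two_or_four hy with ⟨h1, h2⟩ | ⟨h1, h2⟩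
    · rw [h2, eq_comm, ← orderOf_dvd_iff_pow_eq_one, ho, h1]
    · rw [h2, eq_comm]
      refine (h.eq_one_or_eq_of_sq (pow_mem hcX 2) ?_).resolve_left ?_
      · rw [← pow_mul, ← orderOf_dvd_iff_pow_eq_one, ho, h1]
      · rw [← orderOf_dvd_iff_pow_eq_one, ho, h1]
        norm_num
  · exact h.conj_eq_inv hy hcX (h.torsion_pow_four hy hct)
  · rintro ⟨k, hk⟩
    have hk' : c ^ k = y := congrArg Subtype.val hk
    exact hy (hk' ▸ zpow_mem hcX k)
  · rintro ⟨g, hg⟩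
    rcases (h.mem_essentialSubgroup).1 hg with h1 | ⟨w, hw, rfl⟩
    · exact Or.inl (hmem g hg h1)
    · right
      refine hmem _ _ ?_
      have := (h.torsion_normal (orderOf y)).conj_mem w hw y⁻¹
      have h2 : y⁻¹ * (w * y) = y⁻¹ * w * y⁻¹⁻¹ := by group
      change y⁻¹ * (w * y) ∈ torsionZpowers a (orderOf y)
      rw [h2]
      exact this

theorem card_essentialSubgroup (h : IsMaxClassGenerator a m) {y : P}
    (hy : y ∉ Subgroup.zpowers a) : Nat.card (essentialSubgroup a y) = 2 * orderOf y := by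
  obtain ⟨c, hc, ho, -, ht⟩ := h.exists_torsion_generator hy
  have hcE : c ∈ essentialSubgroup a y :=
    torsion_le_essentialSubgroup y (ht ▸ Subgroup.mem_zpowers c)
  exact (h.isEssentialPair hy hcE hc ho).card_eq

/-- The pair with the roles of `⟨a⟩` and of the second generator exchanged. -/
theorem isEssentialPair_swap (h : IsMaxClassGenerator a m) {y c : P} (hy : y ∉ Subgroup.zpowers a)
    (hc : c ∈ essentialSubgroup a y) (hcX : c ∈ Subgroup.zpowers a)
    (ho : orderOf c = orderOf y) :
    IsEssentialPair (G := essentialSubgroup a y) (orderOf y)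
      ⟨y, self_mem_essentialSubgroup y⟩ ⟨c, hc⟩ := by
  have hp := h.isEssentialPair hy hc hcX ho
  have hsq : y ^ 2 = c ^ 2 := congrArg Subtype.val hp.sq_eq
  have hct := h.mem_torsion_of_mem hy hc hcX
  have hconj := h.conj_eq_inv hy hcX (h.torsion_pow_four hy hct)
  have hnot : (⟨c, hc⟩ : essentialSubgroup a y) ∉
      Subgroup.zpowers ⟨y, self_mem_essentialSubgroup y⟩ := by
    -- otherwise `c` would commute with `y`, and equal `y`, having the same order
    have := h.finite
    rintro hk
    have hle : Subgroup.zpowers (⟨c, hc⟩ : essentialSubgroup a y) =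
        Subgroup.zpowers ⟨y, self_mem_essentialSubgroup y⟩ := by
      refine Subgroup.eq_of_le_of_card_ge ((Subgroup.zpowers_le).2 hk) ?_
      rw [Nat.card_zpowers, Nat.card_zpowers, Subgroup.orderOf_mk, Subgroup.orderOf_mk, ho]
    exact hp.notMem (hle ▸ Subgroup.mem_zpowers _)
  have hcard := hp.card_eq
  have hidx : (Subgroup.zpowers (⟨y, self_mem_essentialSubgroup y⟩ :
      essentialSubgroup a y)).index = 2 := by
    have := h.finite
    have h1 := (Subgroup.zpowers (⟨y, self_mem_essentialSubgroup y⟩ :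
      essentialSubgroup a y)).card_mul_index
    rw [hcard, Nat.card_zpowers, Subgroup.orderOf_mk, mul_comm 2] at h1
    exact Nat.eq_of_mul_eq_mul_left (orderOf_pos y) h1
  refine ⟨hp.eq_or, Subgroup.orderOf_mk _ _, hp.sq_eq.symm, Subtype.ext ?_, hnot, fun g => ?_⟩
  · change c * y * c⁻¹ = y⁻¹
    have h4 : y ^ 2 * y ^ 2 = 1 := by rw [← pow_add]; exact h.pow_four hy
    calc c * y * c⁻¹ = c * (y * c⁻¹ * y⁻¹) * y := by group
      _ = c * c * y := by rw [← conj_inv, hconj, inv_inv]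
      _ = y ^ 2 * y ^ 2 * y⁻¹ := by rw [← sq, ← hsq, sq]; group
      _ = y⁻¹ := by rw [h4, one_mul]
  · rw [Subgroup.mul_mem_iff_of_index_two hidx]
    by_cases hg : g ∈ Subgroup.zpowers (⟨y, self_mem_essentialSubgroup y⟩ : essentialSubgroup a y)
    · exact Or.inl hg
    · right
      refine iff_of_false (fun h1 => hnot ?_) hg
      exact inv_mem_iff.1 h1

/-- The automorphism group of an essential subgroup is transitive on the generators of its maximal
subgroups. -/
theorem exists_mulAut_apply_eq (h : IsMaxClassGenerator a m) {y : P}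
    (hy : y ∉ Subgroup.zpowers a) {u v : essentialSubgroup a y} (hu : orderOf u = orderOf y)
    (hv : orderOf v = orderOf y) : ∃ θ : MulAut (essentialSubgroup a y), θ u = v := by
  obtain ⟨c, hc, ho, -, ht⟩ := h.exists_torsion_generator hy
  have hcE : c ∈ essentialSubgroup a y :=
    torsion_le_essentialSubgroup y (ht ▸ Subgroup.mem_zpowers c)
  have key : ∀ u : essentialSubgroup a y, orderOf u = orderOf y →
      ∃ w, IsEssentialPair (orderOf y) u w := by
    rintro ⟨u, hu⟩ huo
    rw [Subgroup.orderOf_mk] at huo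
    by_cases huX : u ∈ Subgroup.zpowers a
    · exact ⟨_, h.isEssentialPair hy hu huX huo⟩
    · have heq := h.essentialSubgroup_eq_of_mem hy hu huX
      have hp := h.isEssentialPair_swap huX (c := c) (heq ▸ hcE) hc (ho.trans huo.symm)
      rw [huo] at hp
      refine ⟨⟨c, hcE⟩, ?_⟩
      have gen : ∀ E : Subgroup P, essentialSubgroup a u = E → ∀ (hu : u ∈ E) (hc : c ∈ E),
          IsEssentialPair (G := E) (orderOf y) ⟨u, hu⟩ ⟨c, hc⟩ := by
        rintro _ rfl _ _
        exact hp
      exact gen _ heq hu hcE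
  obtain ⟨w, hw⟩ := key u hu
  obtain ⟨w', hw'⟩ := key v hv
  exact hw.exists_mulAut hw'

end IsMaxClassGenerator

end MaxClass

/-! ### Normalizers and automorphisms of the essential subgroups -/

section EssentialSubgroups

variable {P : Type*} [Group P] {a : P} {m : ℕ}

theorem eq_or_eq_inv_of_mem_zpowers {G : Type*} [Group G] {u v : G} (hu : u ^ 4 = 1)
    (hv : v ∈ Subgroup.zpowers u) (ho : orderOf v = orderOf u) : v = u ∨ v = u⁻¹ := by
  obtain ⟨k, rfl⟩ := hv
  change orderOf (u ^ k) = orderOf u at ho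
  change u ^ k = u ∨ u ^ k = u⁻¹
  have hu' : u ^ (4 : ℤ) = 1 := by exact_mod_cast hu
  have hk : u ^ k = u ^ (k % 4) := by
    conv_lhs => rw [← Int.mul_ediv_add_emod k 4, zpow_add, zpow_mul, hu', one_zpow, one_mul]
  rw [hk] at ho ⊢
  have h4 : k % 4 = 0 ∨ k % 4 = 1 ∨ k % 4 = 2 ∨ k % 4 = 3 := by omega
  rcases h4 with h4 | h4 | h4 | h4 <;> rw [h4] at ho ⊢
  · rw [zpow_zero, orderOf_one, eq_comm, orderOf_eq_one_iff] at ho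
    simp [ho]
  · simp
  · have h2 : u ^ 2 = 1 := by
      rw [← orderOf_dvd_iff_pow_eq_one, ← ho, orderOf_dvd_iff_pow_eq_one]
      rw [← zpow_natCast, ← zpow_mul]
      exact hu'
    have h2' : u ^ (2 : ℤ) = 1 := by exact_mod_cast h2
    rw [h2', orderOf_one, eq_comm, orderOf_eq_one_iff] at ho
    simp [ho]
  · right
    rw [eq_inv_iff_mul_eq_one, ← zpow_add_one]
    exact hu'

namespace IsMaxClassGenerator

/-- The normalizer of the cyclic subgroup generated by an element outside `⟨a⟩`. -/
theorem mem_essentialSubgroup_of_conj_mem (h : IsMaxClassGenerator a m) {u n : P}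
    (hu : u ∉ Subgroup.zpowers a) (hn : n * u * n⁻¹ ∈ Subgroup.zpowers u) :
    n ∈ essentialSubgroup a u := by
  have key : ∀ n ∈ Subgroup.zpowers a, n * u * n⁻¹ ∈ Subgroup.zpowers u →
      n ∈ essentialSubgroup a u := by
    intro n hnX hn
    refine torsion_le_essentialSubgroup u ⟨hnX, ?_⟩
    have hcomm : ∀ w ∈ Subgroup.zpowers a, w * u * w⁻¹ = u → w ^ 2 = 1 := fun w hw hwu =>
      h.sq_eq_one_of_conj_eq hu hw (by
        rw [mul_inv_eq_iff_eq_mul] at hwu ⊢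
        exact hwu.symm)
    rcases eq_or_eq_inv_of_mem_zpowers (h.pow_four hu) hn (orderOf_conj n u) with h1 | h1
    · have h2 := hcomm n hnX h1
      rcases h.orderOf_eq_two_or_four hu with ⟨h3, -⟩ | ⟨h3, -⟩
      · rw [h3, h2]
      · rw [h3, show 4 = 2 * 2 by norm_num, pow_mul, h2, one_pow]
    · rcases h.orderOf_eq_two_or_four hu with ⟨h3, h4⟩ | ⟨h3, h4⟩
      · rw [h3]
        refine hcomm n hnX ?_
        rw [h1]
        exact inv_eq_of_mul_eq_one_right (by rw [← sq, h4])
      · rw [h3, show 4 = 2 * 2 by norm_num, pow_mul]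
        refine hcomm _ (pow_mem hnX 2) ?_
        calc n ^ 2 * u * (n ^ 2)⁻¹ = n * (n * u * n⁻¹) * n⁻¹ := by rw [sq]; group
          _ = n * u⁻¹ * n⁻¹ := by rw [h1]
          _ = (n * u * n⁻¹)⁻¹ := by group
          _ = u := by rw [h1, inv_inv]
  by_cases hnX : n ∈ Subgroup.zpowers a
  · exact key n hnX hn
  · have h1 : n * u ∈ Subgroup.zpowers a := h.mul_mem_iff.2 (iff_of_false hnX hu)
    have h2 := key (n * u) h1 (by
      have : n * u * u * (n * u)⁻¹ = n * u * n⁻¹ := by group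
      rwa [this])
    exact (Subgroup.mul_mem_cancel_right _ (self_mem_essentialSubgroup u)).1 h2

theorem conj_mul_inv_of_mem (h : IsMaxClassGenerator a m) {y : P} (hy : y ∉ Subgroup.zpowers a) :
    (∀ l : ℤ, a ^ l * y * (a ^ l)⁻¹ * y⁻¹ = a ^ (2 * l)) ∨
      3 ≤ m ∧ ∀ l : ℤ, a ^ l * y * (a ^ l)⁻¹ * y⁻¹ = a ^ (2 * l) * (a ^ 2 ^ (m - 1)) ^ l := by
  have h0 : ∀ l : ℤ, a ^ l * y * (a ^ l)⁻¹ * y⁻¹ = a ^ l * (y * a * y⁻¹) ^ (-l) := fun l => by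
    rw [_root_.conj_zpow, zpow_neg]
    group
  rcases h.conj y hy with h1 | ⟨h3, h1⟩
  · refine Or.inl fun l => ?_
    rw [h0, h1, inv_zpow, zpow_neg, inv_inv, ← zpow_add, two_mul]
  · refine Or.inr ⟨h3, fun l => ?_⟩
    have hc : Commute a⁻¹ (a ^ 2 ^ (m - 1)) := ((Commute.refl a).pow_right _).inv_left
    have h2 : ((a ^ 2 ^ (m - 1)) ^ l)⁻¹ = (a ^ 2 ^ (m - 1)) ^ l := by
      rw [← inv_zpow, inv_eq_of_mul_eq_one_right h.involution_sq]
    rw [h0, h1, hc.mul_zpow, inv_zpow, zpow_neg, zpow_neg, inv_inv, h2, ← mul_assoc, ← zpow_add,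
      two_mul]

theorem involution_mem (h : IsMaxClassGenerator a m) :
    a ^ 2 ^ (m - 1) ∈ Subgroup.zpowers (a ^ 2) := by
  have := h.two_le
  refine ⟨((2 ^ (m - 2) : ℕ) : ℤ), ?_⟩
  change (a ^ 2) ^ ((2 ^ (m - 2) : ℕ) : ℤ) = _
  rw [zpow_natCast, ← pow_mul, ← pow_succ', show m - 2 + 1 = m - 1 by omega]

/-- The conjugacy class of an element `y` outside `⟨a⟩` is contained in the coset `⟨a ^ 2⟩ y`. -/
theorem conj_mul_inv_mem (h : IsMaxClassGenerator a m) {y : P} (hy : y ∉ Subgroup.zpowers a)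
    (g : P) : g * y * g⁻¹ * y⁻¹ ∈ Subgroup.zpowers (a ^ 2) := by
  have key : ∀ g ∈ Subgroup.zpowers a, g * y * g⁻¹ * y⁻¹ ∈ Subgroup.zpowers (a ^ 2) := by
    rintro _ ⟨l, rfl⟩
    have h1 : a ^ (2 * l) ∈ Subgroup.zpowers (a ^ 2) :=
      ⟨l, by rw [zpow_mul, zpow_ofNat]⟩
    change a ^ l * y * (a ^ l)⁻¹ * y⁻¹ ∈ _
    rcases h.conj_mul_inv_of_mem hy with h2 | ⟨-, h2⟩
    · rw [h2]
      exact h1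
    · rw [h2]
      exact mul_mem h1 (zpow_mem h.involution_mem l)
  by_cases hg : g ∈ Subgroup.zpowers a
  · exact key g hg
  · have h1 := key (g * y) (h.mul_mem_iff.2 (iff_of_false hg hy))
    have h2 : g * y * y * (g * y)⁻¹ * y⁻¹ = g * y * g⁻¹ * y⁻¹ := by group
    rwa [h2] at h1

/-- The conjugacy class of an element `y` outside `⟨a⟩` contains the coset `⟨a ^ 2⟩ y`. -/
theorem exists_conj_eq_mul (h : IsMaxClassGenerator a m) {y w : P} (hy : y ∉ Subgroup.zpowers a)
    (hw : w ∈ Subgroup.zpowers (a ^ 2)) : ∃ g ∈ Subgroup.zpowers a, g * y * g⁻¹ = w * y := by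
  obtain ⟨k, rfl⟩ := hw
  change ∃ g ∈ Subgroup.zpowers a, g * y * g⁻¹ = (a ^ 2) ^ k * y
  have hw : (a ^ 2) ^ k = a ^ (2 * k) := by rw [zpow_mul, zpow_ofNat]
  rw [hw]
  rcases h.conj_mul_inv_of_mem hy with h1 | ⟨h3, h1⟩
  · exact ⟨a ^ k, ⟨k, rfl⟩, mul_inv_eq_iff_eq_mul.1 (h1 k)⟩
  by_cases hk : Even k
  · refine ⟨a ^ k, ⟨k, rfl⟩, mul_inv_eq_iff_eq_mul.1 ?_⟩
    rw [h1, zpow_eq_of_mul_self h.involution_sq, if_pos hk, mul_one]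
  -- the twist by the involution is compensated by an element of order four
  refine ⟨a ^ (k + (2 ^ (m - 2) : ℕ)), ⟨_, rfl⟩, mul_inv_eq_iff_eq_mul.1 ?_⟩
  have he : Even (((2 ^ (m - 2) : ℕ) : ℤ)) := by
    rw [Int.even_coe_nat]
    exact (Nat.even_pow.2 ⟨even_two, by omega⟩)
  have ha : a ^ (2 * (k + ((2 ^ (m - 2) : ℕ) : ℤ))) = a ^ (2 * k) * a ^ 2 ^ (m - 1) := by
    rw [mul_add, zpow_add, show (2 : ℤ) * ((2 ^ (m - 2) : ℕ) : ℤ) = ((2 ^ (m - 1) : ℕ) : ℤ) by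
      rw [show m - 1 = m - 2 + 1 by omega, pow_succ']; push_cast; ring, zpow_natCast]
  rw [h1, ha, zpow_eq_of_mul_self h.involution_sq, if_neg (by rw [Int.even_add]; tauto), mul_assoc,
    h.involution_sq, mul_one]

theorem _root_.IsLargeMaxClassGenerator.torsion_le (h : IsLargeMaxClassGenerator a m) {y : P}
    (hy : y ∉ Subgroup.zpowers a) : torsionZpowers a (orderOf y) ≤ Subgroup.zpowers (a ^ 2) := by
  rintro _ ⟨⟨k, rfl⟩, hk⟩
  have hk' : (a ^ k) ^ orderOf y = 1 := hk
  rw [← zpow_natCast, ← zpow_mul, h.zpow_eq_one_iff] at hk'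
  have hev : (2 : ℤ) ∣ k := by
    have h2 := h.two_le
    rcases h.orderOf_eq_two_or_four hy with ⟨h1, -⟩ | ⟨h1, -⟩ <;> rw [h1] at hk'
    · have h4 : ((4 : ℕ) : ℤ) ∣ ((2 ^ m : ℕ) : ℤ) := by
        have : 2 ^ 2 ∣ 2 ^ m := pow_dvd_pow 2 h2
        exact_mod_cast this
      have := h4.trans hk'
      omega
    · have h8 : ((8 : ℕ) : ℤ) ∣ ((2 ^ m : ℕ) : ℤ) := by
        have : 2 ^ 3 ∣ 2 ^ m := pow_dvd_pow 2 (h.three_le y hy h1)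
        exact_mod_cast this
      have := h8.trans hk'
      omega
  obtain ⟨l, rfl⟩ := hev
  exact ⟨l, by simp only [zpow_mul, zpow_ofNat]⟩

theorem card_centralizer_le_four (h : IsMaxClassGenerator a m) {u : P}
    (hu : u ∉ Subgroup.zpowers a) : Nat.card (Subgroup.centralizer {u}) ≤ 4 := by
  have := h.finite
  have h1 : (Subgroup.zpowers a).relIndex (Subgroup.centralizer {u}) ≤ 2 := by
    have := h.normal
    rw [← h.index_eq]
    exact Nat.le_of_dvd (by rw [h.index_eq]; norm_num)
      (Subgroup.relIndex_dvd_index_of_normal (Subgroup.zpowers a) (Subgroup.centralizer {u}))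
  have h2 : Nat.card ↥(Subgroup.zpowers a ⊓ Subgroup.centralizer {u}) ≤ 2 := by
    have hle : Subgroup.zpowers a ⊓ Subgroup.centralizer {u} ≤
        Subgroup.zpowers (a ^ 2 ^ (m - 1)) := by
      rintro w ⟨hw, hwu⟩
      have hwu := Subgroup.mem_centralizer_singleton_iff.1 hwu
      rcases h.eq_one_or_eq_of_sq hw (h.sq_eq_one_of_conj_eq hu hw
        (by rw [mul_inv_eq_iff_eq_mul]; exact hwu.symm)) with rfl | rfl
      · exact one_mem _
      · exact Subgroup.mem_zpowers _
    refine (Nat.le_of_dvd Nat.card_pos (Subgroup.card_dvd_of_le hle)).trans ?_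
    rw [Nat.card_zpowers]
    exact orderOf_le_of_pow_eq_one (by norm_num) (by rw [sq]; exact h.involution_sq)
  have h3 := ((Subgroup.zpowers a).subgroupOf (Subgroup.centralizer {u})).card_mul_index
  rw [← Subgroup.inf_subgroupOf_right,
    Nat.card_congr (Subgroup.subgroupOfEquivOfLe inf_le_right).toEquiv,
    Subgroup.inf_subgroupOf_right] at h3
  rw [← h3]
  exact Nat.mul_le_mul h2 h1

theorem apply_notMem (h : IsMaxClassGenerator a m) {y c : P}
    (hy : y ∉ Subgroup.zpowers a) (hc : c ∈ essentialSubgroup a y) (hcX : c ∈ Subgroup.zpowers a)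
    (ho : orderOf c = orderOf y) {β : MulAut (essentialSubgroup a y)}
    (hβ : (β ⟨c, hc⟩ : P) ∈ Subgroup.zpowers a) :
    (β ⟨y, self_mem_essentialSubgroup y⟩ : P) ∉ Subgroup.zpowers a := by
  have := h.finite
  intro hy'
  have hyE := self_mem_essentialSubgroup (a := a) y
  have h1 : (β ⟨y, hyE⟩ : P) ∈ Subgroup.zpowers (β ⟨c, hc⟩ : P) := by
    refine le_of_card_dvd_of_le_isCyclic (C := Subgroup.zpowers a)
      ((Subgroup.zpowers_le).2 hy') ((Subgroup.zpowers_le).2 hβ) ?_ (Subgroup.mem_zpowers _)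
    rw [Nat.card_zpowers, Nat.card_zpowers, Subgroup.orderOf_coe, Subgroup.orderOf_coe,
      MulEquiv.orderOf_eq, MulEquiv.orderOf_eq, Subgroup.orderOf_mk, Subgroup.orderOf_mk, ho]
  obtain ⟨k, hk⟩ := h1
  have h2 : β (⟨c, hc⟩ ^ k) = β ⟨y, hyE⟩ := by
    rw [map_zpow]
    exact Subtype.ext hk
  have h3 : c ^ k = y := congrArg Subtype.val (β.injective h2)
  exact hy (h3 ▸ zpow_mem hcX k)

/-- An automorphism of an essential subgroup which maps a generator of its intersection with `⟨a⟩`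
into `⟨a⟩` is induced by conjugation in the whole group. -/
theorem _root_.IsLargeMaxClassGenerator.mem_autP_of_apply_mem
    (h : IsLargeMaxClassGenerator a m) {y c : P}
    (hy : y ∉ Subgroup.zpowers a) (hc : c ∈ essentialSubgroup a y) (hcX : c ∈ Subgroup.zpowers a)
    (ho : orderOf c = orderOf y) {β : MulAut (essentialSubgroup a y)}
    (hβ : (β ⟨c, hc⟩ : P) ∈ Subgroup.zpowers a) :
    β ∈ FusionSystem.autP (essentialSubgroup a y) := by
  have := h.finite
  have hct := h.mem_torsion_of_mem hy hc hcX
  have hc4 := h.torsion_pow_four hy hct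
  have hyE := self_mem_essentialSubgroup (a := a) y
  have hy' := h.apply_notMem hy hc hcX ho hβ
  obtain ⟨w, hw, hwy⟩ := h.eq_mul_of_mem (β ⟨y, hyE⟩).2 hy'
  obtain ⟨g, hg, hgy⟩ := h.exists_conj_eq_mul hy (h.torsion_le hy hw)
  rw [← hwy] at hgy
  have hoc : orderOf (β ⟨c, hc⟩ : P) = orderOf c := by
    rw [Subgroup.orderOf_coe, MulEquiv.orderOf_eq, Subgroup.orderOf_mk]
  have hz := h.isEssentialPair hy hc hcX ho
  have hcc : (β ⟨c, hc⟩ : P) = c ∨ (β ⟨c, hc⟩ : P) = c⁻¹ := by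
    refine eq_or_eq_inv_of_mem_zpowers hc4 ?_ hoc
    refine le_of_card_dvd_of_le_isCyclic (C := Subgroup.zpowers a)
      ((Subgroup.zpowers_le).2 hβ) ((Subgroup.zpowers_le).2 hcX) ?_ (Subgroup.mem_zpowers _)
    rw [Nat.card_zpowers, Nat.card_zpowers, hoc]
  have key : ∃ k : P, k * c * k⁻¹ = β ⟨c, hc⟩ ∧ k * y * k⁻¹ = β ⟨y, hyE⟩ := by
    rcases hcc with h1 | h1
    · exact ⟨g, by rw [h1, h.comm hg hcX, mul_inv_cancel_right], hgy⟩
    · refine ⟨g * y, ?_, by rw [← hgy]; group⟩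
      calc g * y * c * (g * y)⁻¹ = g * (y * c * y⁻¹) * g⁻¹ := by group
        _ = c⁻¹ := by rw [h.conj_eq_inv hy hcX hc4, h.comm hg (inv_mem hcX), mul_inv_cancel_right]
        _ = _ := h1.symm
  obtain ⟨k, hkc, hky⟩ := key
  refine FusionSystem.mem_autP'.2 ⟨k, ?_⟩
  have hC : ∀ x ∈ Subgroup.zpowers (⟨c, hc⟩ : essentialSubgroup a y),
      (β x : P) = k * x * k⁻¹ := by
    rintro _ ⟨i, rfl⟩
    change (β (⟨c, hc⟩ ^ i) : P) = k * c ^ i * k⁻¹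
    rw [map_zpow, SubgroupClass.coe_zpow, ← hkc, _root_.conj_zpow]
  intro x
  rcases hz.gen x with hx | hx
  · exact hC x hx
  · have h1 := hC _ hx
    have h2 : x = ⟨y, hyE⟩ * (⟨y, hyE⟩⁻¹ * x) := by group
    have h3 : (β x : P) = β ⟨y, hyE⟩ * β (⟨y, hyE⟩⁻¹ * x) := by
      rw [← Subgroup.coe_mul, ← map_mul, ← h2]
    rw [h3, h1, ← hky, Subgroup.coe_mul, Subgroup.coe_inv]
    group

theorem orderOf_apply {H : Subgroup P} (β : MulAut H) (x : H) :
    orderOf (β x : P) = orderOf (x : P) := by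
  rw [Subgroup.orderOf_coe, MulEquiv.orderOf_eq, Subgroup.orderOf_coe]

/-- An automorphism `β` of an essential subgroup such that `β c_n β⁻¹` is induced by conjugation,
for some `n` that normalizes the subgroup but is not contained in it, is itself induced by
conjugation. -/
theorem _root_.IsLargeMaxClassGenerator.mem_or_mem_autP (h : IsLargeMaxClassGenerator a m) {y : P}
    (hy : y ∉ Subgroup.zpowers a) {β : MulAut (essentialSubgroup a y)} {n n' : P}
    (hn : ∀ x : essentialSubgroup a y, ∃ hx : n * x * n⁻¹ ∈ essentialSubgroup a y,
      (β ⟨n * x * n⁻¹, hx⟩ : P) = n' * β x * n'⁻¹) :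
    n ∈ essentialSubgroup a y ∨ β ∈ FusionSystem.autP (essentialSubgroup a y) := by
  have := h.finite
  obtain ⟨c, hcX, ho, -, hct⟩ := h.exists_torsion_generator hy
  have hcE : c ∈ essentialSubgroup a y :=
    torsion_le_essentialSubgroup y (hct ▸ Subgroup.mem_zpowers c)
  by_cases hβ : (β ⟨c, hcE⟩ : P) ∈ Subgroup.zpowers a
  · exact Or.inr (h.mem_autP_of_apply_mem hy hcE hcX ho hβ)
  left
  -- `n'` normalizes the cyclic group generated by the image of `c`, hence lies in `E`
  have hn' : n' ∈ essentialSubgroup a y := by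
    rw [← h.essentialSubgroup_eq_of_mem hy (β ⟨c, hcE⟩).2 hβ]
    refine h.mem_essentialSubgroup_of_conj_mem hβ ?_
    obtain ⟨hx, h1⟩ := hn ⟨c, hcE⟩
    have h2 : n * c * n⁻¹ ∈ Subgroup.zpowers c := by
      rw [← hct]
      exact (h.torsion_normal _).conj_mem c (hct ▸ Subgroup.mem_zpowers c) n
    obtain ⟨k, hk⟩ := h2
    refine ⟨k, ?_⟩
    change (β ⟨c, hcE⟩ : P) ^ k = _
    rw [← h1, ← SubgroupClass.coe_zpow, ← map_zpow]
    exact congrArg (fun x => (β x : P)) (Subtype.ext hk)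
  obtain ⟨v, hv⟩ := β.surjective ⟨n', hn'⟩
  have hy1 : (v : P)⁻¹ * n ∈ essentialSubgroup a y := by
    refine h.mem_essentialSubgroup_of_conj_mem hy ?_
    obtain ⟨hx, h1⟩ := hn ⟨y, self_mem_essentialSubgroup y⟩
    have h2 : β ⟨n * y * n⁻¹, hx⟩ = β (v * ⟨y, self_mem_essentialSubgroup y⟩ * v⁻¹) := by
      rw [map_mul, map_mul, map_inv, hv]
      exact Subtype.ext h1
    have h3 : n * y * n⁻¹ = v * y * (v : P)⁻¹ := congrArg Subtype.val (β.injective h2)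
    have h4 : (v : P)⁻¹ * n * y * ((v : P)⁻¹ * n)⁻¹ = y := by
      calc (v : P)⁻¹ * n * y * ((v : P)⁻¹ * n)⁻¹ = (v : P)⁻¹ * (n * y * n⁻¹) * v := by group
        _ = y := by rw [h3]; group
    rw [h4]
    exact Subgroup.mem_zpowers y
  exact (Subgroup.mul_mem_cancel_left _ (inv_mem v.2)).1 hy1

theorem isCyclic_of_le_essentialSubgroup (h : IsMaxClassGenerator a m) {y : P}
    (hy : y ∉ Subgroup.zpowers a) {K : Subgroup P} (hK : K ≤ essentialSubgroup a y)
    (hne : K ≠ essentialSubgroup a y) : IsCyclic K := by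
  have := h.finite
  by_cases hX : K ≤ Subgroup.zpowers a
  · exact isCyclic_of_injective (Subgroup.inclusion hX) (Subgroup.inclusion_injective hX)
  obtain ⟨u, hu, huX⟩ := SetLike.not_le_iff_exists.1 hX
  have ho := h.orderOf_eq_of_mem hy (hK hu) huX
  have hle : Subgroup.zpowers u ≤ K := (Subgroup.zpowers_le).2 hu
  suffices hKu : Subgroup.zpowers u = K by
    rw [← hKu]
    infer_instance
  refine Subgroup.eq_of_le_of_card_ge hle ?_
  have h1 := Subgroup.card_dvd_of_le hle
  have h2 := Subgroup.card_dvd_of_le hK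
  have h3 : Nat.card K ≠ Nat.card (essentialSubgroup a y) := fun h3 =>
    hne (Subgroup.eq_of_le_of_card_ge hK h3.ge)
  rw [h.card_essentialSubgroup hy] at h2 h3
  rw [Nat.card_zpowers, ho] at h1 ⊢
  obtain ⟨d, hd⟩ := h1
  rw [hd, mul_comm 2] at h2 h3
  have hd2 : d ∣ 2 := Nat.dvd_of_mul_dvd_mul_left (orderOf_pos y) h2
  rcases (Nat.dvd_prime Nat.prime_two).1 hd2 with rfl | rfl
  · rw [hd, mul_one]
  · exact absurd rfl h3

theorem not_isCyclic_essentialSubgroup (h : IsMaxClassGenerator a m) {y : P}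
    (hy : y ∉ Subgroup.zpowers a) : ¬ IsCyclic (essentialSubgroup a y) := by
  have := h.finite
  intro hcyc
  obtain ⟨c, hcX, ho, -, hct⟩ := h.exists_torsion_generator hy
  have hcE : c ∈ essentialSubgroup a y :=
    torsion_le_essentialSubgroup y (hct ▸ Subgroup.mem_zpowers c)
  obtain ⟨k, hk⟩ := mem_zpowers_of_orderOf_dvd (u := (⟨y, self_mem_essentialSubgroup y⟩ :
    essentialSubgroup a y)) (v := ⟨c, hcE⟩) (by rw [Subgroup.orderOf_mk, Subgroup.orderOf_mk, ho])
  have hk' : c ^ k = y := congrArg Subtype.val hk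
  exact hy (hk' ▸ zpow_mem hcX k)

theorem eight_le_card (h : IsMaxClassGenerator a m) : 8 ≤ Nat.card P := by
  rw [h.card_eq]
  have h1 : 2 ^ 3 ≤ 2 ^ (m + 1) := Nat.pow_le_pow_right (by norm_num) (by have := h.two_le; omega)
  exact h1

theorem _root_.IsLargeMaxClassGenerator.essentialSubgroup_ne_top
    (h : IsLargeMaxClassGenerator a m) {y : P}
    (hy : y ∉ Subgroup.zpowers a) : essentialSubgroup a y ≠ ⊤ := fun htop => by
  have h1 := h.card_essentialSubgroup hy
  rw [htop, Subgroup.card_top, h.card_eq] at h1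
  rcases h.orderOf_eq_two_or_four hy with ⟨h2, -⟩ | ⟨h2, -⟩ <;> rw [h2] at h1
  · have : 2 ^ 3 ≤ 2 ^ (m + 1) := Nat.pow_le_pow_right (by norm_num) (by have := h.two_le; omega)
    omega
  · have : 2 ^ 4 ≤ 2 ^ (m + 1) :=
      Nat.pow_le_pow_right (by norm_num) (by have := h.three_le y hy h2; omega)
    omega

/-- The automorphisms of an essential subgroup induced by conjugation form a self-normalizing
`2`-subgroup, hence a Sylow subgroup, of its automorphism group. -/
theorem _root_.IsLargeMaxClassGenerator.eq_autP_of_isPGroup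
    (h : IsLargeMaxClassGenerator a m) {y : P}
    (hy : y ∉ Subgroup.zpowers a) {S : Subgroup (MulAut (essentialSubgroup a y))}
    (hS : IsPGroup 2 S) (hle : FusionSystem.autP (essentialSubgroup a y) ≤ S) :
    S = FusionSystem.autP (essentialSubgroup a y) := by
  have := h.finite
  by_contra hne
  have hlt := FusionSystem.lt_normalizer hS
    (Q := (FusionSystem.autP (essentialSubgroup a y)).subgroupOf S) (by
    rw [Ne, Subgroup.subgroupOf_eq_top]
    exact fun h1 => hne (le_antisymm h1 hle))
  obtain ⟨⟨β, hβS⟩, hβ, hβn⟩ := SetLike.exists_of_lt hlt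
  obtain ⟨n, hn, hnE⟩ := SetLike.exists_of_lt
    (FusionSystem.lt_normalizer h.isPGroup (h.essentialSubgroup_ne_top hy))
  have h1 : (essentialSubgroup a y).normalizerMonoidHom ⟨n, hn⟩ ∈
      FusionSystem.autP (essentialSubgroup a y) := ⟨_, rfl⟩
  have h2 := (Subgroup.mem_normalizer_iff.1 hβ ⟨_, hle h1⟩).1 h1
  rw [Subgroup.mem_subgroupOf] at h2
  obtain ⟨n', hn', h3⟩ := FusionSystem.mem_autP.1 h2
  refine (h.mem_or_mem_autP hy (β := β) (n := n) (n' := n') fun x => ?_).elim hnE hβn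
  have hx : n * x * n⁻¹ ∈ (essentialSubgroup a y) := (Subgroup.mem_normalizer_iff.1 hn x).1 x.2
  refine ⟨hx, ?_⟩
  rw [← h3]
  change _ = ((β * (essentialSubgroup a y).normalizerMonoidHom ⟨n, hn⟩ * β⁻¹) (β x) : P)
  have h4 : β⁻¹ (β x) = x := β.symm_apply_apply x
  rw [MulAut.mul_apply, MulAut.mul_apply, h4]
  rfl

end IsMaxClassGenerator
end EssentialSubgroups

/-! ### The fusion system of a conjugation-invariant family of essential subgroups -/

section EssentialFamilies

variable {P : Type*} [Group P] {a : P} {m : ℕ}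

/-- A set of essential subgroups that is closed under conjugation. -/
@[ext]
structure EssentialFamily (a : P) where
  /-- The members of the family. -/
  carrier : Set (Subgroup P)
  exists_eq : ∀ E ∈ carrier, ∃ y ∉ Subgroup.zpowers a, E = essentialSubgroup a y
  conj_mem : ∀ E ∈ carrier, ∀ g : P, E.map (MulAut.conj g).toMonoidHom ∈ carrier

namespace EssentialFamily

/-- The union of the members of the family. -/
def support (𝓔 : EssentialFamily a) : Set P := {x | ∃ E ∈ 𝓔.carrier, x ∈ E}

/-- The morphisms of the fusion system that a family of essential subgroups generates: conjugations,
maps between cyclic subgroups of the support, and maps which, up to conjugation, are automorphisms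
of members of the family. -/
def IsMor (𝓔 : EssentialFamily a) {Q R : Subgroup P} (φ : Q →* R) : Prop :=
  (∃ g : P, ∀ x : Q, (φ x : P) = g * x * g⁻¹) ∨
  (IsCyclic Q ∧ ∀ x : Q, (x : P) ∈ 𝓔.support ∧ (φ x : P) ∈ 𝓔.support) ∨
  (Q ∈ 𝓔.carrier ∧ ∃ g : P, ∀ x : Q, g * φ x * g⁻¹ ∈ Q)

variable (𝓔 : EssentialFamily a)

theorem conj_mem_support {x : P} (hx : x ∈ 𝓔.support) (g : P) : g * x * g⁻¹ ∈ 𝓔.support := by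
  obtain ⟨E, hE, hxE⟩ := hx
  exact ⟨_, 𝓔.conj_mem E hE g, x, hxE, rfl⟩

theorem mem_support_of_conj {x g : P} (hx : g * x * g⁻¹ ∈ 𝓔.support) : x ∈ 𝓔.support := by
  have h1 := 𝓔.conj_mem_support hx g⁻¹
  have h2 : g⁻¹ * (g * x * g⁻¹) * g⁻¹⁻¹ = x := by group
  rwa [h2] at h1

theorem IsMor.mem_support_iff {𝓔 : EssentialFamily a} {Q R : Subgroup P} {φ : Q →* R}
    (hφ : 𝓔.IsMor φ) (x : Q) : (φ x : P) ∈ 𝓔.support ↔ (x : P) ∈ 𝓔.support := by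
  rcases hφ with ⟨g, hg⟩ | ⟨-, h1⟩ | ⟨hQ, g, hg⟩
  · rw [hg]
    exact ⟨𝓔.mem_support_of_conj, fun h => 𝓔.conj_mem_support h g⟩
  · exact iff_of_true (h1 x).2 (h1 x).1
  · exact iff_of_true (𝓔.mem_support_of_conj ⟨Q, hQ, hg x⟩) ⟨Q, hQ, x.2⟩

theorem mem_carrier_of_conj {Q R : Subgroup P} (hR : R ∈ 𝓔.carrier) (g : P)
    (h : ∀ x, x ∈ Q ↔ g * x * g⁻¹ ∈ R) : Q ∈ 𝓔.carrier := by
  have h1 := 𝓔.conj_mem R hR g⁻¹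
  have h2 : R.map (MulAut.conj g⁻¹).toMonoidHom = Q := by
    ext x
    rw [h, Subgroup.mem_map_equiv]
    simp
  rwa [h2] at h1

theorem mem_iff_conj_mem_of_equiv [Finite P] {Q R : Subgroup P} (e : Q ≃* R) {g : P}
    (hg : ∀ x ∈ R, g * x * g⁻¹ ∈ Q) (x : P) : x ∈ R ↔ g * x * g⁻¹ ∈ Q := by
  have h1 : R.map (MulAut.conj g).toMonoidHom = Q := by
    refine Subgroup.eq_of_le_of_card_ge ?_ ?_
    · rintro _ ⟨x, hx, rfl⟩
      exact hg x hx
    · rw [Nat.card_congr e.toEquiv]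
      exact (Nat.card_congr ((MulAut.conj g).subgroupMap R).toEquiv).le
  refine ⟨hg x, fun hx => ?_⟩
  rw [← h1] at hx
  obtain ⟨x', hx', h2⟩ := hx
  have h3 : g * x' * g⁻¹ = g * x * g⁻¹ := h2
  have h4 : x' = x := by simpa using h3
  exact h4 ▸ hx'

/-- The fusion system that a family of essential subgroups generates. -/
def fusionSystem (h : IsMaxClassGenerator a m) : FusionSystem P where
  Hom Q R := {φ | Function.Injective φ ∧ 𝓔.IsMor φ}
  injective_of_mem h := h.1
  conj_mem g φ hg := by
    refine ⟨fun x y hxy => ?_, Or.inl ⟨g, hg⟩⟩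
    have h : g * (x : P) * g⁻¹ = g * y * g⁻¹ := by rw [← hg, ← hg, hxy]
    exact Subtype.ext (by simpa using h)
  comp_mem := by
    rintro Q R S φ ψ ⟨hφi, hφ⟩ ⟨hψi, hψ⟩
    refine ⟨hψi.comp hφi, ?_⟩
    rcases id hψ with ⟨k, hk⟩ | ⟨hR, hU⟩ | ⟨hR, k, hk⟩
    · rcases id hφ with ⟨g, hg⟩ | ⟨hQ, hU⟩ | ⟨hQ, g, hg⟩
      · exact Or.inl ⟨k * g, fun x => by simp [hk, hg, mul_assoc]⟩
      · exact Or.inr (Or.inl ⟨hQ, fun x => ⟨(hU x).1, (hψ.mem_support_iff _).2 (hU x).2⟩⟩)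
      · refine Or.inr (Or.inr ⟨hQ, g * k⁻¹, fun x => ?_⟩)
        have h1 : g * k⁻¹ * ψ (φ x) * (g * k⁻¹)⁻¹ = g * φ x * g⁻¹ := by
          rw [hk]
          group
        exact h1 ▸ hg x
    · exact Or.inr (Or.inl ⟨isCyclic_of_injective φ hφi, fun x =>
        ⟨(hφ.mem_support_iff x).1 (hU _).1, (hU _).2⟩⟩)
    · by_cases hs : Function.Surjective φ
      · rcases id hφ with ⟨g, hg⟩ | ⟨hQ, hU⟩ | ⟨hQ, g, hg⟩
        · have hmem : ∀ x, x ∈ Q ↔ g * x * g⁻¹ ∈ R := fun x => by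
            constructor
            · intro hx
              exact hg ⟨x, hx⟩ ▸ (φ ⟨x, hx⟩).2
            · intro hx
              obtain ⟨y, hy⟩ := hs ⟨_, hx⟩
              have h1 : g * (y : P) * g⁻¹ = g * x * g⁻¹ := by rw [← hg, hy]
              have h2 : (y : P) = x := by simpa using h1
              exact h2 ▸ y.2
          refine Or.inr (Or.inr ⟨𝓔.mem_carrier_of_conj hR g hmem, g⁻¹ * k, fun x => ?_⟩)
          rw [hmem]
          have h1 : g * (g⁻¹ * k * ((ψ.comp φ) x : P) * (g⁻¹ * k)⁻¹) * g⁻¹ =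
              k * ψ (φ x) * k⁻¹ := by
            rw [MonoidHom.comp_apply]
            group
          exact h1 ▸ hk (φ x)
        · exact Or.inr (Or.inl ⟨hQ, fun x => ⟨(hU x).1, (hψ.mem_support_iff _).2 (hU x).2⟩⟩)
        · refine Or.inr (Or.inr ⟨hQ, g * k, fun x => ?_⟩)
          obtain ⟨y, hy⟩ := hs ⟨_, hk (φ x)⟩
          have h1 : g * k * ((ψ.comp φ) x : P) * (g * k)⁻¹ = g * φ y * g⁻¹ := by
            rw [MonoidHom.comp_apply, hy]
            group
          exact h1 ▸ hg y
      · -- a proper subgroup of an essential subgroup is cyclic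
        have hcyc : IsCyclic Q := by
          obtain ⟨y, hy, rfl⟩ := 𝓔.exists_eq R hR
          have h1 := h.isCyclic_of_le_essentialSubgroup hy 
            (K := ((Subgroup.subtype _).comp φ).range) (by rintro _ ⟨x, rfl⟩; exact (φ x).2)
            (fun h2 => hs fun r => by
              obtain ⟨x, h4⟩ := h2.ge r.2
              exact ⟨x, Subtype.ext h4⟩)
          exact isCyclic_of_injective _ (MonoidHom.ofInjective
            (f := (Subgroup.subtype _).comp φ) (Subtype.val_injective.comp hφi)).injective
        exact Or.inr (Or.inl ⟨hcyc, fun x => ⟨(hφ.mem_support_iff x).1 ⟨R, hR, (φ x).2⟩,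
          (hψ.mem_support_iff _).2 ⟨R, hR, (φ x).2⟩⟩⟩)
  codRestrict_mem := by
    rintro Q R S φ ψ ⟨hφi, hφ⟩ hψ
    refine ⟨fun x y hxy => hφi (Subtype.ext (by rw [← hψ, ← hψ, hxy])), ?_⟩
    simpa only [IsMor, hψ] using hφ
  symm_mem := by
    rintro Q R e ⟨hei, he⟩
    refine ⟨e.symm.injective, ?_⟩
    rcases id he with ⟨g, hg⟩ | ⟨hQ, hU⟩ | ⟨hQ, g, hg⟩
    · refine Or.inl ⟨g⁻¹, fun x => ?_⟩
      have h1 : ((e (e.symm x) : R) : P) = g * (e.symm x : P) * g⁻¹ := hg (e.symm x)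
      rw [e.apply_symm_apply] at h1
      rw [h1]
      simp [mul_assoc]
    · refine Or.inr (Or.inl ⟨isCyclic_of_injective e.symm.toMonoidHom e.symm.injective,
        fun x => ?_⟩)
      have h1 := hU (e.symm x)
      refine ⟨?_, h1.1⟩
      have h2 : ((e.toMonoidHom (e.symm x) : R) : P) = x := congrArg _ (e.apply_symm_apply x)
      exact h2 ▸ h1.2
    · have := h.finite
      have hmem := mem_iff_conj_mem_of_equiv e (g := g) fun x hx => by
        have h1 := hg (e.symm ⟨x, hx⟩)
        have h2 : ((e.toMonoidHom (e.symm ⟨x, hx⟩) : R) : P) = x :=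
          congrArg _ (e.apply_symm_apply _)
        rwa [h2] at h1
      refine Or.inr (Or.inr ⟨𝓔.mem_carrier_of_conj hQ g hmem, g⁻¹, fun x => ?_⟩)
      rw [hmem]
      have h1 : g * (g⁻¹ * (e.symm x : P) * g⁻¹⁻¹) * g⁻¹ = e.symm x := by group
      exact h1.symm ▸ (e.symm x).2

variable {𝓔} {h : IsMaxClassGenerator a m}

theorem aut_eq_top {E : Subgroup P} (hE : E ∈ 𝓔.carrier) : (𝓔.fusionSystem h).aut E = ⊤ :=
  (Subgroup.eq_top_iff' _).2 fun β =>
    ⟨β.injective, Or.inr (Or.inr ⟨hE, 1, fun x => by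
      rw [one_mul, inv_one, mul_one]
      exact (β x).2⟩)⟩

theorem not_isCyclic_of_mem {E : Subgroup P} (h : IsMaxClassGenerator a m) (hE : E ∈ 𝓔.carrier) :
    ¬ IsCyclic E := by
  obtain ⟨y, hy, rfl⟩ := 𝓔.exists_eq E hE
  exact h.not_isCyclic_essentialSubgroup hy

/-- Unless it is a cyclic subgroup of the support, a subgroup is isomorphic in the fusion system to
its conjugates only. -/
theorem exists_conj_of_isConj {Q R : Subgroup P} (hQ : ¬ (IsCyclic Q ∧ ∀ x ∈ Q, x ∈ 𝓔.support))
    (hQR : (𝓔.fusionSystem h).IsConj Q R) : ∃ g : P, ∀ x, x ∈ R ↔ g * x * g⁻¹ ∈ Q := by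
  have := h.finite
  obtain ⟨e, -, ⟨g, hg⟩ | ⟨hc, hU⟩ | ⟨-, g, hg⟩⟩ := hQR
  · refine ⟨g⁻¹, mem_iff_conj_mem_of_equiv e fun x hx => ?_⟩
    have h1 : ((e (e.symm ⟨x, hx⟩) : R) : P) = g * (e.symm ⟨x, hx⟩ : P) * g⁻¹ := hg _
    rw [e.apply_symm_apply] at h1
    have h2 : g⁻¹ * x * g⁻¹⁻¹ = e.symm ⟨x, hx⟩ :=
      (congrArg (fun t => g⁻¹ * t * g⁻¹⁻¹) h1).trans (by group)
    exact h2 ▸ (e.symm ⟨x, hx⟩).2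
  · exact absurd ⟨hc, fun x hx => (hU ⟨x, hx⟩).1⟩ hQ
  · refine ⟨g, mem_iff_conj_mem_of_equiv e fun x hx => ?_⟩
    have h1 := hg (e.symm ⟨x, hx⟩)
    have h2 : ((e.toMonoidHom (e.symm ⟨x, hx⟩) : R) : P) = x :=
      congrArg _ (e.apply_symm_apply _)
    rwa [h2] at h1

theorem isFullyCentralized_of_conj {F : FusionSystem P} {Q : Subgroup P}
    (hQ : ∀ R, F.IsConj Q R → ∃ g : P, ∀ x, x ∈ R ↔ g * x * g⁻¹ ∈ Q) : F.IsFullyCentralized Q := by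
  intro R hR
  obtain ⟨g, hg⟩ := hQ R hR
  have h1 : (Subgroup.centralizer (R : Set P)).map (MulAut.conj g).toMonoidHom =
      Subgroup.centralizer (Q : Set P) := by
    ext x
    rw [Subgroup.mem_map_equiv, Subgroup.mem_centralizer_iff, Subgroup.mem_centralizer_iff]
    have h2 : (MulAut.conj g).symm x = g⁻¹ * x * g := rfl
    rw [h2]
    constructor
    · intro hx y hy
      have h3 := hx (g⁻¹ * y * g) (by
        rw [SetLike.mem_coe, hg]
        have h4 : g * (g⁻¹ * y * g) * g⁻¹ = y := by group
        rwa [h4])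
      calc y * x = g * (g⁻¹ * y * g * (g⁻¹ * x * g)) * g⁻¹ := by group
        _ = x * y := by rw [h3]; group
    · intro hx y hy
      have h3 := hx (g * y * g⁻¹) ((hg y).1 hy)
      calc y * (g⁻¹ * x * g) = g⁻¹ * (g * y * g⁻¹ * x) * g := by group
        _ = g⁻¹ * x * g * y := by rw [h3]; group
  rw [← h1]
  exact (Nat.card_congr ((MulAut.conj g).subgroupMap _).toEquiv).le

theorem aut_le_autP_of_notMem {Q : Subgroup P} [Finite P]
    (hQ : ¬ (IsCyclic Q ∧ ∀ x ∈ Q, x ∈ 𝓔.support)) (hQE : Q ∉ 𝓔.carrier) :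
    (𝓔.fusionSystem h).aut Q ≤ FusionSystem.autP Q := by
  rintro β ⟨-, ⟨g, hg⟩ | ⟨hc, hU⟩ | ⟨hE, -⟩⟩
  · exact FusionSystem.mem_autP'.2 ⟨g, hg⟩
  · exact absurd ⟨hc, fun x hx => (hU ⟨x, hx⟩).1⟩ hQ
  · exact absurd hE hQE

theorem exists_sylow_of_mem {h : IsLargeMaxClassGenerator a m} {E : Subgroup P}
    (hE : E ∈ 𝓔.carrier) :
    ∃ S : Sylow 2 ((𝓔.fusionSystem h.toIsMaxClassGenerator).aut E),
      (S : Subgroup ((𝓔.fusionSystem h.toIsMaxClassGenerator).aut E)) =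
        (FusionSystem.autP E).subgroupOf ((𝓔.fusionSystem h.toIsMaxClassGenerator).aut E) := by
  have := h.finite
  obtain ⟨y, hy, rfl⟩ := 𝓔.exists_eq E hE
  have hle := FusionSystem.autP_le_aut (𝓔.fusionSystem h.toIsMaxClassGenerator)
    (essentialSubgroup a y)
  have hp : IsPGroup 2 ((FusionSystem.autP (essentialSubgroup a y)).subgroupOf
      ((𝓔.fusionSystem h.toIsMaxClassGenerator).aut (essentialSubgroup a y))) :=
    (FusionSystem.isPGroup_autP h.isPGroup _).comap_subtype
  obtain ⟨S, hS⟩ := hp.exists_le_sylow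
  refine ⟨S, le_antisymm (fun β hβ => ?_) hS⟩
  have h1 := h.eq_autP_of_isPGroup hy (S.2.map (Subgroup.subtype _)) (fun β hβ =>
    ⟨⟨β, hle hβ⟩, hS hβ, rfl⟩)
  exact h1.le ⟨β, hβ, rfl⟩

theorem exists_extension_of_mem {h : IsLargeMaxClassGenerator a m} {E R : Subgroup P}
    (hE : E ∈ 𝓔.carrier) (φ : E ≃* R)
    (hφ : φ.toMonoidHom ∈ (𝓔.fusionSystem h.toIsMaxClassGenerator).Hom E R) :
    ∃ ψ ∈ (𝓔.fusionSystem h.toIsMaxClassGenerator).Hom (FusionSystem.extender φ) ⊤,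
      ∀ x : E, (ψ (Subgroup.inclusion (FusionSystem.le_extender φ) x) : P) = φ x := by
  have := h.finite
  by_cases hle : FusionSystem.extender φ ≤ E
  · refine ⟨(Subgroup.inclusion le_top).comp (φ.toMonoidHom.comp (Subgroup.inclusion hle)),
      FusionSystem.restrict_mem _ hφ hle _ fun x => rfl, fun x => rfl⟩
  apply FusionSystem.extender_eq_of_mem_autP
  rcases hφ.2 with h1 | ⟨hc, -⟩ | ⟨-, g, hg⟩
  · exact h1
  · exact absurd hc (𝓔.not_isCyclic_of_mem h.toIsMaxClassGenerator hE)
  obtain ⟨y, hy, rfl⟩ := 𝓔.exists_eq E hE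
  obtain ⟨n, hn, hnE⟩ := SetLike.not_le_iff_exists.1 hle
  have hmem := mem_iff_conj_mem_of_equiv φ (g := g) fun x hx => by
    have h1 := hg (φ.symm ⟨x, hx⟩)
    have h2 : ((φ.toMonoidHom (φ.symm ⟨x, hx⟩) : R) : P) = x :=
      congrArg _ (φ.apply_symm_apply _)
    rwa [h2] at h1
  have hR : R.map (MulAut.conj g).toMonoidHom = essentialSubgroup a y := by
    ext x
    rw [Subgroup.mem_map_equiv, hmem]
    simp [mul_assoc]
  let β : MulAut (essentialSubgroup a y) :=
    (φ.trans ((MulAut.conj g).subgroupMap R)).trans (MulEquiv.subgroupCongr hR)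
  have hβ : ∀ x, (β x : P) = g * φ x * g⁻¹ := fun x => rfl
  obtain ⟨hnN, hnφ⟩ := (FusionSystem.mem_extender φ n).1 hn
  obtain ⟨r, -, hr⟩ := FusionSystem.mem_autP.1 hnφ
  have h3 := h.mem_or_mem_autP hy (β := β) (n := n) (n' := g * r * g⁻¹) fun x => by
    have hx : n * x * n⁻¹ ∈ essentialSubgroup a y :=
      (Subgroup.mem_normalizer_iff.1 hnN x).1 x.2
    refine ⟨hx, ?_⟩
    have h4 := hr (φ x)
    have h5 : (MulAut.congr φ ((essentialSubgroup a y).normalizerMonoidHom ⟨n, hnN⟩)) (φ x) =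
        φ ⟨n * x * n⁻¹, hx⟩ := by
      change φ ((essentialSubgroup a y).normalizerMonoidHom ⟨n, hnN⟩ (φ.symm (φ x))) = _
      rw [φ.symm_apply_apply]
      rfl
    rw [h5] at h4
    rw [hβ, hβ, h4]
    group
  obtain ⟨k, hk⟩ := FusionSystem.mem_autP'.1 (h3.resolve_left hnE)
  refine ⟨g⁻¹ * k, fun x => ?_⟩
  have h4 := hk x
  rw [hβ] at h4
  calc (φ x : P) = g⁻¹ * (g * φ x * g⁻¹) * g := by group
    _ = _ := by rw [h4]; group

end EssentialFamily
end EssentialFamilies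

/-! ### Cyclic subgroups of the support, and saturation -/

section Saturation

variable {P : Type*} [Group P] {a : P} {m : ℕ}

namespace IsMaxClassGenerator

theorem normal_of_le (h : IsMaxClassGenerator a m) {R : Subgroup P}
    (hR : R ≤ Subgroup.zpowers a) : R.Normal := by
  have := h.finite
  refine ⟨fun x hx g => ?_⟩
  refine le_of_card_dvd_of_le_isCyclic (C := Subgroup.zpowers a) (K := R)
    ((Subgroup.zpowers_le).2 (h.normal.conj_mem x (hR hx) g)) hR ?_ (Subgroup.mem_zpowers _)
  rw [Nat.card_zpowers, orderOf_conj, ← Nat.card_zpowers]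
  exact Subgroup.card_dvd_of_le ((Subgroup.zpowers_le).2 hx)

theorem card_centralizer_zpowers_le (h : IsMaxClassGenerator a m) {u : P}
    (hu : u ∉ Subgroup.zpowers a) :
    Nat.card (Subgroup.centralizer (Subgroup.zpowers u : Set P)) ≤ 4 := by
  have := h.finite
  refine le_trans (Nat.le_of_dvd Nat.card_pos (Subgroup.card_dvd_of_le ?_))
    (h.card_centralizer_le_four hu)
  exact Subgroup.centralizer_le (by simp)

theorem zpowers_le_centralizer (h : IsMaxClassGenerator a m) {R : Subgroup P}
    (hR : R ≤ Subgroup.zpowers a) : Subgroup.zpowers a ≤ Subgroup.centralizer (R : Set P) :=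
  fun _ hx => Subgroup.mem_centralizer_iff.2 fun _ hr => h.comm (hR hr) hx

theorem four_le_card_centralizer (h : IsMaxClassGenerator a m) {R : Subgroup P}
    (hR : R ≤ Subgroup.zpowers a) : 4 ≤ Nat.card (Subgroup.centralizer (R : Set P)) := by
  have := h.finite
  refine le_trans ?_ (Nat.le_of_dvd Nat.card_pos
    (Subgroup.card_dvd_of_le (h.zpowers_le_centralizer hR)))
  rw [Nat.card_zpowers, h.orderOf_eq]
  have h1 : 2 ^ 2 ≤ 2 ^ m := Nat.pow_le_pow_right (by norm_num) h.two_le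
  exact h1

theorem _root_.IsLargeMaxClassGenerator.four_lt_card_centralizer
    (h : IsLargeMaxClassGenerator a m) {R : Subgroup P} (hR : R ≤ Subgroup.zpowers a) {u : P}
    (hu : u ∉ Subgroup.zpowers a) (hc : Nat.card R = orderOf u) :
    4 < Nat.card (Subgroup.centralizer (R : Set P)) := by
  have := h.finite
  rcases h.orderOf_eq_two_or_four hu with ⟨h1, -⟩ | ⟨h1, -⟩
  · have htop : Subgroup.centralizer (R : Set P) = ⊤ := by
      refine (Subgroup.eq_top_iff' _).2 fun g => Subgroup.mem_centralizer_iff.2 fun r hr => ?_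
      have hr2 : r ^ 2 = 1 := by
        have h2 : (⟨r, hr⟩ : R) ^ Nat.card R = 1 := pow_card_eq_one'
        rw [hc, h1] at h2
        exact congrArg Subtype.val h2
      rcases h.eq_one_or_eq_of_sq (hR hr) hr2 with rfl | rfl
      · simp
      · exact (mul_inv_eq_iff_eq_mul.1 (h.involution_central g)).symm
    rw [htop, Subgroup.card_top]
    have := h.eight_le_card
    omega
  · have h2 : 2 ^ 3 ≤ 2 ^ m := Nat.pow_le_pow_right (by norm_num) (h.three_le u hu h1)
    have h3 := Nat.le_of_dvd Nat.card_pos (Subgroup.card_dvd_of_le (h.zpowers_le_centralizer hR))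
    rw [Nat.card_zpowers, h.orderOf_eq] at h3
    omega

/-- Automorphisms of subgroups of order at most `4` of `⟨a⟩` are induced by conjugation. -/
theorem mem_autP_of_pow_four (h : IsMaxClassGenerator a m) {v : P} (hv : v ∈ Subgroup.zpowers a)
    (hv4 : v ^ 4 = 1) (β : MulAut (Subgroup.zpowers v)) :
    β ∈ FusionSystem.autP (Subgroup.zpowers v) := by
  have := h.finite
  obtain ⟨x, hx⟩ := h.exists_notMem
  have hvv := Subgroup.mem_zpowers v
  have h1 := eq_or_eq_inv_of_mem_zpowers hv4 (β ⟨v, hvv⟩).2 (orderOf_apply β _)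
  have key : ∃ g : P, (β ⟨v, hvv⟩ : P) = g * v * g⁻¹ := by
    rcases h1 with h1 | h1
    · exact ⟨1, by rw [h1]; simp⟩
    · exact ⟨x, by rw [h1, h.conj_eq_inv hx hv hv4]⟩
  obtain ⟨g, hg⟩ := key
  refine FusionSystem.mem_autP'.2 ⟨g, ?_⟩
  rintro ⟨_, k, rfl⟩
  change (β (⟨v, hvv⟩ ^ k) : P) = g * v ^ k * g⁻¹
  rw [map_zpow, SubgroupClass.coe_zpow, hg, _root_.conj_zpow]

end IsMaxClassGenerator

namespace EssentialFamily

variable {𝓔 : EssentialFamily a} {h : IsMaxClassGenerator a m}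

theorem mem_carrier_of_mem_support (h : IsMaxClassGenerator a m) {u : P}
    (hu : u ∉ Subgroup.zpowers a) (hU : u ∈ 𝓔.support) : essentialSubgroup a u ∈ 𝓔.carrier := by
  obtain ⟨E, hE, huE⟩ := hU
  obtain ⟨y, hy, rfl⟩ := 𝓔.exists_eq E hE
  rwa [h.essentialSubgroup_eq_of_mem hy huE hu]

theorem pow_four_of_mem_support (h : IsMaxClassGenerator a m) {u : P}
    (hU : u ∈ 𝓔.support) : u ^ 4 = 1 := by
  by_cases hu : u ∈ Subgroup.zpowers a
  · obtain ⟨E, hE, huE⟩ := hU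
    obtain ⟨y, hy, rfl⟩ := 𝓔.exists_eq E hE
    exact h.torsion_pow_four hy (h.mem_torsion_of_mem hy huE hu)
  · exact h.pow_four hu

theorem exists_zpowers_of_not_le {Q : Subgroup P} (hQ : IsCyclic Q)
    (hX : ¬ Q ≤ Subgroup.zpowers a) : ∃ u ∉ Subgroup.zpowers a, Q = Subgroup.zpowers u := by
  obtain ⟨u, hu⟩ := (Subgroup.isCyclic_iff_exists_zpowers_eq_top Q).1 hQ
  refine ⟨u, fun hu' => hX ?_, hu.symm⟩
  rwa [← hu, Subgroup.zpowers_le]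

theorem mem_autP_of_le [Finite P] (h : IsMaxClassGenerator a m) {Q : Subgroup P}
    (hU : ∀ x ∈ Q, x ∈ 𝓔.support) (hX : Q ≤ Subgroup.zpowers a) (β : MulAut Q) :
    β ∈ FusionSystem.autP Q := by
  have hQ : IsCyclic Q :=
    isCyclic_of_injective (Subgroup.inclusion hX) (Subgroup.inclusion_injective hX)
  obtain ⟨u, rfl⟩ := (Subgroup.isCyclic_iff_exists_zpowers_eq_top Q).1 hQ
  have hu := Subgroup.mem_zpowers u
  exact h.mem_autP_of_pow_four (hX hu) (pow_four_of_mem_support h (hU u hu)) β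

/-- If `F` contains all automorphisms of the members of the family, every cyclic subgroup of the
support is isomorphic in `F` to a subgroup of `⟨a⟩`, through an automorphism of a member. -/
theorem exists_isConj_le (h : IsMaxClassGenerator a m) (F : FusionSystem P)
    (hF : ∀ E ∈ 𝓔.carrier, F.aut E = ⊤) {Q : Subgroup P} (hQ : IsCyclic Q)
    (hU : ∀ x ∈ Q, x ∈ 𝓔.support) : ∃ R ≤ Subgroup.zpowers a, F.IsConj Q R := by
  by_cases hX : Q ≤ Subgroup.zpowers a
  · exact ⟨Q, hX, FusionSystem.IsConj.refl F Q⟩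
  obtain ⟨u, hu, rfl⟩ := exists_zpowers_of_not_le hQ hX
  have huu := Subgroup.mem_zpowers u
  have huE := self_mem_essentialSubgroup (a := a) u
  have hE := mem_carrier_of_mem_support h hu (hU u huu)
  obtain ⟨c, hcX, ho, -, hct⟩ := h.exists_torsion_generator hu
  have hcE : c ∈ essentialSubgroup a u :=
    torsion_le_essentialSubgroup u (hct ▸ Subgroup.mem_zpowers c)
  obtain ⟨θ, hθ⟩ := h.exists_mulAut_apply_eq hu (u := ⟨u, huE⟩) (v := ⟨c, hcE⟩)
    (Subgroup.orderOf_mk _ _) (by rw [Subgroup.orderOf_mk, ho])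
  have hθF : θ ∈ F.aut (essentialSubgroup a u) := hF _ hE ▸ Subgroup.mem_top θ
  have hle : Subgroup.zpowers u ≤ essentialSubgroup a u := (Subgroup.zpowers_le).2 huE
  obtain ⟨S, e, he, hes⟩ := FusionSystem.exists_equiv_of_mem F (FusionSystem.restrict_mem F hθF hle
    (θ.toMonoidHom.comp (Subgroup.inclusion hle)) fun x => rfl)
  refine ⟨S, fun s hs => ?_, e, he⟩
  obtain ⟨⟨_, k, rfl⟩, hk⟩ := e.surjective ⟨s, hs⟩
  have h1 : s = θ (⟨u, huE⟩ ^ k) := by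
    have h2 := hes ⟨(fun k : ℤ => u ^ k) k, k, rfl⟩
    rw [hk] at h2
    exact h2
  rw [h1, map_zpow, hθ]
  exact zpow_mem hcX k

theorem le_of_isFullyNormalized {h : IsLargeMaxClassGenerator a m} {Q : Subgroup P}
    (hQ : IsCyclic Q) (hU : ∀ x ∈ Q, x ∈ 𝓔.support)
    (hn : (𝓔.fusionSystem h.toIsMaxClassGenerator).IsFullyNormalized Q) :
    Q ≤ Subgroup.zpowers a := by
  have := h.finite
  by_contra hX
  obtain ⟨R, hR, hQR⟩ :=
    exists_isConj_le h.toIsMaxClassGenerator _ (fun E hE => aut_eq_top hE) hQ hU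
  obtain ⟨u, hu, rfl⟩ := exists_zpowers_of_not_le hQ hX
  have h1 := hn R hQR
  have h2 := h.normal_of_le hR
  rw [Subgroup.normalizer_eq_top, Subgroup.card_top] at h1
  have h3 : Subgroup.normalizer (Subgroup.zpowers u : Set P) ≤ essentialSubgroup a u :=
    fun n hn' => h.mem_essentialSubgroup_of_conj_mem hu
      ((Subgroup.mem_normalizer_iff.1 hn' u).1 (Subgroup.mem_zpowers u))
  refine h.essentialSubgroup_ne_top hu (top_le_iff.1 (le_trans ?_ h3))
  rw [top_le_iff, ← Subgroup.card_eq_iff_eq_top]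
  exact le_antisymm (Subgroup.card_le_card_group _) h1

theorem le_of_isFullyCentralized {h : IsLargeMaxClassGenerator a m} {Q : Subgroup P}
    (hQ : IsCyclic Q) (hU : ∀ x ∈ Q, x ∈ 𝓔.support)
    (hn : (𝓔.fusionSystem h.toIsMaxClassGenerator).IsFullyCentralized Q) :
    Q ≤ Subgroup.zpowers a := by
  have := h.finite
  by_contra hX
  obtain ⟨R, hR, hQR⟩ :=
    exists_isConj_le h.toIsMaxClassGenerator _ (fun E hE => aut_eq_top hE) hQ hU
  obtain ⟨u, hu, rfl⟩ := exists_zpowers_of_not_le hQ hX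
  have h1 := hn R hQR
  have h2 := h.card_centralizer_zpowers_le hu
  have h3 := h.four_lt_card_centralizer hR hu (by rw [← hQR.card_eq, Nat.card_zpowers])
  omega

theorem eq_of_card_eq [Finite P] {Q R : Subgroup P} (hQ : Q ≤ Subgroup.zpowers a)
    (hR : R ≤ Subgroup.zpowers a) (hc : Nat.card Q = Nat.card R) : Q = R :=
  le_antisymm (le_of_card_dvd_of_le_isCyclic (C := Subgroup.zpowers a) hQ hR hc.dvd)
    (le_of_card_dvd_of_le_isCyclic (C := Subgroup.zpowers a) hR hQ hc.symm.dvd)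

theorem isFullyCentralized_of_le (h : IsMaxClassGenerator a m) {F : FusionSystem P}
    {Q : Subgroup P} (hX : Q ≤ Subgroup.zpowers a) : F.IsFullyCentralized Q := by
  have := h.finite
  intro R hR
  by_cases hRX : R ≤ Subgroup.zpowers a
  · rw [eq_of_card_eq hX hRX hR.card_eq]
  · have hQ : IsCyclic Q :=
      isCyclic_of_injective (Subgroup.inclusion hX) (Subgroup.inclusion_injective hX)
    obtain ⟨e, -⟩ := hR
    obtain ⟨u, hu, rfl⟩ := exists_zpowers_of_not_le (isCyclic_of_surjective e e.surjective) hRX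
    exact (h.card_centralizer_zpowers_le hu).trans (h.four_le_card_centralizer hX)

theorem exists_extension_of_isCyclic {h : IsLargeMaxClassGenerator a m} {Q R : Subgroup P}
    (hQ : IsCyclic Q) (hU : ∀ x ∈ Q, x ∈ 𝓔.support) (φ : Q ≃* R)
    (hφ : φ.toMonoidHom ∈ (𝓔.fusionSystem h.toIsMaxClassGenerator).Hom Q R)
    (hR : (𝓔.fusionSystem h.toIsMaxClassGenerator).IsFullyCentralized R) :
    ∃ ψ ∈ (𝓔.fusionSystem h.toIsMaxClassGenerator).Hom (FusionSystem.extender φ) ⊤,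
      ∀ x : Q, (ψ (Subgroup.inclusion (FusionSystem.le_extender φ) x) : P) = φ x := by
  have := h.finite
  have hRU : ∀ x ∈ R, x ∈ 𝓔.support := fun x hx => by
    have h1 := (hφ.2.mem_support_iff (φ.symm ⟨x, hx⟩)).2 (hU _ (φ.symm ⟨x, hx⟩).2)
    have h2 : ((φ.toMonoidHom (φ.symm ⟨x, hx⟩) : R) : P) = x :=
      congrArg _ (φ.apply_symm_apply _)
    rwa [h2] at h1
  have hRX := le_of_isFullyCentralized (h := h) (isCyclic_of_surjective φ φ.surjective) hRU hR
  by_cases hX : Q ≤ Subgroup.zpowers a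
  · obtain rfl := eq_of_card_eq hX hRX (Nat.card_congr φ.toEquiv)
    exact FusionSystem.extender_eq_of_mem_autP φ
      (FusionSystem.mem_autP'.1 (mem_autP_of_le h.toIsMaxClassGenerator hU hX φ))
  obtain ⟨u, hu, rfl⟩ := exists_zpowers_of_not_le hQ hX
  have huu := Subgroup.mem_zpowers u
  have huE := self_mem_essentialSubgroup (a := a) u
  have hE := mem_carrier_of_mem_support h.toIsMaxClassGenerator hu (hU u huu)
  have ho : orderOf (φ ⟨u, huu⟩ : P) = orderOf u := by
    rw [Subgroup.orderOf_coe, MulEquiv.orderOf_eq, Subgroup.orderOf_mk]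
  have hφE : (φ ⟨u, huu⟩ : P) ∈ essentialSubgroup a u :=
    torsion_le_essentialSubgroup u ⟨hRX (φ ⟨u, huu⟩).2, by rw [← ho, pow_orderOf_eq_one]⟩
  obtain ⟨θ, hθ⟩ := h.exists_mulAut_apply_eq hu (u := ⟨u, huE⟩) (v := ⟨_, hφE⟩)
    (Subgroup.orderOf_mk _ _) (by rw [Subgroup.orderOf_mk, ho])
  have hθF : θ ∈ (𝓔.fusionSystem h.toIsMaxClassGenerator).aut (essentialSubgroup a u) :=
    aut_eq_top hE ▸ Subgroup.mem_top θ
  have hle : FusionSystem.extender φ ≤ essentialSubgroup a u := fun n hn =>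
    h.mem_essentialSubgroup_of_conj_mem hu
      ((Subgroup.mem_normalizer_iff.1 (FusionSystem.extender_le_normalizer φ hn) u).1 huu)
  refine ⟨(Subgroup.inclusion le_top).comp (θ.toMonoidHom.comp (Subgroup.inclusion hle)),
    FusionSystem.restrict_mem _ hθF hle _ fun x => rfl, ?_⟩
  rintro ⟨_, k, rfl⟩
  change (θ (⟨u, huE⟩ ^ k) : P) = φ (⟨u, huu⟩ ^ k)
  rw [map_zpow, map_zpow, hθ]
  rfl

/-- The fusion system generated by a family of essential subgroups is saturated. -/
theorem isSaturated (𝓔 : EssentialFamily a) (h : IsLargeMaxClassGenerator a m) :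
    (𝓔.fusionSystem h.toIsMaxClassGenerator).IsSaturated 2 := by
  have := h.finite
  refine ⟨fun Q hQ => ?_, fun Q hQ => ?_, fun Q R φ hφ hR => ?_⟩
  · by_cases hcU : IsCyclic Q ∧ ∀ x ∈ Q, x ∈ 𝓔.support
    · exact isFullyCentralized_of_le h.toIsMaxClassGenerator
        (le_of_isFullyNormalized (h := h) hcU.1 hcU.2 hQ)
    · exact isFullyCentralized_of_conj fun R hR => exists_conj_of_isConj hcU hR
  · by_cases hE : Q ∈ 𝓔.carrier
    · exact exists_sylow_of_mem (h := h) hE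
    refine FusionSystem.exists_sylow_of_aut_le h.isPGroup ?_
    by_cases hcU : IsCyclic Q ∧ ∀ x ∈ Q, x ∈ 𝓔.support
    · exact fun β _ => mem_autP_of_le h.toIsMaxClassGenerator hcU.2
        (le_of_isFullyNormalized (h := h) hcU.1 hcU.2 hQ) β
    · exact aut_le_autP_of_notMem hcU hE
  · by_cases hE : Q ∈ 𝓔.carrier
    · exact exists_extension_of_mem (h := h) hE φ hφ
    by_cases hcU : IsCyclic Q ∧ ∀ x ∈ Q, x ∈ 𝓔.support
    · exact exists_extension_of_isCyclic (h := h) hcU.1 hcU.2 φ hφ hR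
    · refine FusionSystem.extender_eq_of_mem_autP φ ?_
      rcases hφ.2 with h1 | ⟨hc, h1⟩ | ⟨h1, -⟩
      · exact h1
      · exact absurd ⟨hc, fun x hx => (h1 ⟨x, hx⟩).1⟩ hcU
      · exact absurd h1 hE

/-- The family is determined by its fusion system. -/
theorem isPGroup_aut_iff (𝓔 : EssentialFamily a) (h : IsLargeMaxClassGenerator a m)
    (Q : Subgroup P) :
    IsPGroup 2 ((𝓔.fusionSystem h.toIsMaxClassGenerator).aut Q) ↔ Q ∉ 𝓔.carrier := by
  have := h.finite
  constructor
  · intro hp hE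
    obtain ⟨y, hy, rfl⟩ := 𝓔.exists_eq Q hE
    have h1 := h.eq_autP_of_isPGroup hy hp (FusionSystem.autP_le_aut _ _)
    rw [aut_eq_top hE] at h1
    -- the full automorphism group moves `⟨a⟩ ∩ E`, and conjugations do not
    obtain ⟨c, hcX, ho, -, hct⟩ := h.exists_torsion_generator hy
    have hcE : c ∈ essentialSubgroup a y :=
      torsion_le_essentialSubgroup y (hct ▸ Subgroup.mem_zpowers c)
    obtain ⟨θ, hθ⟩ := h.exists_mulAut_apply_eq hy (u := ⟨c, hcE⟩)
      (v := ⟨y, self_mem_essentialSubgroup y⟩)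
      (by rw [Subgroup.orderOf_mk, ho]) (Subgroup.orderOf_mk _ _)
    obtain ⟨g, hg⟩ := FusionSystem.mem_autP'.1 (h1 ▸ Subgroup.mem_top θ)
    have h2 := hg ⟨c, hcE⟩
    rw [hθ] at h2
    refine hy ?_
    rw [show y = g * c * g⁻¹ from h2]
    exact h.normal.conj_mem c hcX g
  · intro hE
    by_cases hcU : IsCyclic Q ∧ ∀ x ∈ Q, x ∈ 𝓔.support
    · have := hcU.1
      exact (isPGroup_mulAut_of_isCyclic (h.isPGroup.to_subgroup Q)).to_subgroup _
    · exact (FusionSystem.isPGroup_autP h.isPGroup Q).to_le (aut_le_autP_of_notMem hcU hE)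

end EssentialFamily
end Saturation

/-! ### Saturated fusion systems on groups of maximal class -/

section Classification

variable {P : Type*} [Group P] {a : P} {m : ℕ}

theorem FusionSystem.IsConj.isPGroup_aut {F : FusionSystem P} {Q R : Subgroup P}
    (hQR : F.IsConj Q R) {p : ℕ} (hR : IsPGroup p (F.aut R)) : IsPGroup p (F.aut Q) := by
  obtain ⟨e, he⟩ := hQR
  rintro ⟨α, hα⟩
  have h1 : MulAut.congr e α ∈ F.aut R :=
    F.comp_mem (F.symm_mem e he) (F.comp_mem (φ := α.toMonoidHom) (ψ := e.toMonoidHom) hα he)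
  obtain ⟨k, hk⟩ := hR ⟨_, h1⟩
  refine ⟨k, Subtype.ext ((MulAut.congr e).injective ?_)⟩
  change MulAut.congr e (α ^ p ^ k) = MulAut.congr e 1
  rw [map_pow, map_one]
  exact congrArg Subtype.val hk

namespace IsMaxClassGenerator

theorem map_conj_essentialSubgroup (h : IsMaxClassGenerator a m) {y : P}
    (hy : y ∉ Subgroup.zpowers a) (g : P) :
    (essentialSubgroup a y).map (MulAut.conj g).toMonoidHom =
      essentialSubgroup a (g * y * g⁻¹) := by
  have := h.finite
  refine Subgroup.eq_of_le_of_card_ge ?_ ?_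
  · rintro _ ⟨x, hx, rfl⟩
    exact h.conj_mem_essentialSubgroup hx g
  · rw [h.card_essentialSubgroup (h.conj_notMem hy g), orderOf_conj, ← h.card_essentialSubgroup hy]
    exact (Nat.card_congr ((MulAut.conj g).subgroupMap _).toEquiv).le

theorem card_inf_mul_two (h : IsMaxClassGenerator a m) {Q : Subgroup P}
    (hQ : ¬ Q ≤ Subgroup.zpowers a) :
    Nat.card ↥(Subgroup.zpowers a ⊓ Q) * 2 = Nat.card Q := by
  have := h.finite
  have := h.normal
  have h1 : (Subgroup.zpowers a).relIndex Q = 2 := by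
    have h2 := Subgroup.relIndex_dvd_index_of_normal (Subgroup.zpowers a) Q
    rw [h.index_eq] at h2
    exact ((Nat.dvd_prime Nat.prime_two).1 h2).resolve_left
      (fun h3 => hQ (Subgroup.relIndex_eq_one.1 h3))
  have h3 := ((Subgroup.zpowers a).subgroupOf Q).card_mul_index
  rw [← Subgroup.inf_subgroupOf_right,
    Nat.card_congr (Subgroup.subgroupOfEquivOfLe inf_le_right).toEquiv,
    Subgroup.inf_subgroupOf_right] at h3
  rw [← h3]
  exact congrArg _ h1.symm

theorem eq_essentialSubgroup_of_card (h : IsMaxClassGenerator a m) {Q : Subgroup P} {y : P}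
    (hyQ : y ∈ Q) (hy : y ∉ Subgroup.zpowers a) (hc : Nat.card Q = 2 * orderOf y) :
    Q = essentialSubgroup a y := by
  have := h.finite
  have h1 := h.card_inf_mul_two (Q := Q) (fun hle => hy (hle hyQ))
  obtain ⟨c, hcX, ho, -, hct⟩ := h.exists_torsion_generator hy
  have h2 : torsionZpowers a (orderOf y) = Subgroup.zpowers a ⊓ Q := by
    refine EssentialFamily.eq_of_card_eq (a := a) (fun x hx => hx.1) inf_le_left ?_
    rw [hct, Nat.card_zpowers]
    omega
  refine (Subgroup.eq_of_le_of_card_ge ?_ ?_).symm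
  · rw [essentialSubgroup, h2]
    exact sup_le inf_le_right ((Subgroup.zpowers_le).2 hyQ)
  · rw [h.card_essentialSubgroup hy, hc]

/-- A subgroup with an automorphism of odd order is an essential subgroup. -/
theorem exists_eq_essentialSubgroup (h : IsMaxClassGenerator a m) (hm : IsMetacyclic P)
    {Q : Subgroup P} {α : MulAut Q} (hα : Odd (orderOf α)) (h1 : α ≠ 1) :
    ∃ y ∉ Subgroup.zpowers a, Q = essentialSubgroup a y := by
  have := h.finite
  have hQp := h.isPGroup.to_subgroup Q
  have hX : ¬ Q ≤ Subgroup.zpowers a := fun hX => by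
    have : IsCyclic Q :=
      isCyclic_of_injective (Subgroup.inclusion hX) (Subgroup.inclusion_injective hX)
    exact h1 (eq_one_of_odd_orderOf (isPGroup_mulAut_of_isCyclic hQp) hα)
  have hgen : ∀ b c : Q, (∀ g : Q, ∃ i j : ℤ, g = b ^ i * c ^ j) → 
      (b : P) ∉ Subgroup.zpowers a ∨ (c : P) ∉ Subgroup.zpowers a := by
    intro b c hbc
    by_contra! hcon
    refine hX fun x hx => ?_
    obtain ⟨i, j, hij⟩ := hbc ⟨x, hx⟩
    have h2 : x = (b : P) ^ i * (c : P) ^ j := congrArg Subtype.val hij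
    rw [h2]
    exact mul_mem (zpow_mem hcon.1 i) (zpow_mem hcon.2 j)
  have hfin : ∀ (b c : Q) (q : ℕ), orderOf b = q → orderOf c = q →
      (∀ g : Q, ∃ i j : ℤ, g = b ^ i * c ^ j) → Nat.card Q = 2 * q → 
      ∃ y ∉ Subgroup.zpowers a, Q = essentialSubgroup a y := by
    rintro ⟨b, hb⟩ ⟨c, hc⟩ q hbo hco hbc hcard
    rw [Subgroup.orderOf_mk] at hbo hco
    rcases hgen _ _ hbc with h2 | h2
    · exact ⟨b, h2, h.eq_essentialSubgroup_of_card hb h2 (by rw [hbo, hcard])⟩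
    · exact ⟨c, h2, h.eq_essentialSubgroup_of_card hc h2 (by rw [hco, hcard])⟩
  have hpow : ∀ {b : Q} {q : ℕ}, orderOf (α b) = q ↔ orderOf b = q := fun {b q} => by
    rw [MulEquiv.orderOf_eq]
  obtain ⟨b, ⟨n, hn, hb⟩ | hb⟩ := exists_generator_pair_of_odd_mulAut hQp (hm.subgroup Q) hα h1
  · obtain ⟨e, -⟩ := hb.exists_equiv
    have hcard : Nat.card Q = 2 ^ n * 2 ^ n := by
      rw [← Nat.card_congr e.toEquiv, Nat.card_prod]
      simp
    -- the elements of `Q ∩ ⟨a⟩` commute with an element outside `⟨a⟩`, so they are involutions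
    have hle : Nat.card ↥(Subgroup.zpowers a ⊓ Q) ≤ 2 := by
      obtain ⟨y, hyQ, hyX⟩ := SetLike.not_le_iff_exists.1 hX
      have h2 : Subgroup.zpowers a ⊓ Q ≤ Subgroup.zpowers (a ^ 2 ^ (m - 1)) := by
        rintro w ⟨hw, hwQ⟩
        have h3 : y * w = w * y := congrArg Subtype.val (hb.mul_comm ⟨y, hyQ⟩ ⟨w, hwQ⟩)
        rcases h.eq_one_or_eq_of_sq hw (h.sq_eq_one_of_conj_eq hyX hw
          (by rw [mul_inv_eq_iff_eq_mul, h3])) with rfl | rfl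
        · exact one_mem _
        · exact Subgroup.mem_zpowers _
      refine (Nat.le_of_dvd Nat.card_pos (Subgroup.card_dvd_of_le h2)).trans ?_
      rw [Nat.card_zpowers]
      exact orderOf_le_of_pow_eq_one (by norm_num) (by rw [sq]; exact h.involution_sq)
    have hn1 : n = 1 := by
      have h2 := h.card_inf_mul_two hX
      by_contra hne
      have h3 : 2 ^ 2 ≤ 2 ^ n := Nat.pow_le_pow_right (by norm_num) (by omega)
      have h4 := Nat.mul_le_mul h3 h3
      omega
    subst hn1
    exact hfin b (α b) 2 hb.orderOf_left hb.orderOf_right hb.gen hcard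
  · obtain ⟨e, -⟩ := hb.exists_equiv
    refine hfin b (α b) 4 hb.orderOf_eq (hpow.2 hb.orderOf_eq) hb.gen ?_
    rw [← Nat.card_congr e.toEquiv, Nat.card_eq_fintype_card, QuaternionGroup.card]

/-- A group of automorphisms of an essential subgroup that contains the conjugations and a
nontrivial automorphism of odd order is the full automorphism group: it is transitive on the three
maximal subgroups, and the stabilizer of one of them consists of conjugations. -/
theorem _root_.IsLargeMaxClassGenerator.mem_of_odd (h : IsLargeMaxClassGenerator a m)
    (hm : IsMetacyclic P) {y : P}
    (hy : y ∉ Subgroup.zpowers a) {S : Subgroup (MulAut (essentialSubgroup a y))}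
    (hS : FusionSystem.autP (essentialSubgroup a y) ≤ S) {α : MulAut (essentialSubgroup a y)}
    (hα : α ∈ S) (ho : Odd (orderOf α)) (h1 : α ≠ 1) (β : MulAut (essentialSubgroup a y)) :
    β ∈ S := by
  have := h.finite
  have hp := h.isPGroup.to_subgroup (essentialSubgroup a y)
  have hV := (hm.subgroup (essentialSubgroup a y)).card_squareQuotient_le
  obtain ⟨c, hcX, hoc, -, hct⟩ := h.exists_torsion_generator hy
  have hcE : c ∈ essentialSubgroup a y :=
    torsion_le_essentialSubgroup y (hct ▸ Subgroup.mem_zpowers c)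
  have hΦ : squareSubgroup (essentialSubgroup a y) ≤
      (Subgroup.zpowers a).subgroupOf (essentialSubgroup a y) := by
    rw [squareSubgroup, Subgroup.closure_le]
    rintro _ ⟨x, rfl⟩
    exact h.sq_mem x
  have hstab : ∀ γ : MulAut (essentialSubgroup a y), (γ ⟨c, hcE⟩ : P) ∈ Subgroup.zpowers a →
      γ ∈ S := fun γ hγ => hS (h.mem_autP_of_apply_mem hy hcE hcX hoc hγ)
  have key : ∀ γ ∈ S, squareQuotientAut β (⟨c, hcE⟩ : essentialSubgroup a y) =
      squareQuotientAut γ (⟨c, hcE⟩ : essentialSubgroup a y) → β ∈ S := by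
    intro γ hγ heq
    have h2 : squareQuotientAut (γ⁻¹ * β) (⟨c, hcE⟩ : essentialSubgroup a y) =
        ((⟨c, hcE⟩ : essentialSubgroup a y) : _ ⧸ squareSubgroup (essentialSubgroup a y)) := by
      rw [squareQuotientAut_mul, MulAut.mul_apply, heq, ← MulAut.mul_apply, ← squareQuotientAut_mul,
        inv_mul_cancel, squareQuotientAut_mk, MulAut.one_apply]
    rw [squareQuotientAut_mk, eq_comm, QuotientGroup.eq] at h2
    have h3 : (γ⁻¹ * β) ∈ S := hstab _ ((Subgroup.mul_mem_cancel_left _ (inv_mem hcX)).1 (hΦ h2))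
    exact (Subgroup.mul_mem_cancel_left _ (inv_mem hγ)).1 h3
  by_cases hβ : (β ⟨c, hcE⟩ : P) ∈ Subgroup.zpowers a
  · exact hstab β hβ
  have hβ1 : squareQuotientAut β (⟨c, hcE⟩ : essentialSubgroup a y) ≠ 1 := by
    rw [squareQuotientAut_mk, Ne, QuotientGroup.eq_one_iff]
    exact fun h2 => hβ (hΦ h2)
  have hc1 :
      ((⟨c, hcE⟩ : essentialSubgroup a y) : _ ⧸ squareSubgroup (essentialSubgroup a y)) ≠ 1 :=
    fun h2 => hβ1 (by rw [h2, map_one])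
  have hαc : squareQuotientAut α (⟨c, hcE⟩ : essentialSubgroup a y) ≠ 1 := by
    rw [Ne, EmbeddingLike.map_eq_one_iff]
    exact hc1
  rcases eq_or_of_card_le_four hV squareQuotient_mul_self hc1 hαc
    (squareQuotientAut_ne hp hV ho h1 hc1)
    (squareQuotientAut β (⟨c, hcE⟩ : essentialSubgroup a y)) with h2 | h2 | h2 | h2
  · exact absurd h2 hβ1
  · exact key 1 (one_mem S) (by rw [h2, squareQuotientAut_mk, MulAut.one_apply])
  · exact key α hα h2
  · refine key (α * α) (mul_mem hα hα) ?_
    rw [h2, squareQuotientAut_mul, MulAut.mul_apply, squareQuotientAut_apply_apply hp hV ho h1]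

end IsMaxClassGenerator

namespace EssentialFamily

/-- A fusion system in which all automorphisms of the members of a family are morphisms contains the
fusion system that the family generates. -/
theorem hom_subset {𝓔 : EssentialFamily a} (h : IsMaxClassGenerator a m) {F : FusionSystem P}
    (hF : ∀ E ∈ 𝓔.carrier, F.aut E = ⊤) (Q R : Subgroup P) :
    (𝓔.fusionSystem h).Hom Q R ⊆ F.Hom Q R := by
  have := h.finite
  intro φ hφG
  obtain ⟨hφ, ⟨g, hg⟩ | ⟨hQ, hU⟩ | ⟨hE, g, hg⟩⟩ := id hφG
  · exact F.conj_mem g φ hg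
  · obtain ⟨S, e, heG, he⟩ := FusionSystem.exists_equiv_of_mem _ hφG
    have hSU : ∀ x ∈ S, x ∈ 𝓔.support := fun x hx => by
      have h1 := (hU (e.symm ⟨x, hx⟩)).2
      rw [← he, e.apply_symm_apply] at h1
      exact h1
    obtain ⟨C, hC, f, hf⟩ := exists_isConj_le h F hF hQ (fun x hx => (hU ⟨x, hx⟩).1)
    obtain ⟨C', hC', f', hf'⟩ := exists_isConj_le h F hF (isCyclic_of_surjective e e.surjective) hSU
    obtain rfl := eq_of_card_eq hC hC' (by
      rw [← Nat.card_congr f.toEquiv, ← Nat.card_congr f'.toEquiv, Nat.card_congr e.toEquiv])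
    -- all automorphisms of the cyclic group `C` are conjugations
    have hγ : ((f.symm.trans e).trans f' : MulAut C) ∈ F.aut C := by
      obtain ⟨v, rfl⟩ := (Subgroup.isCyclic_iff_exists_zpowers_eq_top C).1
        (isCyclic_of_surjective f f.surjective)
      refine FusionSystem.autP_le_aut F _
        (h.mem_autP_of_pow_four (hC (Subgroup.mem_zpowers v)) ?_ _)
      have h1 := pow_four_of_mem_support h (hU (f.symm ⟨v, Subgroup.mem_zpowers v⟩)).1
      have h2 : (f.symm ⟨v, Subgroup.mem_zpowers v⟩) ^ 4 = 1 := Subtype.ext h1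
      rw [← map_pow, EmbeddingLike.map_eq_one_iff] at h2
      exact congrArg Subtype.val h2
    have h1 := F.comp_mem (F.comp_mem hf hγ) (F.symm_mem f' hf')
    refine F.codRestrict_mem φ h1 fun x => ?_
    rw [← he]
    change _ = ((f'.symm (f' (e (f.symm (f x)))) : S) : P)
    rw [f.symm_apply_apply, f'.symm_apply_apply]
  · have hf : Function.Injective (((MulAut.conj g).toMonoidHom.comp
        (R.subtype.comp φ)).codRestrict Q hg) := fun x y hxy =>
      hφ (Subtype.ext ((MulAut.conj g).injective (congrArg Subtype.val hxy)))
    let β : MulAut Q := MulEquiv.ofBijective _ ⟨hf, Finite.surjective_of_injective hf⟩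
    have hβ : β ∈ F.aut Q := hF Q hE ▸ Subgroup.mem_top β
    have h1 := F.comp_mem hβ (F.conj_mem (R := ⊤) g⁻¹
      ((Subgroup.topEquiv.symm.toMonoidHom).comp ((MulAut.conj g⁻¹).toMonoidHom.comp Q.subtype))
      fun x => rfl)
    refine F.codRestrict_mem φ h1 fun x => ?_
    change (φ x : P) = g⁻¹ * (g * φ x * g⁻¹) * g⁻¹⁻¹
    group

/-- Every saturated fusion system on a `2`-group of maximal class is generated by the essential
subgroups with a nontrivial automorphism of odd order. -/
theorem exists_eq_fusionSystem (h : IsLargeMaxClassGenerator a m) (hm : IsMetacyclic P)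
    {F : FusionSystem P} (hF : F.IsSaturated 2) :
    ∃ 𝓔 : EssentialFamily a, F = 𝓔.fusionSystem h.toIsMaxClassGenerator := by
  have := h.finite
  let 𝓔 : EssentialFamily a :=
    { carrier := {E | (∃ y ∉ Subgroup.zpowers a, E = essentialSubgroup a y) ∧
        ¬ IsPGroup 2 (F.aut E)}
      exists_eq := fun E hE => hE.1
      conj_mem := by
        rintro _ ⟨⟨y, hy, rfl⟩, hp⟩ g
        refine ⟨⟨_, h.conj_notMem hy g, h.map_conj_essentialSubgroup hy g⟩, fun hp' => hp ?_⟩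
        refine FusionSystem.IsConj.isPGroup_aut ⟨(MulAut.conj g).subgroupMap _, ?_⟩ hp'
        exact F.conj_mem g _ fun x => rfl }
  have hodd : ∀ Q : Subgroup P, ¬ IsPGroup 2 (F.aut Q) →
      ∃ α ∈ F.aut Q, Odd (orderOf α) ∧ α ≠ 1 := by
    intro Q hQ
    obtain ⟨⟨α, hα⟩, ho, h1⟩ := exists_odd_of_not_isPGroup hQ
    rw [Subgroup.orderOf_mk] at ho
    exact ⟨α, hα, ho, fun h2 => h1 (Subtype.ext h2)⟩
  have hfull : ∀ E ∈ 𝓔.carrier, F.aut E = ⊤ := by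
    rintro _ ⟨⟨y, hy, rfl⟩, hp⟩
    obtain ⟨α, hα, ho, h1⟩ := hodd _ hp
    exact (Subgroup.eq_top_iff' _).2
      (h.mem_of_odd hm hy (FusionSystem.autP_le_aut F _) hα ho h1)
  refine ⟨𝓔, FusionSystem.ext_of_subset ?_ (hom_subset h.toIsMaxClassGenerator hfull)⟩
  refine hF.hom_subset_of_aut_le h.isPGroup _ fun Q hQ _ => ?_
  by_cases hp : IsPGroup 2 (F.aut Q)
  · exact FusionSystem.autP_le_of_inner (hF.aut_le_autP hQ hp)
  · obtain ⟨α, hα, ho, h1⟩ := hodd Q hp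
    rw [aut_eq_top (𝓔 := 𝓔) ⟨h.exists_eq_essentialSubgroup hm ho h1, hp⟩]
    exact le_top

end EssentialFamily
end Classification

/-! ### The conjugacy classes of essential subgroups, and counting -/

section Counting

variable {P : Type*} [Group P] {a : P} {m : ℕ}

/-- For `x` outside `⟨a⟩`, the elements `x` (for `false`) and `a * x` (for `true`). In a `2`-group
of maximal class they represent the two conjugacy classes of elements outside `⟨a⟩`, which are the
cosets of `⟨a ^ 2⟩` outside `⟨a⟩`. -/
def classRepresentative (a x : P) (b : Bool) : P := cond b (a * x) x

namespace IsMaxClassGenerator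

theorem classRepresentative_notMem (_h : IsMaxClassGenerator a m) {x : P}
    (hx : x ∉ Subgroup.zpowers a) (b : Bool) : classRepresentative a x b ∉ Subgroup.zpowers a := by
  cases b
  · exact hx
  · exact fun h1 => hx ((Subgroup.mul_mem_cancel_left _ (Subgroup.mem_zpowers a)).1 h1)

theorem zpow_mul_eq_conj (h : IsMaxClassGenerator a m) {x : P} (hx : x ∉ Subgroup.zpowers a)
    (i : ℤ) : ∃ g, a ^ i * x = g * classRepresentative a x (decide (Odd i)) * g⁻¹ := by
  have hD : ∀ l : ℤ, a ^ (2 * l) ∈ Subgroup.zpowers (a ^ 2) := fun l =>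
    ⟨l, by simp only [zpow_mul, zpow_ofNat]⟩
  rcases Int.even_or_odd' i with ⟨l, rfl | rfl⟩
  · obtain ⟨g, -, hg⟩ := h.exists_conj_eq_mul hx (hD l)
    refine ⟨g, ?_⟩
    rw [← hg, decide_eq_false (by simp)]
    rfl
  · obtain ⟨g, -, hg⟩ := h.exists_conj_eq_mul (h.classRepresentative_notMem hx true) (hD l)
    refine ⟨g, ?_⟩
    rw [decide_eq_true (by simp), hg, zpow_add, zpow_one, mul_assoc]
    rfl

theorem exists_eq_conj (h : IsMaxClassGenerator a m) {x y : P} (hx : x ∉ Subgroup.zpowers a)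
    (hy : y ∉ Subgroup.zpowers a) : ∃ b g, y = g * classRepresentative a x b * g⁻¹ := by
  have h1 : y * x⁻¹ ∈ Subgroup.zpowers a :=
    h.mul_mem_iff.2 (iff_of_false hy fun h2 => hx (inv_mem_iff.1 h2))
  obtain ⟨i, hi⟩ := h1
  have h2 : y = a ^ i * x := by rw [show a ^ i = _ from hi, inv_mul_cancel_right]
  rw [h2]
  exact ⟨_, h.zpow_mul_eq_conj hx i⟩

theorem notMem_zpowers_sq (h : IsMaxClassGenerator a m) : a ∉ Subgroup.zpowers (a ^ 2) := by
  rintro ⟨k, hk⟩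
  have h1 : a ^ (2 * k - 1) = 1 := by
    rw [zpow_sub_one, zpow_mul, zpow_ofNat, show (a ^ 2) ^ k = a from hk, mul_inv_cancel]
  rw [h.zpow_eq_one_iff] at h1
  have h2 : ((2 : ℕ) : ℤ) ∣ ((2 ^ m : ℕ) : ℤ) := by
    have : 2 ∣ 2 ^ m := dvd_pow_self 2 (by have := h.two_le; omega)
    exact_mod_cast this
  have := h2.trans h1
  omega

/-- The two classes of essential subgroups are different. -/
theorem _root_.IsLargeMaxClassGenerator.eq_of_essentialSubgroup_eq
    (h : IsLargeMaxClassGenerator a m) {x g : P} (hx : x ∉ Subgroup.zpowers a) {b b' : Bool}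
    (he : essentialSubgroup a (classRepresentative a x b) =
      essentialSubgroup a (g * classRepresentative a x b' * g⁻¹)) : b = b' := by
  have hb := h.classRepresentative_notMem hx b
  have hb' := h.classRepresentative_notMem hx b'
  have h1 : g * classRepresentative a x b' * g⁻¹ ∈
      essentialSubgroup a (classRepresentative a x b) := by
    rw [he]
    exact self_mem_essentialSubgroup _
  obtain ⟨w, hw, h2⟩ := h.eq_mul_of_mem h1 (h.conj_notMem hb' g)
  have h3 := h.conj_mul_inv_mem hb' g
  rw [h2, mul_assoc, Subgroup.mul_mem_cancel_left _ (h.torsion_le hb hw)] at h3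
  have ha := h.notMem_zpowers_sq
  cases b <;> cases b'
  · rfl
  · refine absurd ?_ ha
    rw [← inv_mem_iff]
    have h4 : x * (a * x)⁻¹ = a⁻¹ := by group
    exact h4 ▸ h3
  · refine absurd ?_ ha
    have h4 : a * x * x⁻¹ ∈ Subgroup.zpowers (a ^ 2) := h3
    rwa [mul_inv_cancel_right] at h4
  · rfl

theorem _root_.map_essentialSubgroup {σ : P ≃* P} (hσ : σ a = a) (y : P) :
    (essentialSubgroup a y).map σ.toMonoidHom = essentialSubgroup a (σ y) := by
  have ho : orderOf (σ y) = orderOf y := MulEquiv.orderOf_eq σ y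
  have hX : ∀ i : ℤ, σ (a ^ i) = a ^ i := fun i => by rw [map_zpow, hσ]
  rw [essentialSubgroup, essentialSubgroup, Subgroup.map_sup, MonoidHom.map_zpowers, ho]
  congr 1
  ext w
  constructor
  · rintro ⟨w, ⟨⟨i, rfl⟩, hw⟩, rfl⟩
    exact (hX i).symm ▸ ⟨⟨i, rfl⟩, hw⟩
  · rintro ⟨⟨i, rfl⟩, hw⟩
    exact ⟨a ^ i, ⟨⟨i, rfl⟩, hw⟩, hX i⟩

end IsMaxClassGenerator

namespace EssentialFamily

/-- The family of the essential subgroups in a given set of conjugacy classes. -/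
def ofClasses (h : IsMaxClassGenerator a m) {x : P} (hx : x ∉ Subgroup.zpowers a)
    (T : Set Bool) : EssentialFamily a where
  carrier := {E | ∃ b ∈ T, ∃ g, E = essentialSubgroup a (g * classRepresentative a x b * g⁻¹)}
  exists_eq := by
    rintro _ ⟨b, -, g, rfl⟩
    exact ⟨_, h.conj_notMem (h.classRepresentative_notMem hx b) g, rfl⟩
  conj_mem := by
    rintro _ ⟨b, hb, g, rfl⟩ k
    refine ⟨b, hb, k * g, ?_⟩
    rw [h.map_conj_essentialSubgroup (h.conj_notMem (h.classRepresentative_notMem hx b) g)]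
    congr 1
    group

theorem mem_ofClasses_iff (h : IsLargeMaxClassGenerator a m) {x : P}
    (hx : x ∉ Subgroup.zpowers a) {T : Set Bool} {b : Bool} :
    essentialSubgroup a (classRepresentative a x b) ∈
      (ofClasses h.toIsMaxClassGenerator hx T).carrier ↔ b ∈ T := by
  constructor
  · rintro ⟨b', hb', g, he⟩
    rwa [h.eq_of_essentialSubgroup_eq hx he]
  · exact fun hb => ⟨b, hb, 1, by simp⟩

theorem exists_eq_ofClasses (h : IsMaxClassGenerator a m) {x : P}
    (hx : x ∉ Subgroup.zpowers a) (𝓔 : EssentialFamily a) : ∃ T, 𝓔 = ofClasses h hx T := by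
  have hc : ∀ b g, essentialSubgroup a (g * classRepresentative a x b * g⁻¹) =
      (essentialSubgroup a (classRepresentative a x b)).map (MulAut.conj g).toMonoidHom :=
    fun b g => (h.map_conj_essentialSubgroup (h.classRepresentative_notMem hx b) g).symm
  refine ⟨{b | essentialSubgroup a (classRepresentative a x b) ∈ 𝓔.carrier},
    EssentialFamily.ext (Set.ext fun E => ⟨fun hE => ?_, ?_⟩)⟩
  · obtain ⟨y, hy, rfl⟩ := 𝓔.exists_eq E hE
    obtain ⟨b, g, rfl⟩ := h.exists_eq_conj hx hy
    refine ⟨b, ?_, g, rfl⟩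
    have h1 := 𝓔.conj_mem _ hE g⁻¹
    rw [h.map_conj_essentialSubgroup hy] at h1
    have h2 : g⁻¹ * (g * classRepresentative a x b * g⁻¹) * g⁻¹⁻¹ = classRepresentative a x b := by
      group
    rwa [h2] at h1
  · rintro ⟨b, hb, g, rfl⟩
    rw [hc]
    exact 𝓔.conj_mem _ hb g

/-- An automorphism of the group that maps one family to another one is an isomorphism of the
fusion systems. -/
theorem fusionSystem_isIsomorphic {h : IsMaxClassGenerator a m} {𝓔 𝓔' : EssentialFamily a}
    (σ : P ≃* P) (hσ : ∀ E, E ∈ 𝓔.carrier ↔ E.map σ.toMonoidHom ∈ 𝓔'.carrier) :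
    (𝓔.fusionSystem h).IsIsomorphic (𝓔'.fusionSystem h) := by
  have hU : ∀ x, x ∈ 𝓔.support ↔ σ x ∈ 𝓔'.support := by
    intro x
    constructor
    · rintro ⟨E, hE, hx⟩
      exact ⟨_, (hσ E).1 hE, x, hx, rfl⟩
    · rintro ⟨E, hE, hx⟩
      have h1 : (E.map σ.symm.toMonoidHom).map σ.toMonoidHom = E := by
        ext x
        simp [Subgroup.mem_map]
      refine ⟨E.map σ.symm.toMonoidHom, (hσ _).2 (h1.symm ▸ hE), σ x, hx, ?_⟩
      exact σ.symm_apply_apply x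
  refine ⟨σ, fun Q R φ => ?_⟩
  have hmem : ∀ x : Q, σ x ∈ Q.map σ.toMonoidHom := fun x => ⟨x, x.2, rfl⟩
  have ht : ∀ x : Q, (FusionSystem.transport σ φ ⟨σ x, hmem x⟩ : P) = σ (φ x) := fun x =>
    FusionSystem.transport_apply σ φ x x.2 (hmem x)
  have hall : ∀ p : Q.map σ.toMonoidHom → Prop, (∀ y, p y) ↔ ∀ x : Q, p ⟨σ x, hmem x⟩ := by
    intro p
    refine ⟨fun hp x => hp _, ?_⟩
    rintro hp ⟨_, x, hx, rfl⟩
    exact hp ⟨x, hx⟩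
  have hinj : Function.Injective φ ↔ Function.Injective (FusionSystem.transport σ φ) := by
    rw [injective_iff_map_eq_one, injective_iff_map_eq_one, hall]
    refine forall_congr' fun x => ?_
    rw [← OneMemClass.coe_eq_one, ← OneMemClass.coe_eq_one, ← OneMemClass.coe_eq_one,
      ← OneMemClass.coe_eq_one, ht, EmbeddingLike.map_eq_one_iff]
    change _ ↔ (_ → σ x = 1)
    rw [EmbeddingLike.map_eq_one_iff]
  have hmor : 𝓔.IsMor φ ↔ 𝓔'.IsMor (FusionSystem.transport σ φ) := by
    refine or_congr ?_ (or_congr (and_congr ?_ ?_) (and_congr (hσ Q) ?_))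
    · refine σ.toEquiv.exists_congr fun g => ?_
      rw [hall]
      refine forall_congr' fun x => ?_
      rw [ht]
      change _ ↔ σ (φ x) = σ g * σ x * (σ g)⁻¹
      rw [← map_mul, ← map_inv, ← map_mul, σ.injective.eq_iff]
    · exact (σ.subgroupMap Q).isCyclic
    · rw [hall]
      refine forall_congr' fun x => ?_
      rw [ht, hU, hU]
    · refine σ.toEquiv.exists_congr fun g => ?_
      rw [hall]
      refine forall_congr' fun x => ?_
      rw [ht]
      change _ ↔ σ g * σ (φ x) * (σ g)⁻¹ ∈ Q.map σ.toMonoidHom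
      rw [← map_mul, ← map_inv, ← map_mul,
        ← Subgroup.mem_map_iff_mem (f := σ.toMonoidHom) σ.injective]
      rfl
  exact and_congr hinj hmor

theorem mem_carrier_iff_of_transport (h : IsLargeMaxClassGenerator a m)
    {𝓔 𝓔' : EssentialFamily a} {α : P ≃* P}
    (hα : ∀ (Q R : Subgroup P) (φ : Q →* R),
      φ ∈ (𝓔.fusionSystem h.toIsMaxClassGenerator).Hom Q R ↔ FusionSystem.transport α φ ∈
        (𝓔'.fusionSystem h.toIsMaxClassGenerator).Hom (Q.map α.toMonoidHom) (R.map α.toMonoidHom))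
    (Q : Subgroup P) : Q ∈ 𝓔.carrier ↔ Q.map α.toMonoidHom ∈ 𝓔'.carrier := by
  have h1 := FusionSystem.isPGroup_aut_map_iff hα 2 Q
  rw [isPGroup_aut_iff 𝓔 h, isPGroup_aut_iff 𝓔' h] at h1
  exact not_iff_not.1 h1

theorem ncard_eq_of_isIsomorphic (h : IsLargeMaxClassGenerator a m) {𝓔 𝓔' : EssentialFamily a}
    (hi : (𝓔.fusionSystem h.toIsMaxClassGenerator).IsIsomorphic
      (𝓔'.fusionSystem h.toIsMaxClassGenerator)) : 𝓔.carrier.ncard = 𝓔'.carrier.ncard := by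
  obtain ⟨α, hα⟩ := hi
  have h1 : 𝓔'.carrier = (fun Q : Subgroup P => Q.map α.toMonoidHom) '' 𝓔.carrier := by
    ext E
    constructor
    · intro hE
      have h1 : (E.map α.symm.toMonoidHom).map α.toMonoidHom = E := by
        ext x
        simp [Subgroup.mem_map]
      exact ⟨_, (mem_carrier_iff_of_transport h hα _).2 (h1.symm ▸ hE), h1⟩
    · rintro ⟨Q, hQ, rfl⟩
      exact (mem_carrier_iff_of_transport h hα Q).1 hQ
  rw [h1, Set.ncard_image_of_injective _ (Subgroup.map_injective α.injective)]

end EssentialFamily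

/-- If the two classes of essential subgroups are not interchanged by an automorphism because their
members have different orders, there are four saturated fusion systems. -/
theorem IsLargeMaxClassGenerator.numSaturated_eq_four (h : IsLargeMaxClassGenerator a m)
    (hm : IsMetacyclic P) {x : P} (hx : x ∉ Subgroup.zpowers a)
    (ho : orderOf (a * x) ≠ orderOf x) : FusionSystem.numSaturated 2 P = 4 := by
  have := h.finite
  have key : ∀ T T' : Set Bool,
      ((EssentialFamily.ofClasses h.toIsMaxClassGenerator hx T).fusionSystem
        h.toIsMaxClassGenerator).IsIsomorphic ((EssentialFamily.ofClasses h.toIsMaxClassGenerator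
          hx T').fusionSystem h.toIsMaxClassGenerator) → T ⊆ T' := by
    rintro T T' ⟨α, hα⟩ b hb
    obtain ⟨b', hb', g, he⟩ := (EssentialFamily.mem_carrier_iff_of_transport h hα _).1
      ((EssentialFamily.mem_ofClasses_iff h hx).2 hb)
    have h1 := h.classRepresentative_notMem hx
    have h2 : Nat.card (essentialSubgroup a (classRepresentative a x b)) =
        Nat.card (essentialSubgroup a (g * classRepresentative a x b' * g⁻¹)) := by
      rw [← he]
      exact Nat.card_congr (α.subgroupMap _).toEquiv
    rw [h.card_essentialSubgroup (h1 b), h.card_essentialSubgroup (h.conj_notMem (h1 b') g),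
      IsMaxClassGenerator.orderOf_conj] at h2
    have h3 : orderOf (classRepresentative a x b) = orderOf (classRepresentative a x b') := by omega
    cases b <;> cases b'
    · exact hb'
    · exact absurd h3.symm ho
    · exact absurd h3 ho
    · exact hb'
  rw [FusionSystem.numSaturated_eq_card (ι := Set Bool)
    (fun T => (EssentialFamily.ofClasses h.toIsMaxClassGenerator hx T).fusionSystem
      h.toIsMaxClassGenerator) (fun T => EssentialFamily.isSaturated _ h)
    (fun T T' hi => (key T T' hi).antisymm (key T' T hi.symm))]
  · simp [Nat.card_eq_fintype_card]
  · intro F hF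
    obtain ⟨𝓔, rfl⟩ := EssentialFamily.exists_eq_fusionSystem h hm hF
    obtain ⟨T, rfl⟩ := 𝓔.exists_eq_ofClasses h.toIsMaxClassGenerator hx
    exact ⟨T, FusionSystem.IsIsomorphic.refl _⟩

theorem EssentialFamily.map_mem_ofClasses (h : IsMaxClassGenerator a m) {x : P}
    (hx : x ∉ Subgroup.zpowers a) {σ : P ≃* P} (hσ : σ a = a) {k : ℤ}
    (hσx : σ x = a ^ (2 * k + 1) * x) {T : Set Bool} {E : Subgroup P}
    (hE : E ∈ (ofClasses h hx T).carrier) :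
    E.map σ.toMonoidHom ∈ (ofClasses h hx (not ⁻¹' T)).carrier := by
  obtain ⟨b, hb, g, rfl⟩ := hE
  have h1 : ∃ g, σ (classRepresentative a x b) = g * classRepresentative a x (!b) * g⁻¹ := by
    cases b
    · have h2 := h.zpow_mul_eq_conj hx (2 * k + 1)
      rwa [decide_eq_true (by simp), ← hσx] at h2
    · have h2 := h.zpow_mul_eq_conj hx (2 * (k + 1))
      rw [decide_eq_false (by simp)] at h2
      have h3 : σ (a * x) = a ^ (2 * (k + 1)) * x := by
        rw [map_mul, hσ, hσx, ← mul_assoc, ← zpow_one_add]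
        congr 2
        ring
      rwa [← h3] at h2
  obtain ⟨k, hk⟩ := h1
  refine ⟨!b, by simpa using hb, σ g * k, ?_⟩
  rw [map_essentialSubgroup hσ, map_mul, map_mul, map_inv, hk]
  congr 1
  group

/-- If an automorphism interchanges the two classes of essential subgroups, there are three
saturated fusion systems. -/
theorem IsLargeMaxClassGenerator.numSaturated_eq_three (h : IsLargeMaxClassGenerator a m)
    (hm : IsMetacyclic P) {x : P} (hx : x ∉ Subgroup.zpowers a) {σ : P ≃* P} (hσ : σ a = a)
    (hσx : σ x = a * x) : FusionSystem.numSaturated 2 P = 3 := by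
  have := h.finite
  have hiff : ∀ (T : Set Bool) (E : Subgroup P),
      E ∈ (EssentialFamily.ofClasses h.toIsMaxClassGenerator hx T).carrier ↔ E.map σ.toMonoidHom ∈
        (EssentialFamily.ofClasses h.toIsMaxClassGenerator hx (not ⁻¹' T)).carrier := by
    intro T E
    refine ⟨EssentialFamily.map_mem_ofClasses _ hx hσ (k := 0) (by simpa using hσx), fun hE => ?_⟩
    have h1 := EssentialFamily.map_mem_ofClasses _ hx (σ := σ.symm) (k := -1)
      (by rw [MulEquiv.symm_apply_eq, hσ])
      (by rw [MulEquiv.symm_apply_eq, map_mul, map_zpow, hσ, hσx]; group) hE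
    have h2 : (E.map σ.toMonoidHom).map σ.symm.toMonoidHom = E := by
      ext x
      simp [Subgroup.mem_map]
    have h3 : not ⁻¹' (not ⁻¹' T) = T := by
      ext b
      simp
    rwa [h2, h3] at h1
  have hmono : ∀ {T T' : Set Bool}, T ⊂ T' →
      (EssentialFamily.ofClasses h.toIsMaxClassGenerator hx T).carrier.ncard <
        (EssentialFamily.ofClasses h.toIsMaxClassGenerator hx T').carrier.ncard := by
    intro T T' hT
    refine Set.ncard_lt_ncard (LE.le.ssubset_of_not_superset ?_ fun hle => ?_)
      (Set.toFinite _)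
    · rintro _ ⟨b, hb, g, rfl⟩
      exact ⟨b, hT.1 hb, g, rfl⟩
    · exact hT.2 fun b hb => (EssentialFamily.mem_ofClasses_iff h hx).1
        (hle ((EssentialFamily.mem_ofClasses_iff h hx).2 hb))
  have h01 := hmono (T := ∅) (T' := {true}) (by simp [Set.ssubset_iff_subset_ne])
  have h12 := hmono (T := {true}) (T' := Set.univ) (by
    refine (Set.subset_univ _).ssubset_of_ne fun h1 => ?_
    have h2 : false ∈ ({true} : Set Bool) := h1 ▸ Set.mem_univ _
    simp at h2)
  let T : Fin 3 → Set Bool := ![∅, {true}, Set.univ]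
  rw [FusionSystem.numSaturated_eq_card (ι := Fin 3)
    (fun i => (EssentialFamily.ofClasses h.toIsMaxClassGenerator hx (T i)).fusionSystem
      h.toIsMaxClassGenerator) (fun T => EssentialFamily.isSaturated _ h)
    (fun i j hi => ?_) (fun F hF => ?_)]
  · simp
  · have h1 := EssentialFamily.ncard_eq_of_isIsomorphic h hi
    have h02 := h01.trans h12
    fin_cases i <;> fin_cases j <;> first
      | rfl
      | (exfalso
         simp only [T] at h1
         first
          | exact h01.ne h1 | exact h01.ne' h1 | exact h12.ne h1
          | exact h12.ne' h1 | exact h02.ne h1 | exact h02.ne' h1)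
  · obtain ⟨𝓔, rfl⟩ := EssentialFamily.exists_eq_fusionSystem h hm hF
    obtain ⟨S, rfl⟩ := 𝓔.exists_eq_ofClasses h.toIsMaxClassGenerator hx
    by_cases ht : true ∈ S <;> by_cases hf : false ∈ S
    · refine ⟨2, ?_⟩
      have : S = T 2 := by ext b; cases b <;> simp [T, ht, hf]
      rw [this]
      exact FusionSystem.IsIsomorphic.refl _
    · refine ⟨1, ?_⟩
      have : S = T 1 := by ext b; cases b <;> simp [T, ht, hf]
      rw [this]
      exact FusionSystem.IsIsomorphic.refl _
    · refine ⟨1, ?_⟩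
      have : T 1 = not ⁻¹' S := by ext b; cases b <;> simp [T, ht, hf]
      rw [this]
      exact EssentialFamily.fusionSystem_isIsomorphic σ (hiff S)
    · refine ⟨0, ?_⟩
      have : S = T 0 := by ext b; cases b <;> simp [T, ht, hf]
      rw [this]
      exact FusionSystem.IsIsomorphic.refl _

end Counting

/-! ### Recognition of dihedral, quaternion and semidihedral groups -/

theorem QuaternionGroup.inv_a {n : ℕ} (i : ZMod (2 * n)) : (a i)⁻¹ = a (-i) := rfl

theorem QuaternionGroup.inv_xa {n : ℕ} (i : ZMod (2 * n)) :
    (xa i)⁻¹ = xa ((n : ZMod (2 * n)) + i) := rfl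

theorem QuaternionGroup.a_one_zpow {n : ℕ} (k : ℤ) : (a 1 : QuaternionGroup n) ^ k = a k := by
  cases k with
  | ofNat k => simp [a_one_pow]
  | negSucc k => rw [zpow_negSucc, a_one_pow, inv_a, Int.cast_negSucc]

section Recognition

variable {P : Type*} [Group P] {a : P} {m : ℕ}

namespace IsMaxClassGenerator

theorem mem_or_inv_mul_mem (h : IsMaxClassGenerator a m) {x : P} (hx : x ∉ Subgroup.zpowers a)
    (g : P) : g ∈ Subgroup.zpowers a ∨ x⁻¹ * g ∈ Subgroup.zpowers a := by
  by_cases hg : g ∈ Subgroup.zpowers a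
  · exact Or.inl hg
  · exact Or.inr (h.mul_mem_iff.2 (iff_of_false (fun h1 => hx (inv_mem_iff.1 h1)) hg))

theorem sq_eq_sq_of_inverted (h : IsMaxClassGenerator a m) {x y : P}
    (hx : x ∉ Subgroup.zpowers a) (hxa : x * a * x⁻¹ = a⁻¹) (hy : y ∉ Subgroup.zpowers a) :
    y ^ 2 = x ^ 2 := by
  obtain ⟨i, hi⟩ := h.mul_mem_iff.2 (iff_of_false hy fun h2 => hx (inv_mem_iff.1 h2))
  have h2 : y = a ^ i * x := by rw [show a ^ i = _ from hi, inv_mul_cancel_right]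
  have h3 : x * a ^ i * x⁻¹ = a ^ (-i) := by rw [← _root_.conj_zpow, hxa, inv_zpow, zpow_neg]
  calc y ^ 2 = a ^ i * (x * a ^ i * x⁻¹) * x ^ 2 := by rw [h2, sq, sq]; group
    _ = x ^ 2 := by rw [h3, zpow_neg, mul_inv_cancel, one_mul]

theorem exists_mulEquiv_of_inverted (h : IsMaxClassGenerator a m) {x y : P}
    (hx : x ∉ Subgroup.zpowers a) (hxa : x * a * x⁻¹ = a⁻¹) (hy : y ∉ Subgroup.zpowers a)
    (hya : y * a * y⁻¹ = a⁻¹) : ∃ σ : P ≃* P, σ a = a ∧ σ x = y := by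
  have hyx := h.sq_eq_sq_of_inverted hx hxa hy
  rcases h.sq_eq hx with h2 | h2
  · obtain ⟨e, he, hex⟩ := exists_dihedralGroup_equiv h.orderOf_eq h2 hxa hx
        (h.mem_or_inv_mul_mem hx)
    obtain ⟨f, hf, hfy⟩ := exists_dihedralGroup_equiv h.orderOf_eq (hyx.trans h2) hya hy
      (h.mem_or_inv_mul_mem hy)
    refine ⟨e.symm.trans f, ?_, ?_⟩
    · rw [MulEquiv.trans_apply, ← he, e.symm_apply_apply, hf, he]
    · rw [MulEquiv.trans_apply, ← hex, e.symm_apply_apply, hfy]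
  · have ho : orderOf a = 2 * 2 ^ (m - 1) := by
      have := h.two_le
      rw [h.orderOf_eq, ← pow_succ', show m - 1 + 1 = m by omega]
    obtain ⟨e, he, hex⟩ := exists_quaternionGroup_equiv ho h2 hxa hx (h.mem_or_inv_mul_mem hx)
    obtain ⟨f, hf, hfy⟩ := exists_quaternionGroup_equiv ho (hyx.trans h2) hya hy
      (h.mem_or_inv_mul_mem hy)
    refine ⟨e.symm.trans f, ?_, ?_⟩
    · rw [MulEquiv.trans_apply, ← he, e.symm_apply_apply, hf, he]
    · rw [MulEquiv.trans_apply, ← hex, e.symm_apply_apply, hfy]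

theorem numSaturated_eq_three (h : IsMaxClassGenerator a m) (hm : IsMetacyclic P) {x : P}
    (hx : x ∉ Subgroup.zpowers a) (hxa : x * a * x⁻¹ = a⁻¹) (h3 : x ^ 2 ≠ 1 → 3 ≤ m) :
    FusionSystem.numSaturated 2 P = 3 := by
  have hax : a * x ∉ Subgroup.zpowers a := fun h1 =>
    hx ((Subgroup.mul_mem_cancel_left _ (Subgroup.mem_zpowers a)).1 h1)
  obtain ⟨σ, hσ, hσx⟩ := h.exists_mulEquiv_of_inverted hx hxa hax (by
    calc a * x * a * (a * x)⁻¹ = a * (x * a * x⁻¹) * a⁻¹ := by group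
      _ = a⁻¹ := by rw [hxa]; group)
  refine IsLargeMaxClassGenerator.numSaturated_eq_three ⟨h, fun y hy hy4 => h3 fun h2 => ?_⟩ hm hx
    hσ
    hσx
  have h4 := orderOf_dvd_of_pow_eq_one ((h.sq_eq_sq_of_inverted hx hxa hy).trans h2)
  rw [hy4] at h4
  norm_num at h4

theorem isDihedral_or_isQuaternion_or_isSemidihedral (h : IsMaxClassGenerator a m) :
    IsDihedralTwoGroup P ∨ IsQuaternionTwoGroup P ∨ IsSemidihedralTwoGroup P := by
  have hm2 := h.two_le
  obtain ⟨x, hx⟩ := h.exists_notMem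
  rcases h.conj x hx with hxa | ⟨h3, hxa⟩
  · rcases h.sq_eq hx with h2 | h2
    · obtain ⟨e, -⟩ := exists_dihedralGroup_equiv h.orderOf_eq h2 hxa hx
        (h.mem_or_inv_mul_mem hx)
      exact Or.inl ⟨m, hm2, ⟨e.symm⟩⟩
    · have ho : orderOf a = 2 * 2 ^ (m - 1) := by
        rw [h.orderOf_eq, ← pow_succ', show m - 1 + 1 = m by omega]
      obtain ⟨e, -⟩ := exists_quaternionGroup_equiv ho h2 hxa hx (h.mem_or_inv_mul_mem hx)
      exact Or.inr (Or.inl ⟨m - 1, by omega, ⟨e.symm⟩⟩)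
  · right; right
    have haX := Subgroup.mem_zpowers a
    -- one of `x` and `a * x` is an involution
    obtain ⟨s, hs, hs2, hsa⟩ : ∃ s ∉ Subgroup.zpowers a, s ^ 2 = 1 ∧
        s * a * s⁻¹ = a⁻¹ * a ^ 2 ^ (m - 1) := by
      rcases h.sq_eq hx with h2 | h2
      · exact ⟨x, hx, h2, hxa⟩
      · refine ⟨a * x, fun h1 => hx ((Subgroup.mul_mem_cancel_left _ haX).1 h1), ?_, ?_⟩
        · calc (a * x) ^ 2 = a * (x * a * x⁻¹) * x ^ 2 := by rw [sq, sq]; group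
            _ = 1 := by rw [hxa, h2, mul_inv_cancel_left, h.involution_sq]
        · calc a * x * a * (a * x)⁻¹ = a * (x * a * x⁻¹) * a⁻¹ := by group
            _ = _ := by
              rw [hxa, mul_inv_cancel_left]
              exact h.comm (pow_mem haX _) (inv_mem haX)
    refine ⟨m + 1, by omega, h.card_eq, a, s, ?_, ?_, hs2, ?_⟩
    · refine (Subgroup.eq_top_iff' _).2 fun g => ?_
      have hle : Subgroup.zpowers a ≤ Subgroup.closure {a, s} :=
        (Subgroup.zpowers_le).2 (Subgroup.subset_closure (by simp))
      rcases h.mem_or_inv_mul_mem hs g with h1 | h1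
      · exact hle h1
      · exact (Subgroup.mul_mem_cancel_left _
          (inv_mem (Subgroup.subset_closure (by simp)))).1 (hle h1)
    · rw [show m + 1 - 1 = m by omega, ← h.orderOf_eq, pow_orderOf_eq_one]
    · rw [hsa, show m + 1 - 2 = m - 1 by omega, inv_mul_eq_iff_eq_mul, ← pow_succ',
        Nat.sub_add_cancel Nat.one_le_two_pow]

end IsMaxClassGenerator

theorem IsDihedralTwoGroup.numSaturated_eq_three (hP : IsDihedralTwoGroup P) (hm : IsMetacyclic P) :
    FusionSystem.numSaturated 2 P = 3 := by
  obtain ⟨n, hn, ⟨e⟩⟩ := hP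
  have hr : ∀ g, g ∈ Subgroup.zpowers (e.symm (.r 1)) ↔ ∃ i, e g = .r i := by
    intro g
    constructor
    · rintro ⟨k, rfl⟩
      exact ⟨k, by simp⟩
    · rintro ⟨i, hi⟩
      obtain ⟨k, rfl⟩ := ZMod.intCast_surjective i
      refine ⟨k, e.injective ?_⟩
      simp [hi]
  have hx : e.symm (.sr 0) ∉ Subgroup.zpowers (e.symm (.r 1)) := by
    rw [hr]
    simp
  have h := isMaxClassGenerator_of_forall (a := e.symm (.r 1)) (y := e.symm (.sr 0)) hn
    (by rw [MulEquiv.orderOf_eq, DihedralGroup.orderOf_r_one]) hx (fun g => by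
      rw [hr, hr]
      rcases hg : e g with i | i
      · exact Or.inl ⟨i, rfl⟩
      · exact Or.inr ⟨i, by simp [hg]⟩) (Or.inl (e.injective (by simp)))
  refine h.numSaturated_eq_three hm hx (e.injective (by simp)) fun h2 => absurd ?_ h2
  exact e.injective (by simp [sq])

theorem IsQuaternionTwoGroup.numSaturated_eq_three (hP : IsQuaternionTwoGroup P)
    (h8 : Nat.card P ≠ 8) (hm : IsMetacyclic P) : FusionSystem.numSaturated 2 P = 3 := by
  obtain ⟨n, hn, ⟨e⟩⟩ := hP
  have hn1 : n ≠ 1 := by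
    rintro rfl
    refine h8 ?_
    rw [Nat.card_congr e.toEquiv, Nat.card_eq_fintype_card, QuaternionGroup.card]
    norm_num
  have hr : ∀ g, g ∈ Subgroup.zpowers (e.symm (.a 1)) ↔ ∃ i, e g = .a i := by
    intro g
    constructor
    · rintro ⟨k, rfl⟩
      exact ⟨k, by simp [QuaternionGroup.a_one_zpow]⟩
    · rintro ⟨i, hi⟩
      obtain ⟨k, rfl⟩ := ZMod.intCast_surjective i
      refine ⟨k, e.injective ?_⟩
      simp [hi, QuaternionGroup.a_one_zpow]
  have hx : e.symm (.xa 0) ∉ Subgroup.zpowers (e.symm (.a 1)) := by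
    rw [hr]
    simp
  have h0 : (2 : ZMod (2 * 2 ^ n)) ^ n + 2 ^ n = 0 := by
    have h1 := ZMod.natCast_self (2 * 2 ^ n)
    push_cast at h1
    rwa [← two_mul]
  have h := isMaxClassGenerator_of_forall (a := e.symm (.a 1)) (y := e.symm (.xa 0))
    (m := n + 1) (by omega)
    (by rw [MulEquiv.orderOf_eq, QuaternionGroup.orderOf_a_one, pow_succ']) hx (fun g => by
      rw [hr, hr]
      rcases hg : e g with i | i
      · exact Or.inl ⟨i, rfl⟩
      · exact Or.inr ⟨i, by simp [hg, QuaternionGroup.inv_xa]⟩)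
    (Or.inl (e.injective (by simp [QuaternionGroup.inv_xa, QuaternionGroup.inv_a, h0])))
  exact h.numSaturated_eq_three hm hx
    (e.injective (by simp [QuaternionGroup.inv_xa, QuaternionGroup.inv_a, h0])) fun _ => by omega

theorem IsSemidihedralTwoGroup.numSaturated_eq_four (hP : IsSemidihedralTwoGroup P)
    (hm : IsMetacyclic P) : FusionSystem.numSaturated 2 P = 4 := by
  obtain ⟨n, hn, hcard, r, s, hrs, hr, hs, hsr⟩ := hP
  have hfin : Finite P := Nat.finite_of_card_ne_zero (by rw [hcard]; positivity)
  obtain ⟨m, rfl⟩ : ∃ m, n = m + 1 := ⟨n - 1, by omega⟩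
  rw [show m + 1 - 1 = m by omega] at hr
  have hsr' : s * r * s⁻¹ = r⁻¹ * r ^ 2 ^ (m - 1) := by
    rw [hsr, show m + 1 - 2 = m - 1 by omega, eq_inv_mul_iff_mul_eq, ← pow_succ',
      Nat.sub_add_cancel Nat.one_le_two_pow]
  have hsinv : s⁻¹ = s := inv_eq_of_mul_eq_one_right (by rw [← sq, hs])
  have hgen : ∀ g, g ∈ Subgroup.zpowers r ∨ s⁻¹ * g ∈ Subgroup.zpowers r := by
    have hn : ∀ w ∈ Subgroup.zpowers r, s * w * s⁻¹ ∈ Subgroup.zpowers r := by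
      rintro _ ⟨k, rfl⟩
      change s * r ^ k * s⁻¹ ∈ _
      rw [← conj_zpow, hsr]
      exact zpow_mem (pow_mem (Subgroup.mem_zpowers r) _) k
    have hn' : ∀ w ∈ Subgroup.zpowers r, s * w * s ∈ Subgroup.zpowers r := by
      intro w hw
      have := hn w hw
      rwa [hsinv] at this
    intro g
    have hg : g ∈ Subgroup.closure {r, s} := hrs ▸ Subgroup.mem_top g
    rw [hsinv]
    induction hg using Subgroup.closure_induction with
    | mem x hx =>
      rcases hx with rfl | rfl
      · exact Or.inl (Subgroup.mem_zpowers _)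
      · exact Or.inr (by rw [← sq, hs]; exact one_mem _)
    | one => exact Or.inl (one_mem _)
    | mul x y _ _ hx hy =>
      rcases hx with hx | hx <;> rcases hy with hy | hy
      · exact Or.inl (mul_mem hx hy)
      · refine Or.inr ?_
        have h1 : s * (x * y) = s * x * s⁻¹ * (s * y) := by group
        rw [h1]
        exact mul_mem (hn x hx) hy
      · refine Or.inr ?_
        rw [← mul_assoc]
        exact mul_mem hx hy
      · refine Or.inl ?_
        have h1 : x * y = s⁻¹ * (s * x) * s⁻¹ * (s * y) := by group
        rw [h1, hsinv]
        exact mul_mem (hn' _ hx) hy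
    | inv x _ hx =>
      rcases hx with hx | hx
      · exact Or.inl (inv_mem hx)
      · refine Or.inr ?_
        have h1 : s * x⁻¹ = s * (s * x)⁻¹ * s := by group
        rw [h1]
        exact hn' _ (inv_mem hx)
  have hsX : s ∉ Subgroup.zpowers r := by
    intro hsX
    have htop : Subgroup.zpowers r = ⊤ := (Subgroup.eq_top_iff' _).2 fun g =>
      (hgen g).elim id fun h1 => (Subgroup.mul_mem_cancel_left _ (inv_mem hsX)).1 h1
    have h1 : Nat.card (Subgroup.zpowers r) = 2 ^ (m + 1) := by rw [htop, Subgroup.card_top, hcard]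
    rw [Nat.card_zpowers] at h1
    have h2 := orderOf_le_of_pow_eq_one (by positivity) hr
    rw [h1, pow_succ] at h2
    have : 0 < 2 ^ m := by positivity
    omega
  have ho : orderOf r = 2 ^ m := by
    have hidx : (Subgroup.zpowers r).index = 2 :=
      Subgroup.index_eq_two_iff_exists_notMem_and'.2
        ⟨s⁻¹, fun h1 => hsX (inv_mem_iff.1 h1), fun g => (hgen g).symm⟩
    have h1 := (Subgroup.zpowers r).card_mul_index
    rw [hidx, Nat.card_zpowers, hcard, pow_succ] at h1
    omega
  have h := isMaxClassGenerator_of_forall (by omega) ho hsX hgen (Or.inr ⟨by omega, hsr'⟩)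
  refine IsLargeMaxClassGenerator.numSaturated_eq_four ⟨h, fun _ _ _ => by omega⟩ hm hsX
    fun heq => ?_
  have h1 : (r * s) ^ 2 = 1 := by
    rw [← orderOf_dvd_iff_pow_eq_one, heq]
    exact orderOf_dvd_of_pow_eq_one hs
  refine h.involution_ne ?_
  calc r ^ 2 ^ (m - 1) = r * (r⁻¹ * r ^ 2 ^ (m - 1)) * s ^ 2 := by rw [hs]; group
    _ = (r * s) ^ 2 := by rw [← hsr', sq, sq]; group
    _ = 1 := h1

end Recognition

/-! ### Groups on which every saturated fusion system is controlled by automorphisms -/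

section Controlled

variable {P : Type*} [Group P]

namespace FusionSystem

/-- The automorphisms of the whole group that belong to a fusion system. -/
def topAut (F : FusionSystem P) : Subgroup (MulAut P) :=
  (F.aut ⊤).comap (MulAut.congr Subgroup.topEquiv.symm).toMonoidHom

variable {F : FusionSystem P}

theorem mem_hom_of_mem_topAut {α : MulAut P} (hα : α ∈ F.topAut) {Q R : Subgroup P} {φ : Q →* R}
    (h : ∀ x : Q, (φ x : P) = α x) : φ ∈ F.Hom Q R :=
  restrict_mem F hα le_top φ h

theorem conj_le_topAut (F : FusionSystem P) : (MulAut.conj : P →* MulAut P).range ≤ F.topAut := by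
  rintro _ ⟨g, rfl⟩
  exact F.conj_mem g _ fun x => rfl

theorem ofAut_topAut_subset (F : FusionSystem P) (Q R : Subgroup P) :
    (ofAut F.topAut F.conj_le_topAut).Hom Q R ⊆ F.Hom Q R := by
  intro φ hφ
  obtain ⟨α, hα, h⟩ := mem_ofAut.1 hφ
  exact mem_hom_of_mem_topAut hα h

theorem exists_mem_topAut [Finite P] {ψ : (⊤ : Subgroup P) →* (⊤ : Subgroup P)}
    (hψ : ψ ∈ F.Hom ⊤ ⊤) : ∃ α ∈ F.topAut, ∀ x : (⊤ : Subgroup P), (ψ x : P) = α x := by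
  have hb : Function.Bijective ψ :=
    ⟨F.injective_of_mem hψ, Finite.surjective_of_injective (F.injective_of_mem hψ)⟩
  refine ⟨MulAut.congr Subgroup.topEquiv (MulEquiv.ofBijective ψ hb), ?_, fun x => rfl⟩
  exact hψ

theorem congr_mem_autP_top_iff {α : MulAut P} :
    MulAut.congr Subgroup.topEquiv.symm α ∈ autP (⊤ : Subgroup P) ↔
      α ∈ (MulAut.conj : P →* MulAut P).range := by
  rw [mem_autP]
  constructor
  · rintro ⟨g, -, hg⟩
    exact ⟨g, MulEquiv.ext fun x => (hg ⟨x, Subgroup.mem_top x⟩).symm⟩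
  · rintro ⟨g, rfl⟩
    exact ⟨g, Subgroup.le_normalizer (Subgroup.mem_top g), fun x => rfl⟩

theorem isFullyNormalized_top [Finite P] (F : FusionSystem P) : F.IsFullyNormalized ⊤ := by
  intro R _
  refine Nat.le_of_dvd Nat.card_pos (Subgroup.card_dvd_of_le ?_)
  exact le_top.trans Subgroup.le_normalizer

/-- In a saturated fusion system, the inner automorphisms form a normal Sylow subgroup of the group
of automorphisms of the whole group, so every such automorphism has an inner power with exponent
prime to `p`. -/
theorem IsSaturated.exists_coprime_pow_mem [Finite P] {p : ℕ} [Fact p.Prime] (hF : F.IsSaturated p)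
    {β : MulAut P} (hβ : β ∈ F.topAut) :
    ∃ k, p.Coprime k ∧ β ^ k ∈ (MulAut.conj : P →* MulAut P).range := by
  obtain ⟨S, hS⟩ := hF.sylow ⊤ F.isFullyNormalized_top
  have hn : (S : Subgroup (F.aut ⊤)).Normal := by
    rw [hS]
    refine ⟨fun γ hγ δ => ?_⟩
    obtain ⟨g, -, hg⟩ := mem_autP.1 (Subgroup.mem_subgroupOf.1 hγ)
    refine Subgroup.mem_subgroupOf.2 (mem_autP.2 ⟨δ.1 ⟨g, Subgroup.mem_top g⟩,
      Subgroup.le_normalizer (Subgroup.mem_top _), fun x => ?_⟩)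
    have h1 : (γ.1 (δ.1.symm x)) =
        ⟨g, Subgroup.mem_top g⟩ * δ.1.symm x * ⟨g, Subgroup.mem_top g⟩⁻¹ :=
      Subtype.ext (hg _)
    change (δ.1 (γ.1 (δ.1.symm x)) : P) = _
    rw [h1, map_mul, map_mul, map_inv, δ.1.apply_symm_apply]
    rfl
  refine ⟨(S : Subgroup (F.aut ⊤)).index, ?_, ?_⟩
  · exact ((Fact.out : p.Prime).coprime_iff_not_dvd).2 S.not_dvd_index
  · have h1 := Subgroup.mem_subgroupOf.1 (hS.le ((S : Subgroup (F.aut ⊤)).pow_index_mem ⟨_, hβ⟩))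
    rw [← congr_mem_autP_top_iff, map_pow]
    exact h1

end FusionSystem

theorem mem_of_pow_mem_of_isPGroup {M : Type*} [Group M] {N : Subgroup M} {β : M} {s k : ℕ}
    (h2 : β ^ 2 ^ s = 1) (hk : Nat.Coprime 2 k) (h : β ^ k ∈ N) : β ∈ N := by
  have h1 : IsCoprime ((2 ^ s : ℕ) : ℤ) (k : ℤ) := Nat.isCoprime_iff_coprime.2 (hk.pow_left s)
  obtain ⟨u, v, huv⟩ := h1
  have h3 : β = (β ^ k) ^ v := by
    calc β = β ^ (u * ((2 ^ s : ℕ) : ℤ) + v * k) := by rw [huv, zpow_one]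
      _ = (β ^ k) ^ v := by
        rw [zpow_add, mul_comm u, zpow_mul, zpow_natCast, h2, one_zpow, one_mul, mul_comm v,
          zpow_mul,
          zpow_natCast]
  rw [h3]
  exact zpow_mem h v

/-- A group of automorphisms in which the inner automorphisms have odd index is generated by the
inner automorphisms and any nontrivial automorphism of odd order. -/
theorem eq_sup_zpowers_of_odd [Finite P] (hP : IsPGroup 2 P) (hm : IsMetacyclic P)
    {A : Subgroup (MulAut P)} (hA : (MulAut.conj : P →* MulAut P).range ≤ A)
    (hodd : ∀ β ∈ A, ∃ k, Nat.Coprime 2 k ∧ β ^ k ∈ (MulAut.conj : P →* MulAut P).range)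
    {α : MulAut P} (hα : α ∈ A) (ho : Odd (orderOf α)) (h1 : α ≠ 1) :
    A = (MulAut.conj : P →* MulAut P).range ⊔ Subgroup.zpowers α := by
  have hV := hm.card_squareQuotient_le
  refine le_antisymm (fun β hβ => ?_) (sup_le hA ((Subgroup.zpowers_le).2 hα))
  obtain ⟨v, hv⟩ : ∃ v : P ⧸ squareSubgroup P, v ≠ 1 := by
    by_contra! hcon
    exact h1 (eq_one_of_odd_of_squareQuotient hP α ho
      (MulEquiv.ext fun v => by rw [hcon v, map_one, map_one]))
  -- elements of `A` that fix a nontrivial element of the quotient are inner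
  have hfix : ∀ γ ∈ A, squareQuotientAut γ v = v → γ ∈ (MulAut.conj : P →* MulAut P).range := by
    intro γ hγ hγv
    obtain ⟨k, hk, hγk⟩ := hodd γ hγ
    obtain ⟨s, t, ht, hst⟩ := Nat.exists_eq_two_pow_mul_odd (orderOf_pos γ).ne'
    refine mem_of_pow_mem_of_isPGroup (s := s) ?_ hk hγk
    by_contra hne
    have hos : Odd (orderOf (γ ^ 2 ^ s)) := by
      rw [orderOf_pow_of_dvd (by positivity) (hst ▸ dvd_mul_right _ _), hst,
        Nat.mul_div_cancel_left _ (by positivity)]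
      exact ht
    refine squareQuotientAut_ne hP hV hos hne hv ?_
    rw [squareQuotientAut_pow]
    have hall : ∀ n : ℕ, (squareQuotientAut γ ^ n) v = v := by
      intro n
      induction n with
      | zero => simp
      | succ n ih => rw [pow_succ, MulAut.mul_apply, hγv, ih]
    exact hall _
  have key : ∀ γ ∈ Subgroup.zpowers α, squareQuotientAut β v = squareQuotientAut γ v →
      β ∈ (MulAut.conj : P →* MulAut P).range ⊔ Subgroup.zpowers α := by
    intro γ hγ heq
    have h2 : γ⁻¹ * β ∈ (MulAut.conj : P →* MulAut P).range := by
      refine hfix _ (mul_mem (inv_mem ((Subgroup.zpowers_le).2 hα hγ)) hβ) ?_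
      rw [squareQuotientAut_mul, MulAut.mul_apply, heq, ← MulAut.mul_apply, ← squareQuotientAut_mul,
        inv_mul_cancel]
      induction v using QuotientGroup.induction_on
      rw [squareQuotientAut_mk, MulAut.one_apply]
    have h3 : β = γ * (γ⁻¹ * β) := by rw [mul_inv_cancel_left]
    rw [h3]
    exact mul_mem (Subgroup.mem_sup_right hγ) (Subgroup.mem_sup_left h2)
  have hαα := Subgroup.mem_zpowers α
  rcases eq_or_of_card_le_four hV squareQuotient_mul_self hv
    (by rwa [Ne, EmbeddingLike.map_eq_one_iff] : squareQuotientAut α v ≠ 1)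
    (squareQuotientAut_ne hP hV ho h1 hv) (squareQuotientAut β v) with h2 | h2 | h2 | h2
  · exact absurd ((EmbeddingLike.map_eq_one_iff).1 h2) hv
  · refine key 1 (one_mem _) ?_
    rw [h2]
    induction v using QuotientGroup.induction_on
    rw [squareQuotientAut_mk, MulAut.one_apply]
  · exact key α hαα h2
  · refine key (α * α) (mul_mem hαα hαα) ?_
    rw [h2, squareQuotientAut_mul, MulAut.mul_apply, squareQuotientAut_apply_apply hP hV ho h1]

namespace FusionSystem

/-- If every morphism of a saturated fusion system extends to an automorphism of the group, and if
the automorphisms of odd order are conjugate, there are two saturated fusion systems. -/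
theorem numSaturated_eq_two [Finite P] (hP : IsPGroup 2 P) (hm : IsMetacyclic P)
    (hext : ∀ F : FusionSystem P, F.IsSaturated 2 →
      ∀ Q R, F.Hom Q R ⊆ (ofAut F.topAut F.conj_le_topAut).Hom Q R)
    {σ : MulAut P} (hσ : σ ^ 3 = 1) (hσ1 : σ ≠ 1)
    (hconj : ∀ α : MulAut P, Odd (orderOf α) → α ≠ 1 → ∃ e : P ≃* P, MulAut.congr e α = σ) :
    numSaturated 2 P = 2 := by
  let A : Subgroup (MulAut P) := (MulAut.conj : P →* MulAut P).range ⊔ Subgroup.zpowers σ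
  have hA : (MulAut.conj : P →* MulAut P).range ≤ A := le_sup_left
  have hσA : σ ∈ A := Subgroup.mem_sup_right (Subgroup.mem_zpowers σ)
  have hσo : orderOf σ = 3 := orderOf_eq_prime hσ hσ1
  have hInn : ((MulAut.conj : P →* MulAut P).range).Normal := by
    refine ⟨?_⟩
    rintro _ ⟨g, rfl⟩ β
    refine ⟨β g, MulEquiv.ext fun x => ?_⟩
    change β g * x * (β g)⁻¹ = β (g * β.symm x * g⁻¹)
    rw [map_mul, map_mul, map_inv, β.apply_symm_apply]
  have hcube : ∀ α ∈ A, ∃ k, Nat.Coprime 2 k ∧ α ^ k ∈ (MulAut.conj : P →* MulAut P).range := by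
    intro α hα
    refine ⟨3, by norm_num, ?_⟩
    obtain ⟨ι, hι, _, ⟨j, rfl⟩, rfl⟩ := (Subgroup.mem_sup_of_normal_left).1 hα
    rw [← QuotientGroup.eq_one_iff]
    have h1 : ((ι * σ ^ j : MulAut P) : MulAut P ⧸ (MulAut.conj : P →* MulAut P).range) =
        ((σ ^ j : MulAut P) : MulAut P ⧸ _) := by
      rw [QuotientGroup.mk_mul, (QuotientGroup.eq_one_iff ι).2 hι, one_mul]
    change (((ι * σ ^ j) ^ 3 : MulAut P) : MulAut P ⧸ (MulAut.conj : P →* MulAut P).range) = 1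
    rw [QuotientGroup.mk_pow, h1, ← QuotientGroup.mk_pow, ← zpow_natCast, ← zpow_mul, mul_comm,
      zpow_mul, zpow_natCast, hσ, one_zpow, QuotientGroup.mk_one]
  have hAs := isSaturated_ofAut hP A hA hcube
  have hinner : IsPGroup 2 ((inner P).aut ⊤) := by
    refine (isPGroup_autP hP ⊤).to_le ?_
    rintro β ⟨g, hg⟩
    exact mem_autP'.2 ⟨g, hg⟩
  have hnot : ¬ IsPGroup 2 ((ofAut A hA).aut ⊤) := by
    intro hp
    have h1 : MulAut.congr Subgroup.topEquiv.symm σ ∈ (ofAut A hA).aut ⊤ :=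
      mem_ofAut (hA := hA).2 ⟨σ, hσA, fun x => rfl⟩
    have h2 := eq_one_of_odd_orderOf hp (x := ⟨_, h1⟩) (by
      rw [Subgroup.orderOf_mk, MulEquiv.orderOf_eq, hσo]
      decide)
    refine hσ1 ((MulAut.congr (Subgroup.topEquiv (G := P)).symm).injective ?_)
    rw [map_one]
    exact congrArg Subtype.val h2
  have hne : ¬ (inner P).IsIsomorphic (ofAut A hA) := by
    rintro ⟨α, hα⟩
    have h1 := (isPGroup_aut_map_iff hα 2 ⊤).1 hinner
    rw [← MonoidHom.range_eq_map, MonoidHom.range_eq_top.2 α.surjective] at h1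
    exact hnot h1
  rw [numSaturated_eq_card (ι := Bool) (fun b => cond b (ofAut A hA) (inner P))]
  · simp
  · rintro (_ | _)
    · exact isSaturated_inner hP
    · exact hAs
  · rintro (_ | _) (_ | _) hi
    · rfl
    · exact absurd hi hne
    · exact absurd hi.symm hne
    · rfl
  · intro F hF
    have hFA : F = ofAut F.topAut F.conj_le_topAut :=
      ext_of_subset (hext F hF) F.ofAut_topAut_subset
    have hco : ∀ β ∈ F.topAut, ∃ k, Nat.Coprime 2 k ∧
        β ^ k ∈ (MulAut.conj : P →* MulAut P).range := fun β hβ => hF.exists_coprime_pow_mem hβ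
    by_cases hp : IsPGroup 2 F.topAut
    · refine ⟨false, ?_⟩
      have h1 : F.topAut = (MulAut.conj : P →* MulAut P).range := by
        refine le_antisymm (fun β hβ => ?_) F.conj_le_topAut
        obtain ⟨s, hs⟩ := hp ⟨β, hβ⟩
        obtain ⟨k, hk, hβk⟩ := hco β hβ
        exact mem_of_pow_mem_of_isPGroup (congrArg Subtype.val hs) hk hβk
      have h2 : F = inner P := by
        rw [hFA, inner_eq_ofAut]
        congr 1
      rw [h2]
      exact IsIsomorphic.refl _
    · refine ⟨true, ?_⟩
      obtain ⟨⟨α, hα⟩, ho, h1⟩ := exists_odd_of_not_isPGroup hp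
      rw [Subgroup.orderOf_mk] at ho
      have h1' : α ≠ 1 := fun h2 => h1 (Subtype.ext h2)
      obtain ⟨e, he⟩ := hconj α ho h1'
      rw [hFA]
      refine ofAut_isIsomorphic F.conj_le_topAut hA e fun β => ?_
      have hI : (MulAut.conj : P →* MulAut P).range.map (MulAut.congr e).toMonoidHom =
          (MulAut.conj : P →* MulAut P).range := by
        ext γ
        constructor
        · rintro ⟨_, ⟨g, rfl⟩, rfl⟩
          refine ⟨e g, MulEquiv.ext fun x => ?_⟩
          change e g * x * (e g)⁻¹ = e (g * e.symm x * g⁻¹)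
          simp
        · rintro ⟨g, rfl⟩
          refine ⟨MulAut.conj (e.symm g), ⟨_, rfl⟩, MulEquiv.ext fun x => ?_⟩
          change e (e.symm g * e.symm x * (e.symm g)⁻¹) = g * x * g⁻¹
          simp
      have hmap : A = F.topAut.map (MulAut.congr e).toMonoidHom := by
        rw [eq_sup_zpowers_of_odd hP hm F.conj_le_topAut hco hα ho h1', Subgroup.map_sup,
          MonoidHom.map_zpowers, hI]
        change A = _ ⊔ Subgroup.zpowers (MulAut.congr e α)
        rw [he]
      change β ∈ F.topAut ↔ MulAut.congr e β ∈ A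
      rw [hmap]
      exact (Subgroup.mem_map_iff_mem (f := (MulAut.congr e).toMonoidHom)
        (MulAut.congr e).injective).symm

end FusionSystem
end Controlled

/-! ### Homocyclic groups of rank two and the quaternion group of order eight -/

section SmallCases

variable {P : Type*} [Group P]

theorem IsHomocyclicPair.card_eq {n : ℕ} {a c : P} (h : IsHomocyclicPair n a c) :
    Nat.card P = 2 ^ n * 2 ^ n := by
  obtain ⟨e, -⟩ := h.exists_equiv
  rw [← Nat.card_congr e.toEquiv, Nat.card_prod]
  simp

theorem mulAut_eq_of_generators {a c : P} (hgen : ∀ g : P, ∃ i j : ℤ, g = a ^ i * c ^ j)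
    {σ τ : MulAut P} (ha : σ a = τ a) (hc : σ c = τ c) : σ = τ := by
  refine MulEquiv.ext fun g => ?_
  obtain ⟨i, j, rfl⟩ := hgen g
  simp [ha, hc]

/-- If `α ^ 3 = 1` and `a`, `α a` is a basis of a homocyclic `2`-group, then, in additive notation,
`1 + α + α ^ 2 = 0`. So `α` is determined up to conjugation. -/
theorem IsHomocyclicPair.apply_eq_of_pow_three {n : ℕ} {a : P} {α : MulAut P}
    (h : IsHomocyclicPair n a (α a)) (h3 : α ^ 3 = 1) : α (α a) = a⁻¹ * (α a)⁻¹ := by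
  obtain ⟨s, t, hst⟩ := h.gen (α (α a))
  have h1 : α (α (α a)) = a := by
    have := congrArg (fun γ : MulAut P => γ a) h3
    exact this
  set c := α a with hc
  have hcomm : Commute a c := h.comm
  have h2 : a ^ (s * t) * c ^ (s + t * t) = a := by
    calc a ^ (s * t) * c ^ (s + t * t) = c ^ s * (a ^ s * c ^ t) ^ t := by
          rw [(hcomm.zpow_zpow s t).mul_zpow, ← zpow_mul, ← zpow_mul, zpow_add,
            (hcomm.zpow_zpow (s * t) s).left_comm]
      _ = α (α c) := by rw [hst, map_mul, map_zpow, map_zpow, hst, ← hc]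
      _ = a := h1
  have h4 : a ^ (s * t - 1) = c ^ (-(s + t * t)) := by
    rw [zpow_sub_one, zpow_neg, eq_inv_iff_mul_eq_one, (hcomm.inv_left.zpow_right _).right_comm, h2,
      mul_inv_cancel]
  have h5 := h.indep _ _ h4
  have h6 : c ^ (s + t * t) = 1 := by
    rw [h5, zpow_neg, eq_comm, inv_eq_one] at h4
    exact h4
  rw [zpow_eq_zpow_iff_dvd h.orderOf_left] at h5
  rw [zpow_eq_zpow_iff_dvd h.orderOf_right] at h6
  -- `t ^ 3 ≡ -1` modulo a power of two, hence `t ≡ -1`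
  have h7 : ((2 ^ n : ℕ) : ℤ) ∣ (t * t - t + 1) * (t + 1) := by
    have := dvd_sub (h6.mul_left t) h5
    have h8 : t * (s + t * t) - (s * t - 1) = (t * t - t + 1) * (t + 1) := by ring
    rwa [h8] at this
  have hodd : Odd (t * t - t + 1) := by
    have : Even (t * t - t) := by
      rw [show t * t - t = t * (t - 1) by ring]
      exact Int.even_mul_pred_self t
    exact this.add_one
  have h8 : ((2 ^ n : ℕ) : ℤ) ∣ t + 1 := (int_odd_coprime_two_pow hodd n).dvd_of_dvd_mul_left h7
  have h9 : ((2 ^ n : ℕ) : ℤ) ∣ s + 1 := by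
    have := dvd_sub h6 (h8.mul_left (t - 1))
    have h10 : s + t * t - (t - 1) * (t + 1) = s + 1 := by ring
    rwa [h10] at this
  rw [← zpow_eq_zpow_iff_dvd h.orderOf_right, zpow_add_one, ← eq_inv_iff_mul_eq_one] at h8
  rw [← zpow_eq_zpow_iff_dvd h.orderOf_left, zpow_add_one, ← eq_inv_iff_mul_eq_one] at h9
  rw [hst, h8, h9]

theorem IsHomocyclicPair.rotate {n : ℕ} {a c : P} (h : IsHomocyclicPair n a c) :
    IsHomocyclicPair n c (a⁻¹ * c⁻¹) := by
  have hcomm : Commute a c := h.comm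
  have hpow : ∀ j : ℤ, (a⁻¹ * c⁻¹) ^ j = a ^ (-j) * c ^ (-j) := fun j => by
    rw [hcomm.inv_inv.mul_zpow, inv_zpow, inv_zpow, zpow_neg, zpow_neg]
  have hrel : ∀ i j : ℤ, c ^ i = (a⁻¹ * c⁻¹) ^ j → a ^ j = 1 ∧ c ^ i = c ^ (-j) := by
    intro i j hij
    rw [hpow] at hij
    have h1 : a ^ (-j) = c ^ (i + j) := by
      rw [zpow_add, hij, mul_assoc, ← zpow_add, neg_add_cancel, zpow_zero, mul_one]
    have h2 := h.indep _ _ h1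
    rw [h2, one_mul] at hij
    rw [zpow_neg, inv_eq_one] at h2
    exact ⟨h2, hij⟩
  refine ⟨h.orderOf_right, ?_, h.mul_comm _ _, ?_, fun g => ?_⟩
  · refine Nat.dvd_antisymm ?_ ?_
    · rw [orderOf_dvd_iff_pow_eq_one, hcomm.inv_inv.mul_pow, inv_pow, inv_pow, ← h.orderOf_left,
        pow_orderOf_eq_one, h.orderOf_left, ← h.orderOf_right, pow_orderOf_eq_one]
      simp
    · rw [← h.orderOf_left, orderOf_dvd_iff_pow_eq_one, ← zpow_natCast]
      refine (hrel 0 _ ?_).1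
      rw [zpow_natCast, pow_orderOf_eq_one, zpow_zero]
  · intro i j hij
    obtain ⟨h1, h2⟩ := hrel i j hij
    rw [zpow_eq_zpow_iff_dvd h.orderOf_left] at h1
    rw [h2, zpow_eq_zpow_iff_dvd h.orderOf_right]
    exact h1.neg_right
  · obtain ⟨i, j, rfl⟩ := h.gen g
    refine ⟨j - i, -i, ?_⟩
    rw [hpow, neg_neg, (hcomm.zpow_zpow i i).eq, ← mul_assoc, ← zpow_add, sub_add_cancel,
      (hcomm.zpow_zpow i j).eq]

/-- In an abelian group, the morphisms of a saturated fusion system extend to automorphisms. -/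
theorem FusionSystem.IsSaturated.hom_subset_of_comm [Finite P] {p : ℕ} {F : FusionSystem P}
    (hF : F.IsSaturated p) (hcomm : ∀ x y : P, x * y = y * x) (Q R : Subgroup P) :
    F.Hom Q R ⊆ (ofAut F.topAut F.conj_le_topAut).Hom Q R := by
  intro φ hφ
  obtain ⟨S, e, he, hes⟩ := exists_equiv_of_mem F hφ
  have hcent : ∀ T : Subgroup P, Subgroup.centralizer (T : Set P) = ⊤ := fun T =>
    (Subgroup.eq_top_iff' _).2 fun x => Subgroup.mem_centralizer_iff.2 fun y _ => hcomm y x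
  obtain ⟨ψ, hψ, hext⟩ := hF.extension Q S e he fun T _ => by rw [hcent, hcent]
  have htop : extender e = ⊤ := by
    refine (Subgroup.eq_top_iff' _).2 fun x => (mem_extender e x).2 ?_
    have hx : x ∈ Subgroup.normalizer (Q : Set P) := by
      refine mem_normalizer_of_conj fun y hy => ?_
      rwa [hcomm x y, mul_inv_cancel_right]
    refine ⟨hx, ?_⟩
    have h1 : Q.normalizerMonoidHom ⟨x, hx⟩ = 1 := MulEquiv.ext fun y => Subtype.ext (by
      change x * y * x⁻¹ = y
      rw [hcomm x y, mul_inv_cancel_right])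
    rw [h1, map_one]
    exact one_mem _
  have key : ∀ (H : Subgroup P) (hQ : Q ≤ H) (ψ : H →* (⊤ : Subgroup P)), H = ⊤ → ψ ∈ F.Hom H ⊤ →
      (∀ x : Q, (ψ (Subgroup.inclusion hQ x) : P) = e x) →
        φ ∈ (ofAut F.topAut F.conj_le_topAut).Hom Q R := by
    rintro H hQ ψ rfl hψ hext
    obtain ⟨α, hα, h⟩ := exists_mem_topAut hψ
    refine mem_ofAut.2 ⟨α, hα, fun x => ?_⟩
    rw [← hes, ← hext, h]
    rfl
  exact key _ _ ψ htop hψ hext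

theorem exists_isHomocyclicPair {n : ℕ}
    (e : P ≃* Multiplicative (ZMod (2 ^ n)) × Multiplicative (ZMod (2 ^ n))) :
    ∃ a c : P, IsHomocyclicPair n a c := by
  have ho : orderOf (Multiplicative.ofAdd (1 : ZMod (2 ^ n))) = 2 ^ n := by
    rw [orderOf_ofAdd_eq_addOrderOf, ZMod.addOrderOf_one]
  refine ⟨e.symm (Multiplicative.ofAdd 1, 1), e.symm (1, Multiplicative.ofAdd 1),
    ?_, ?_, ?_, ?_, ?_⟩
  · rw [MulEquiv.orderOf_eq, Prod.orderOf_mk, ho, orderOf_one, Nat.lcm_one_right]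
  · rw [MulEquiv.orderOf_eq, Prod.orderOf_mk, ho, orderOf_one, Nat.lcm_one_left]
  · rw [← map_mul, ← map_mul, Prod.mk_mul_mk, Prod.mk_mul_mk, one_mul, mul_one]
  · intro i j hij
    rw [← map_zpow, ← map_zpow, e.symm.injective.eq_iff, Prod.pow_mk, Prod.pow_mk, one_zpow,
      one_zpow, Prod.mk.injEq] at hij
    rw [← map_zpow, Prod.pow_mk, hij.1, one_zpow, ← Prod.one_eq_mk, map_one]
  · intro g
    obtain ⟨i, hi⟩ := ZMod.intCast_surjective (Multiplicative.toAdd (e g).1)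
    obtain ⟨j, hj⟩ := ZMod.intCast_surjective (Multiplicative.toAdd (e g).2)
    have hz : ∀ k : ℤ, (Multiplicative.ofAdd (1 : ZMod (2 ^ n))) ^ k =
        Multiplicative.ofAdd (k : ZMod (2 ^ n)) := fun k => by
      rw [← ofAdd_zsmul, zsmul_one]
    refine ⟨i, j, e.injective ?_⟩
    rw [map_mul, map_zpow, map_zpow, e.apply_symm_apply, e.apply_symm_apply, Prod.pow_mk,
      Prod.pow_mk, one_zpow, one_zpow, Prod.mk_mul_mk, one_mul, mul_one, hz, hz, hi, hj]
    rfl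

theorem IsHomocyclicTwoGroup.numSaturated_eq_two [Finite P] (hP : IsPGroup 2 P)
    (hm : IsMetacyclic P) (h : IsHomocyclicTwoGroup P) : FusionSystem.numSaturated 2 P = 2 := by
  obtain ⟨n, hn, ⟨e⟩⟩ := h
  obtain ⟨a, c, hac⟩ := exists_isHomocyclicPair e
  have hcomm := hac.mul_comm
  obtain ⟨σ, hσa, hσc⟩ := hac.exists_equiv_of_pair hac.rotate
  have hσ3 : (σ : MulAut P) ^ 3 = 1 := by
    refine mulAut_eq_of_generators hac.gen ?_ ?_
    · change σ (σ (σ a)) = a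
      rw [hσa, hσc, map_mul, map_inv, map_inv, hσa, hσc, mul_inv_rev, inv_inv, inv_inv,
        inv_mul_cancel_left]
    · change σ (σ (σ c)) = c
      rw [hσc, map_mul, map_inv, map_inv, hσa, hσc, map_mul, map_inv, map_inv, map_mul, map_inv,
        map_inv, hσc, hσa, hcomm a⁻¹]
      group
  have hca : c ≠ a := by
    rintro rfl
    have h1 := hac.indep 1 1 rfl
    have h2 := hac.orderOf_left
    rw [zpow_one] at h1
    rw [h1, orderOf_one] at h2
    have : 2 ^ 1 ≤ 2 ^ n := Nat.pow_le_pow_right (by norm_num) hn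
    omega
  refine FusionSystem.numSaturated_eq_two hP hm (fun F hF => hF.hom_subset_of_comm hcomm)
    (σ := σ) hσ3 (fun h1 => hca ?_) fun α ho h1 => ?_
  · rw [← hσa, h1, MulAut.one_apply]
  obtain ⟨b, ⟨k, hk, hb⟩ | hb⟩ := exists_generator_pair_of_odd_mulAut hP hm ho h1
  · have hkn : k = n := by
      have h2 := hb.card_eq.symm.trans hac.card_eq
      rw [← pow_add, ← pow_add] at h2
      have := Nat.pow_right_injective le_rfl h2
      omega
    subst hkn
    obtain ⟨f, hfb, hfc⟩ := hb.exists_equiv_of_pair hac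
    refine ⟨f, mulAut_eq_of_generators hac.gen ?_ ?_⟩
    · change f (α (f.symm a)) = σ a
      rw [← hfb, f.symm_apply_apply, hfc, hfb, hσa]
    · change f (α (f.symm c)) = σ c
      rw [← hfc, f.symm_apply_apply, hb.apply_eq_of_pow_three
        (pow_three_eq_one_of_odd hP hm.card_squareQuotient_le ho), map_mul, map_inv, map_inv, hfb,
        hfc, hσc]
  · exfalso
    refine hb.sq_ne ?_
    have h2 := hb.conj
    rw [hcomm, inv_mul_cancel_left, eq_inv_iff_mul_eq_one, ← sq] at h2
    exact h2

theorem IsQuaternionPair.isMaxClassGenerator {a c : P} (h : IsQuaternionPair a c) :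
    IsMaxClassGenerator a 2 :=
  isMaxClassGenerator_of_forall le_rfl h.orderOf_eq h.notMem h.mem_or_inv_mul_mem (Or.inl h.conj)

theorem IsQuaternionPair.sq_eq_of_notMem {a c : P} (h : IsQuaternionPair a c) {y : P}
    (hy : y ∉ Subgroup.zpowers a) : y ^ 2 = a ^ 2 :=
  (h.isMaxClassGenerator.sq_eq_sq_of_inverted h.notMem h.conj hy).trans h.sq_eq

theorem IsQuaternionPair.eq_one_or_eq_of_mem_squareSubgroup {a c : P} (h : IsQuaternionPair a c)
    {g : P} (hg : g ∈ squareSubgroup P) : g = 1 ∨ g = a ^ 2 := by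
  have hle : squareSubgroup P ≤ Subgroup.zpowers (a ^ 2) := by
    rw [squareSubgroup, Subgroup.closure_le]
    rintro _ ⟨y, rfl⟩
    by_cases hy : y ∈ Subgroup.zpowers a
    · obtain ⟨k, rfl⟩ := hy
      refine ⟨k, ?_⟩
      change (a ^ 2) ^ k = (a ^ k) ^ 2
      rw [← zpow_natCast a 2, ← zpow_natCast (a ^ k) 2, zpow_comm]
    · change y ^ 2 ∈ _
      rw [h.sq_eq_of_notMem hy]
      exact Subgroup.mem_zpowers _
  obtain ⟨k, rfl⟩ := hle hg
  have h2 : a ^ 2 * a ^ 2 = 1 := by rw [← pow_add, h.pow_four]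
  change (a ^ 2) ^ k = 1 ∨ (a ^ 2) ^ k = a ^ 2
  rcases Int.even_or_odd' k with ⟨l, rfl | rfl⟩
  · left
    rw [zpow_mul, zpow_ofNat, sq (a ^ 2), h2, one_zpow]
  · right
    rw [zpow_add_one, zpow_mul, zpow_ofNat, sq (a ^ 2), h2, one_zpow, one_mul]

theorem IsQuaternionPair.mul_comm_eq {a c : P} (h : IsQuaternionPair a c) : a * c = c * a⁻¹ := by
  have h1 := h.conj
  rw [mul_inv_eq_iff_eq_mul] at h1
  rw [eq_mul_inv_iff_mul_eq, mul_assoc, h1, mul_inv_cancel_left]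

theorem IsQuaternionPair.rotate {a c : P} (h : IsQuaternionPair a c) :
    IsQuaternionPair c (a * c) := by
  have hac := h.mul_comm_eq
  have hconj : a * c * c * (a * c)⁻¹ = c⁻¹ := by
    calc a * c * c * (a * c)⁻¹ = a * c * a⁻¹ := by group
      _ = c * (a ^ 2)⁻¹ := by rw [hac, mul_assoc, sq, mul_inv_rev]
      _ = c⁻¹ := by rw [← h.sq_eq, sq, mul_inv_rev, mul_inv_cancel_left]
  have hw : ∀ j : ℤ, a * c * c ^ j = c ^ (-j) * (a * c) := fun j => by
    rw [zpow_neg, ← inv_zpow, ← hconj, conj_zpow, inv_mul_cancel_right]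
  refine ⟨by rw [h.sq_eq]; exact h.sq_ne, ?_, ?_, hconj, fun g => ?_⟩
  · rw [show 4 = 2 * 2 from rfl, pow_mul, h.sq_eq, ← pow_mul, h.pow_four]
  · rw [h.sq_eq_of_notMem (fun h1 => h.notMem ((Subgroup.mul_mem_cancel_left _
      (Subgroup.mem_zpowers a)).1 h1)), h.sq_eq]
  · obtain ⟨i, j, rfl⟩ := h.gen g
    have hsq : ∀ k : ℤ, a ^ (2 * k) = c ^ (2 * k) := fun k => by
      rw [zpow_mul, zpow_mul, zpow_ofNat, zpow_ofNat, h.sq_eq]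
    rcases Int.even_or_odd' i with ⟨k, rfl | rfl⟩
    · exact ⟨2 * k + j, 0, by rw [hsq, zpow_add, zpow_zero, mul_one]⟩
    · have ha : a = c * (a * c) := by
        rw [hac, ← mul_assoc, ← sq, h.sq_eq, sq, mul_inv_cancel_right]
      refine ⟨2 * k + 1 - j, 1, ?_⟩
      calc a ^ (2 * k + 1) * c ^ j = c ^ (2 * k) * (c * (a * c)) * c ^ j := by
            rw [zpow_add_one, hsq, ← ha]
        _ = c ^ (2 * k) * c * (a * c * c ^ j) := by simp only [mul_assoc]
        _ = c ^ (2 * k + 1 - j) * (a * c) ^ (1 : ℤ) := by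
            rw [hw, zpow_one, sub_eq_add_neg, zpow_add, zpow_add_one]
            simp only [mul_assoc]

theorem IsQuaternionTwoGroup.exists_isQuaternionPair (h : IsQuaternionTwoGroup P)
    (h8 : Nat.card P = 8) : ∃ a c : P, IsQuaternionPair a c := by
  obtain ⟨n, hn, ⟨e⟩⟩ := h
  obtain rfl : n = 1 := by
    rw [Nat.card_congr e.toEquiv, Nat.card_eq_fintype_card, QuaternionGroup.card,
      show 8 = 4 * 2 ^ 1 from rfl] at h8
    exact Nat.pow_right_injective le_rfl (Nat.eq_of_mul_eq_mul_left (by norm_num) h8)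
  refine ⟨e.symm (.a 1), e.symm (.xa 0), ?_, ?_, ?_, ?_, fun g => ?_⟩
  · rw [← map_pow, Ne, map_eq_one_iff _ e.symm.injective]
    decide
  · rw [← map_pow, map_eq_one_iff _ e.symm.injective]
    decide
  · rw [← map_pow, ← map_pow, e.symm.injective.eq_iff]
    decide
  · rw [← map_inv, ← map_inv, ← map_mul, ← map_mul, e.symm.injective.eq_iff]
    decide
  · rcases hg : e g with i | i
    · obtain ⟨k, rfl⟩ := ZMod.intCast_surjective i
      exact ⟨k, 0, e.injective (by simp [hg, QuaternionGroup.a_one_zpow])⟩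
    · obtain ⟨k, rfl⟩ := ZMod.intCast_surjective i
      exact ⟨-k, 1, e.injective (by
        rw [map_mul, map_zpow, map_zpow, e.apply_symm_apply, e.apply_symm_apply, hg, zpow_one,
          QuaternionGroup.a_one_zpow]
        simp)⟩

/-- In the quaternion group of order `8`, the whole group is the only subgroup with a nontrivial
automorphism of odd order. -/
theorem IsQuaternionPair.eq_top_of_odd {a c : P} (h : IsQuaternionPair a c) (hm : IsMetacyclic P)
    {Q : Subgroup P} {α : MulAut Q} (hα : Odd (orderOf α)) (h1 : α ≠ 1) : Q = ⊤ := by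
  have hmax := h.isMaxClassGenerator
  have := hmax.finite
  obtain ⟨y, hy, rfl⟩ := hmax.exists_eq_essentialSubgroup hm hα h1
  have hy2 := h.sq_eq_of_notMem hy
  have hyo : orderOf y = 4 := orderOf_eq_prime_pow (p := 2) (n := 1)
    (by simpa [hy2] using h.sq_ne)
    (by rw [show 2 ^ (1 + 1) = 2 * 2 from rfl, pow_mul, hy2, ← pow_mul, h.pow_four])
  refine Subgroup.eq_top_of_card_eq _ ?_
  rw [hmax.card_essentialSubgroup hy, hyo, hmax.card_eq]
  norm_num

theorem IsQuaternionPair.inv {a c : P} (h : IsQuaternionPair a c) : IsQuaternionPair a⁻¹ c⁻¹ := by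
  refine ⟨?_, ?_, ?_, ?_, fun g => ?_⟩
  · rw [inv_pow]
    exact inv_ne_one.2 h.sq_ne
  · rw [inv_pow, h.pow_four, inv_one]
  · rw [inv_pow, inv_pow, h.sq_eq]
  · rw [inv_inv, inv_inv, mul_assoc, inv_mul_eq_iff_eq_mul]
    exact (mul_inv_eq_iff_eq_mul.1 h.conj).symm
  · obtain ⟨i, j, hij⟩ := h.gen g
    exact ⟨-i, -j, by simpa using hij⟩

/-- An automorphism of order three of the quaternion group of order `8` permutes three suitable
elements of order four cyclically. -/
theorem IsQuaternionPair.exists_apply_apply_eq [Finite P] {b : P} {α : MulAut P}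
    (h : IsQuaternionPair b (α b)) (hm : IsMetacyclic P) (ho : Odd (orderOf α)) (h1 : α ≠ 1) :
    ∃ b, IsQuaternionPair b (α b) ∧ α (α b) = b * α b := by
  have hq := squareQuotientAut_apply_apply h.isMaxClassGenerator.isPGroup hm.card_squareQuotient_le
    ho h1 (b : P ⧸ squareSubgroup P)
  have hq' : ((b * α b : P) : P ⧸ squareSubgroup P) = (α (α b) : P) := hq.symm
  rcases h.eq_one_or_eq_of_mem_squareSubgroup (QuotientGroup.eq.1 hq') with h2 | h2
  · exact ⟨b, h, (inv_mul_eq_one.1 h2).symm⟩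
  · refine ⟨b⁻¹, by rw [map_inv]; exact h.inv, ?_⟩
    rw [inv_mul_eq_iff_eq_mul] at h2
    rw [map_inv, map_inv, h2, ← mul_inv_rev, h.mul_comm_eq, sq, mul_assoc, inv_mul_cancel_left]

theorem IsQuaternionTwoGroup.numSaturated_eq_two [Finite P] (hP : IsPGroup 2 P)
    (h : IsQuaternionTwoGroup P) (h8 : Nat.card P = 8) (hm : IsMetacyclic P) :
    FusionSystem.numSaturated 2 P = 2 := by
  obtain ⟨a, c, hac⟩ := h.exists_isQuaternionPair h8
  obtain ⟨σ, hσa, hσc⟩ := hac.exists_equiv_of_pair hac.rotate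
  have hσ3 : (σ : MulAut P) ^ 3 = 1 := by
    refine mulAut_eq_of_generators hac.gen ?_ ?_
    · change σ (σ (σ a)) = a
      rw [hσa, hσc, map_mul, hσa, hσc, hac.rotate.mul_comm_eq, mul_inv_cancel_right]
    · change σ (σ (σ c)) = c
      rw [hσc, map_mul, hσa, hσc, map_mul, map_mul, hσa, hσc,
        hac.rotate.mul_comm_eq, ← mul_assoc, ← sq, hac.rotate.sq_eq, sq, mul_inv_cancel_right]
  refine FusionSystem.numSaturated_eq_two hP hm (fun F hF => ?_)
    (σ := σ) hσ3 (fun h1 => hac.notMem ?_) fun α ho h1 => ?_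
  · refine hF.hom_subset_of_aut_le hP _ fun Q hQ _ => ?_
    by_cases hp : IsPGroup 2 (F.aut Q)
    · exact FusionSystem.autP_le_of_inner (hF.aut_le_autP hQ hp)
    · obtain ⟨⟨α, hα⟩, ho, h1⟩ := exists_odd_of_not_isPGroup hp
      rw [Subgroup.orderOf_mk] at ho
      obtain rfl := hac.eq_top_of_odd hm ho fun h2 => h1 (Subtype.ext h2)
      intro β hβ
      obtain ⟨γ, hγ, hγβ⟩ := FusionSystem.exists_mem_topAut hβ
      exact (FusionSystem.mem_ofAut (hA := F.conj_le_topAut)).2 ⟨γ, hγ, hγβ⟩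
  · rw [← hσa, h1, MulAut.one_apply]
    exact Subgroup.mem_zpowers a
  obtain ⟨b, ⟨k, -, hb⟩ | hb⟩ := exists_generator_pair_of_odd_mulAut hP hm ho h1
  · exfalso
    refine hac.sq_ne ?_
    have h2 := hac.conj
    rw [hb.mul_comm c a, mul_inv_cancel_right, eq_inv_iff_mul_eq_one, ← sq] at h2
    exact h2
  · obtain ⟨b, hb, hbb⟩ := hb.exists_apply_apply_eq hm ho h1
    obtain ⟨f, hfb, hfc⟩ := hb.exists_equiv_of_pair hac
    refine ⟨f, mulAut_eq_of_generators hac.gen ?_ ?_⟩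
    · change f (α (f.symm a)) = σ a
      rw [← hfb, f.symm_apply_apply, hfc, hfb, hσa]
    · change f (α (f.symm c)) = σ c
      rw [← hfc, f.symm_apply_apply, hbb, map_mul, hfb, hfc, hσc]

end SmallCases

theorem theorem1p1 {P : Type*} [Group P] [Finite P] (hP : IsPGroup 2 P) (hm : IsMetacyclic P) :
    (IsDihedralTwoGroup P ∨ (IsQuaternionTwoGroup P ∧ Nat.card P ≠ 8) →
      FusionSystem.numSaturated 2 P = 3) ∧
    (IsQuaternionTwoGroup P ∧ Nat.card P = 8 → FusionSystem.numSaturated 2 P = 2) ∧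
    (IsSemidihedralTwoGroup P → FusionSystem.numSaturated 2 P = 4) ∧
    (IsHomocyclicTwoGroup P → FusionSystem.numSaturated 2 P = 2) ∧
    (¬ IsDihedralTwoGroup P → ¬ IsQuaternionTwoGroup P → ¬ IsSemidihedralTwoGroup P →
      ¬ IsHomocyclicTwoGroup P →
        ∀ F : FusionSystem P, F.IsSaturated 2 ↔ F = FusionSystem.inner P) := by
  refine ⟨fun h => ?_, fun h => h.1.numSaturated_eq_two hP h.2 hm,
    fun h => h.numSaturated_eq_four hm, fun h => h.numSaturated_eq_two hP hm,
    fun hD hQ hS hH F => ⟨fun hF => ?_, ?_⟩⟩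
  · rcases h with h | ⟨h, h8⟩
    · exact h.numSaturated_eq_three hm
    · exact h.numSaturated_eq_three h8 hm
  · refine hF.eq_inner hP hm hH ?_
    rintro ⟨a, m, h⟩
    rcases h.isDihedral_or_isQuaternion_or_isSemidihedral with h | h | h
    · exact hD h
    · exact hQ h
    · exact hS h
  · rintro rfl
    exact FusionSystem.isSaturated_inner hP
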